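/- Let $M$ be a connected smooth 4-manifold with a smooth Lorentz metric $g$ of signature $(-,+,+,+)$, let $R_{ab}$ be its Ricci tensor and $R=g^{ab}R_{ab}$ its Ricci scalar. Assume that $R_{ab}$ has Segré type $\{1,(111)\}$ at every point: there is a pseudo-orthonormal basis $u,v_2,v_3,v_4$ of the tangent space, with $u$ timelike, consisting of eigenvectors of $R^a{}_b$, such that $v_2,v_3,v_4$ have a common eigenvalue $\rho_2$ and $u$ has an eigenvalue $\rho_1\neq\rho_2$ (no inequalities, such as energy conditions, are imposed on $\rho_1,\rho_2$). Then $(M,g)$ is a Yang Pure Space, i.e. $$\nabla_a R_{bc}-\nabla_b R_{ac}=0 \quad\text{on } M,$$ if and only if $R$ is constant on $M$ and $(M,g)$ is a Robertson–Walker space-time, i.e. there is $k\in\{-1,0,1\}$ such that every point of $M$ has a neighbourhood with smooth coordinates $(u,x,y,z)$ in which $$ds^2=-du^2+\frac{A(u)^2}{\left(1+\frac k4(x^2+y^2+z^2)\right)^2}\,(dx^2+dy^2+dz^2)$$ for some smooth positive function $A$, with $1+\frac k4(x^2+y^2+z^2)>0$. -/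

import Mathlib

open scoped Manifold ContDiff

/-- The model space `ℝ⁴` of coordinates. -/
abbrev R4 : Type := EuclideanSpace ℝ (Fin 4)

namespace Coord

/-! Tensor calculus of a metric on an open subset of `ℝ⁴`, given by its matrix of components
`G x a b = g_{ab}(x)`. -/

/-- The partial derivative `∂ᵢ f` at `x`. -/
noncomputable def pd (i : Fin 4) (f : R4 → ℝ) (x : R4) : ℝ :=
  fderiv ℝ f x (EuclideanSpace.single i 1)

/-- Christoffel symbols of the Levi-Civita connection:
`Γ^a_{bc} = ½ g^{ad} (∂_b g_{dc} + ∂_c g_{db} - ∂_d g_{bc})`. -/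
noncomputable def christoffel (G : R4 → Matrix (Fin 4) (Fin 4) ℝ) (a b c : Fin 4) (x : R4) : ℝ :=
  (1 / 2 : ℝ) * ∑ d, (G x)⁻¹ a d *
    (pd b (fun y => G y d c) x + pd c (fun y => G y d b) x - pd d (fun y => G y b c) x)

/-- Curvature tensor
`R^a_{bcd} = ∂_c Γ^a_{db} - ∂_d Γ^a_{cb} + Γ^a_{ce} Γ^e_{db} - Γ^a_{de} Γ^e_{cb}`. -/
noncomputable def riemann (G : R4 → Matrix (Fin 4) (Fin 4) ℝ) (a b c d : Fin 4) (x : R4) : ℝ :=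
  pd c (christoffel G a d b) x - pd d (christoffel G a c b) x
    + ∑ e, (christoffel G a c e x * christoffel G e d b x
        - christoffel G a d e x * christoffel G e c b x)

/-- Ricci tensor `R_{bd} = R^a_{bad}`. -/
noncomputable def ricci (G : R4 → Matrix (Fin 4) (Fin 4) ℝ) (b d : Fin 4) (x : R4) : ℝ :=
  ∑ a, riemann G a b a d x

/-- Ricci scalar `R = g^{bd} R_{bd}`. -/
noncomputable def ricciScalar (G : R4 → Matrix (Fin 4) (Fin 4) ℝ) (x : R4) : ℝ :=
  ∑ b, ∑ d, (G x)⁻¹ b d * ricci G b d x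

/-- Covariant derivative of the Ricci tensor:
`∇_a R_{bc} = ∂_a R_{bc} - Γ^d_{ab} R_{dc} - Γ^d_{ac} R_{bd}`. -/
noncomputable def covRicci (G : R4 → Matrix (Fin 4) (Fin 4) ℝ) (a b c : Fin 4) (x : R4) : ℝ :=
  pd a (ricci G b c) x
    - ∑ d, (christoffel G d a b x * ricci G d c x + christoffel G d a c x * ricci G b d x)

end Coord

/-- The coordinate vector `∂/∂xⁱ` of the chart `φ`, at the point of `M` with coordinates `x`. -/
noncomputable def coordVector {M : Type*} [TopologicalSpace M] [ChartedSpace R4 M]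
    (φ : OpenPartialHomeomorph M R4) (x : R4) (i : Fin 4) : TangentSpace (𝓡 4) (φ.symm x) :=
  mfderiv (𝓡 4) (𝓡 4) φ.symm x (EuclideanSpace.single i (1 : ℝ))

/-- A smooth Lorentz metric, of signature `(-,+,+,+)`, on a smooth 4-manifold `M`. -/
structure LorentzMetric (M : Type*) [TopologicalSpace M] [ChartedSpace R4 M]
    [IsManifold (𝓡 4) ∞ M] where
  /-- the bilinear form on each tangent space -/
  inner (p : M) : TangentSpace (𝓡 4) p →ₗ[ℝ] TangentSpace (𝓡 4) p →ₗ[ℝ] ℝ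
  symm (p : M) (v w : TangentSpace (𝓡 4) p) : inner p v w = inner p w v
  /-- each tangent space has a pseudo-orthonormal frame -/
  signature (p : M) : ∃ e : Fin 4 → TangentSpace (𝓡 4) p, ∀ i j,
    inner p (e i) (e j) = Matrix.diagonal ![(-1 : ℝ), 1, 1, 1] i j
  /-- the components in every smooth chart are smooth -/
  smooth (φ : OpenPartialHomeomorph M R4) (hφ : φ ∈ IsManifold.maximalAtlas (𝓡 4) ∞ M)
    (i j : Fin 4) : ContDiffOn ℝ ∞
      (fun x => inner (φ.symm x) (coordVector φ x i) (coordVector φ x j)) φ.target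

namespace LorentzMetric

variable {M : Type*} [TopologicalSpace M] [ChartedSpace R4 M] [IsManifold (𝓡 4) ∞ M]

/-- The matrix of components `g_{ij}` of the metric in the chart `φ`, as a function of the
coordinates `x` (meaningful for `x ∈ φ.target`). -/
noncomputable def components (g : LorentzMetric M) (φ : OpenPartialHomeomorph M R4) (x : R4) :
    Matrix (Fin 4) (Fin 4) ℝ :=
  Matrix.of fun i j => g.inner (φ.symm x) (coordVector φ x i) (coordVector φ x j)

/-- Yang's equations `∇_a R_{bc} = ∇_b R_{ac}`, in every smooth chart. -/
def IsYangPureSpace (g : LorentzMetric M) : Prop :=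
  ∀ φ ∈ IsManifold.maximalAtlas (𝓡 4) ∞ M, ∀ x ∈ φ.target, ∀ a b c : Fin 4,
    Coord.covRicci (g.components φ) a b c x = Coord.covRicci (g.components φ) b a c x

/-- The Ricci tensor has Segré type `{1,(111)}` at every point: there is a pseudo-orthonormal
tetrad (the columns of `P`, the first one timelike) of eigenvectors of `R^a_b = g^{ac} R_{cb}`,
with eigenvalue `ρ₁` for the timelike vector and one common eigenvalue `ρ₂ ≠ ρ₁` for the three
spacelike ones. -/
def HasSegreType_1_111 (g : LorentzMetric M) : Prop :=
  ∀ φ ∈ IsManifold.maximalAtlas (𝓡 4) ∞ M, ∀ x ∈ φ.target,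
    ∃ (P : Matrix (Fin 4) (Fin 4) ℝ) (ρ₁ ρ₂ : ℝ), ρ₁ ≠ ρ₂ ∧
      P.transpose * g.components φ x * P = Matrix.diagonal ![-1, 1, 1, 1] ∧
      (g.components φ x)⁻¹ * (Matrix.of fun b c => Coord.ricci (g.components φ) b c x) * P
        = P * Matrix.diagonal ![ρ₁, ρ₂, ρ₂, ρ₂]

/-- The Ricci scalar is constant on `M`. -/
def HasConstantRicciScalar (g : LorentzMetric M) : Prop :=
  ∃ R₀ : ℝ, ∀ φ ∈ IsManifold.maximalAtlas (𝓡 4) ∞ M, ∀ x ∈ φ.target,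
    Coord.ricciScalar (g.components φ) x = R₀

/-- Robertson–Walker geometry: for one curvature index `k ∈ {-1, 0, 1}`, every point of `M` lies
in the domain of a smooth chart `(u, x¹, x², x³)` in which the line element is
`-du² + A(u)² (1 + (k/4) ((x¹)² + (x²)² + (x³)²))⁻² ((dx¹)² + (dx²)² + (dx³)²)`
with a smooth positive function `A`. -/
def IsRobertsonWalker (g : LorentzMetric M) : Prop :=
  ∃ k : ℝ, (k = -1 ∨ k = 0 ∨ k = 1) ∧
    ∀ p : M, ∃ φ ∈ IsManifold.maximalAtlas (𝓡 4) ∞ M, p ∈ φ.source ∧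
      ∃ A : ℝ → ℝ, ContDiffOn ℝ ∞ A ((fun x : R4 => x 0) '' φ.target) ∧
        ∀ x ∈ φ.target, 0 < A (x 0) ∧ 0 < 1 + k / 4 * (x 1 ^ 2 + x 2 ^ 2 + x 3 ^ 2) ∧
          g.components φ x =
            let s : ℝ := A (x 0) ^ 2 / (1 + k / 4 * (x 1 ^ 2 + x 2 ^ 2 + x 3 ^ 2)) ^ 2
            Matrix.diagonal ![-1, s, s, s]

end LorentzMetric

/-! From Yang to Robertson–Walker. The Segré type means Ric = ρ₂ g + σ u⊗u with u a unit timelike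
one-form and σ = ρ₂ − ρ₁ ≠ 0. Contracting Yang's equations gives ∇^a R_ae = ∂_e R, while the
contracted Bianchi identity gives ∂_e R = 2 ∇^a R_ae; so R is locally constant and dσ = 4 dρ₂.
Inserting the form of Ric into Yang's equations is then pure linear algebra at a point
(`yang_algebra`): dρ₂ = Hσu and ∇_a u_b = H (g_ab + u_a u_b). Thus u is geodesic, irrotational and
shear-free (`exists_rwFrame`).

Subtracting an explicit tensor from the Levi-Civita connection leaves a torsion-free connection for
which u is parallel and the spatial metric h = g + u⊗u is parallel up to scale: the connection of
the product of time with space. Its curvature lives on the three-dimensional complement of u and has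
Ricci tensor 2Kh, hence is of constant curvature K on each space section (`curv_prodConn`), and A²K
is constant for the scale factor A with dA = −HAu. Coordinates are found without classifying space
forms: the linear system Hess X = −KhX is flat, so it has local solutions with prescribed value and
differential (`exists_parallel`). Three of them behave like ambient Cartesian coordinates on a
sphere, Euclidean space or hyperboloid (`exists_adapted`), and stereographic projection brings the
metric to the stated form (`exists_isotropic`, `exists_chart`).

One index k must serve all of M. K is expressed by the eigenvalues of Ric and the norm of dρ₂
(`ricCurv`), so it is a scalar of the metric; its sign is locally constant because A²K is, hence
constant as M is connected. The scale of A is then fixed by A²K = k.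

Conversely, in Robertson–Walker coordinates the one-form u = du satisfies ∇u = H(g + u⊗u), so the
Ricci identity makes it a Ricci eigenform. The Segré condition then forces Ric = ρ g + (4ρ − R) u⊗u.
Constant R makes Ric divergence-free, which gives dρ = (4ρ − R)Hu, and this is what makes ∇Ric
symmetric (`yang_of_fluid`). The Ricci tensor of the line element is never computed. -/

namespace Coord

open Filter Topology Matrix

/-! ### Calculus of smooth functions and matrices of functions on `ℝ⁴` -/

/-- Smoothness of a function at every point of a set. -/
def SmoothOn (U : Set R4) (f : R4 → ℝ) : Prop := ∀ x ∈ U, ContDiffAt ℝ ∞ f x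

/-- Smoothness of all entries of a matrix of functions at every point of a set. -/
def MSmoothOn {m n : Type*} (U : Set R4) (F : R4 → Matrix m n ℝ) : Prop :=
  ∀ a b, SmoothOn U (fun y => F y a b)

/-- The entrywise partial derivative of a matrix of functions. -/
noncomputable def mpd {m n : Type*} (i : Fin 4) (F : R4 → Matrix m n ℝ) (x : R4) : Matrix m n ℝ :=
  Matrix.of fun a b => pd i (fun y => F y a b) x

lemma pd_congr {f g : R4 → ℝ} {x : R4} (h : f =ᶠ[𝓝 x] g) (i : Fin 4) : pd i f x = pd i g x := by
  simp only [pd, h.fderiv_eq]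

lemma pd_congr_on {U : Set R4} (hU : IsOpen U) {f g : R4 → ℝ} (h : ∀ y ∈ U, f y = g y) {x : R4}
    (hx : x ∈ U) (i : Fin 4) : pd i f x = pd i g x :=
  pd_congr (Filter.eventuallyEq_of_mem (hU.mem_nhds hx) h) i

lemma mpd_congr_on {m n : Type*} {U : Set R4} (hU : IsOpen U) {F K : R4 → Matrix m n ℝ}
    (h : ∀ y ∈ U, F y = K y) {x : R4} (hx : x ∈ U) (i : Fin 4) : mpd i F x = mpd i K x := by
  ext a b
  exact pd_congr_on hU (fun y hy => by rw [h y hy]) hx i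

@[simp] lemma pd_const (i : Fin 4) (c : ℝ) (x : R4) : pd i (fun _ => c) x = 0 := by
  simp [pd]

@[simp] lemma mpd_const {m n : Type*} (i : Fin 4) (c : Matrix m n ℝ) (x : R4) :
    mpd i (fun _ => c) x = 0 := by
  ext a b; simp [mpd]

lemma pd_add {f g : R4 → ℝ} {x : R4} (i : Fin 4) (hf : DifferentiableAt ℝ f x)
    (hg : DifferentiableAt ℝ g x) : pd i (fun y => f y + g y) x = pd i f x + pd i g x := by
  simp [pd, fderiv_fun_add hf hg]

lemma pd_sub {f g : R4 → ℝ} {x : R4} (i : Fin 4) (hf : DifferentiableAt ℝ f x)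
    (hg : DifferentiableAt ℝ g x) : pd i (fun y => f y - g y) x = pd i f x - pd i g x := by
  simp [pd, fderiv_fun_sub hf hg]

lemma pd_neg {f : R4 → ℝ} {x : R4} (i : Fin 4) : pd i (fun y => - f y) x = - pd i f x := by
  simp [pd, fderiv_fun_neg]

lemma pd_mul {f g : R4 → ℝ} {x : R4} (i : Fin 4) (hf : DifferentiableAt ℝ f x)
    (hg : DifferentiableAt ℝ g x) :
    pd i (fun y => f y * g y) x = pd i f x * g x + f x * pd i g x := by
  simp [pd, fderiv_fun_mul hf hg]; ring

lemma pd_sum {ι : Type*} (s : Finset ι) {f : ι → R4 → ℝ} {x : R4} (i : Fin 4)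
    (hf : ∀ j ∈ s, DifferentiableAt ℝ (f j) x) :
    pd i (fun y => ∑ j ∈ s, f j y) x = ∑ j ∈ s, pd i (f j) x := by
  simp [pd, fderiv_fun_sum hf]

lemma pd_comp {f : R4 → ℝ} {φ : ℝ → ℝ} {φ' : ℝ} {x : R4} (i : Fin 4)
    (hφ : HasDerivAt φ φ' (f x)) (hf : DifferentiableAt ℝ f x) :
    pd i (fun y => φ (f y)) x = φ' * pd i f x := by
  have h := hφ.comp_hasFDerivAt x hf.hasFDerivAt
  have : fderiv ℝ (fun y => φ (f y)) x = φ' • fderiv ℝ f x := h.fderiv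
  simp [pd, this]

lemma fderiv_eq_sum_pd {f : R4 → ℝ} {x : R4} (h : R4) :
    fderiv ℝ f x h = ∑ i, h i * pd i f x := by
  have hh : h = ∑ i, h i • EuclideanSpace.single i (1 : ℝ) := by
    have := (EuclideanSpace.basisFun (Fin 4) ℝ).sum_repr h
    simpa using this.symm
  conv_lhs => rw [hh]
  simp [pd]

lemma eq_zero_of_pd {f : R4 → ℝ} {x : R4} (h : ∀ i, pd i f x = 0) : fderiv ℝ f x = 0 := by
  ext v
  simp [fderiv_eq_sum_pd, h]

namespace SmoothOn

variable {U V : Set R4} {f g : R4 → ℝ}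

lemma mono (hf : SmoothOn U f) (h : V ⊆ U) : SmoothOn V f := fun x hx => hf x (h hx)

lemma differentiableAt (hf : SmoothOn U f) {x : R4} (hx : x ∈ U) : DifferentiableAt ℝ f x :=
  (hf x hx).differentiableAt (by simp)

lemma const (c : ℝ) : SmoothOn U (fun _ => c) := fun _ _ => contDiffAt_const

lemma add (hf : SmoothOn U f) (hg : SmoothOn U g) : SmoothOn U (fun y => f y + g y) :=
  fun x hx => (hf x hx).add (hg x hx)

lemma sub (hf : SmoothOn U f) (hg : SmoothOn U g) : SmoothOn U (fun y => f y - g y) :=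
  fun x hx => (hf x hx).sub (hg x hx)

lemma neg (hf : SmoothOn U f) : SmoothOn U (fun y => - f y) :=
  fun x hx => (hf x hx).neg

lemma mul (hf : SmoothOn U f) (hg : SmoothOn U g) : SmoothOn U (fun y => f y * g y) :=
  fun x hx => (hf x hx).mul (hg x hx)

lemma div (hf : SmoothOn U f) (hg : SmoothOn U g) (h : ∀ x ∈ U, g x ≠ 0) :
    SmoothOn U (fun y => f y / g y) :=
  fun x hx => (hf x hx).div (hg x hx) (h x hx)

lemma pow (hf : SmoothOn U f) (n : ℕ) : SmoothOn U (fun y => f y ^ n) :=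
  fun x hx => (hf x hx).pow n

lemma sum {ι : Type*} {s : Finset ι} {f : ι → R4 → ℝ} (hf : ∀ j ∈ s, SmoothOn U (f j)) :
    SmoothOn U (fun y => ∑ j ∈ s, f j y) :=
  fun x hx => ContDiffAt.sum fun j hj => hf j hj x hx

lemma prod {ι : Type*} {s : Finset ι} {f : ι → R4 → ℝ} (hf : ∀ j ∈ s, SmoothOn U (f j)) :
    SmoothOn U (fun y => ∏ j ∈ s, f j y) :=
  fun x hx => contDiffAt_prod fun j hj => hf j hj x hx

lemma congr (hU : IsOpen U) (hf : SmoothOn U f) (h : ∀ y ∈ U, g y = f y) : SmoothOn U g :=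
  fun x hx => (hf x hx).congr_of_eventuallyEq (Filter.eventuallyEq_of_mem (hU.mem_nhds hx) h)

lemma pd (hf : SmoothOn U f) (i : Fin 4) : SmoothOn U (Coord.pd i f) := fun x hx =>
  ((hf x hx).fderiv_right (m := ∞) (by simp)).clm_apply contDiffAt_const

lemma continuousOn (hf : SmoothOn U f) : ContinuousOn f U :=
  fun x hx => (hf x hx).continuousAt.continuousWithinAt

lemma pd_comm (hf : SmoothOn U f) {x : R4} (hx : x ∈ U) (i j : Fin 4) :
    Coord.pd i (Coord.pd j f) x = Coord.pd j (Coord.pd i f) x := by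
  have hs : IsSymmSndFDerivAt ℝ f x := (hf x hx).isSymmSndFDerivAt <| by
    rw [minSmoothness_of_isRCLikeNormedField]; exact ENat.LEInfty.out
  have hd : DifferentiableAt ℝ (fderiv ℝ f) x :=
    ((hf x hx).fderiv_right (m := ∞) (by simp)).differentiableAt (by simp)
  have key : ∀ i j : Fin 4, Coord.pd i (Coord.pd j f) x =
      fderiv ℝ (fderiv ℝ f) x (EuclideanSpace.single i 1) (EuclideanSpace.single j 1) := by
    intro i j
    have : HasFDerivAt (Coord.pd j f)
      ((ContinuousLinearMap.apply ℝ ℝ (EuclideanSpace.single j (1 : ℝ))).comp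
        (fderiv ℝ (fderiv ℝ f) x)) x :=
      (ContinuousLinearMap.apply ℝ ℝ (EuclideanSpace.single j (1 : ℝ))).hasFDerivAt.comp x
        hd.hasFDerivAt
    rw [Coord.pd, this.fderiv]
    rfl
  rw [key, key]
  exact hs _ _

lemma exp (hf : SmoothOn U f) : SmoothOn U (fun y => Real.exp (f y)) :=
  fun x hx => (hf x hx).exp

lemma sqrt (hf : SmoothOn U f) (h : ∀ x ∈ U, f x ≠ 0) : SmoothOn U (fun y => Real.sqrt (f y)) :=
  fun x hx => (hf x hx).sqrt (h x hx)

end SmoothOn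

lemma pd_coord (i j : Fin 4) (x : R4) : pd i (fun y => y j) x = if j = i then 1 else 0 := by
  have : fderiv ℝ (fun y : R4 => y j) x = (EuclideanSpace.proj j : R4 →L[ℝ] ℝ) :=
    (EuclideanSpace.proj j : R4 →L[ℝ] ℝ).fderiv
  simp [pd, this]

lemma pd_div {f g : R4 → ℝ} {x : R4} (i : Fin 4) (hf : DifferentiableAt ℝ f x)
    (hg : DifferentiableAt ℝ g x) (h0 : g x ≠ 0) :
    pd i (fun y => f y / g y) x = (pd i f x * g x - f x * pd i g x) / g x ^ 2 := by
  have h1 : pd i (fun y => (g y)⁻¹) x = -(g x ^ 2)⁻¹ * pd i g x :=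
    pd_comp i (hasDerivAt_inv h0) hg
  simp only [div_eq_mul_inv]
  rw [pd_mul (f := f) (g := fun y => (g y)⁻¹) i hf (hg.inv h0), h1]
  field_simp
  ring

namespace MSmoothOn

variable {l m n : Type*} {U V : Set R4}

lemma mono {F : R4 → Matrix m n ℝ} (hF : MSmoothOn U F) (h : V ⊆ U) : MSmoothOn V F :=
  fun a b => (hF a b).mono h

lemma const (C : Matrix m n ℝ) : MSmoothOn U (fun _ => C) := fun _ _ => SmoothOn.const _

lemma add {F K : R4 → Matrix m n ℝ} (hF : MSmoothOn U F) (hK : MSmoothOn U K) :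
    MSmoothOn U (fun y => F y + K y) := fun a b => (hF a b).add (hK a b)

lemma sub {F K : R4 → Matrix m n ℝ} (hF : MSmoothOn U F) (hK : MSmoothOn U K) :
    MSmoothOn U (fun y => F y - K y) := fun a b => (hF a b).sub (hK a b)

lemma smul {f : R4 → ℝ} {F : R4 → Matrix m n ℝ} (hf : SmoothOn U f) (hF : MSmoothOn U F) :
    MSmoothOn U (fun y => f y • F y) := fun a b => hf.mul (hF a b)

lemma mul [Fintype m] {F : R4 → Matrix l m ℝ} {K : R4 → Matrix m n ℝ} (hF : MSmoothOn U F)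
    (hK : MSmoothOn U K) : MSmoothOn U (fun y => F y * K y) := fun a b => by
  simp only [Matrix.mul_apply]
  exact SmoothOn.sum fun j _ => (hF a j).mul (hK j b)

lemma transpose {F : R4 → Matrix m n ℝ} (hF : MSmoothOn U F) :
    MSmoothOn U (fun y => (F y)ᵀ) := fun a b => hF b a

lemma sum {ι : Type*} {s : Finset ι} {F : ι → R4 → Matrix m n ℝ}
    (hF : ∀ j ∈ s, MSmoothOn U (F j)) : MSmoothOn U (fun y => ∑ j ∈ s, F j y) := fun a b => by
  simp only [Matrix.sum_apply]
  exact SmoothOn.sum fun j hj => hF j hj a b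

lemma congr (hU : IsOpen U) {F K : R4 → Matrix m n ℝ} (hF : MSmoothOn U F)
    (h : ∀ y ∈ U, K y = F y) : MSmoothOn U K :=
  fun a b => (hF a b).congr hU fun y hy => by rw [h y hy]

lemma mpd {F : R4 → Matrix m n ℝ} (hF : MSmoothOn U F) (i : Fin 4) :
    MSmoothOn U (Coord.mpd i F) := fun a b => (hF a b).pd i

lemma det [Fintype n] [DecidableEq n] {F : R4 → Matrix n n ℝ} (hF : MSmoothOn U F) :
    SmoothOn U (fun y => (F y).det) := by
  simp only [Matrix.det_apply']
  exact SmoothOn.sum fun σ _ => (SmoothOn.const _).mul (SmoothOn.prod fun j _ => hF _ _)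

lemma trace [Fintype n] {F : R4 → Matrix n n ℝ} (hF : MSmoothOn U F) :
    SmoothOn U (fun y => (F y).trace) := by
  simp only [Matrix.trace, Matrix.diag]
  exact SmoothOn.sum fun j _ => hF j j

/-- Cramer's rule: entries of the inverse are entries of the adjugate, themselves determinants, over
the determinant. -/
lemma inv [Fintype n] [DecidableEq n] {F : R4 → Matrix n n ℝ} (hF : MSmoothOn U F)
    (h : ∀ x ∈ U, IsUnit (F x).det) : MSmoothOn U (fun y => (F y)⁻¹) := fun a b => by
  have h2 : SmoothOn U (fun y => (F y).adjugate a b) := by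
    have : (fun y => (F y).adjugate a b) = fun y => ((F y).updateRow b (Pi.single a 1)).det := by
      funext y; rw [Matrix.adjugate_apply]
    rw [this]
    apply MSmoothOn.det (F := fun y => (F y).updateRow b (Pi.single a 1))
    intro c d
    by_cases hc : c = b
    · subst hc
      simpa using SmoothOn.const (U := U) _
    · simpa [Matrix.updateRow_ne hc] using hF c d
  -- Valid at singular points too, where both sides are 0 by the conventions on inverses.
  have h3 : (fun y => (F y)⁻¹ a b) = fun y => (F y).adjugate a b / (F y).det := by
    funext y
    rw [Matrix.inv_def, Matrix.smul_apply, Ring.inverse_eq_inv', smul_eq_mul]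
    ring
  simp only [h3]
  exact h2.div hF.det fun x hx => (h x hx).ne_zero

end MSmoothOn

section mpd

variable {l m n : Type*} {U : Set R4} {x : R4} (i : Fin 4)

lemma mpd_add {F K : R4 → Matrix m n ℝ} (hF : MSmoothOn U F) (hK : MSmoothOn U K) (hx : x ∈ U) :
    mpd i (fun y => F y + K y) x = mpd i F x + mpd i K x := by
  ext a b
  exact pd_add i ((hF a b).differentiableAt hx) ((hK a b).differentiableAt hx)

lemma mpd_sub {F K : R4 → Matrix m n ℝ} (hF : MSmoothOn U F) (hK : MSmoothOn U K) (hx : x ∈ U) :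
    mpd i (fun y => F y - K y) x = mpd i F x - mpd i K x := by
  ext a b
  exact pd_sub i ((hF a b).differentiableAt hx) ((hK a b).differentiableAt hx)

lemma mpd_neg {F : R4 → Matrix m n ℝ} : mpd i (fun y => - F y) x = - mpd i F x := by
  ext a b
  exact pd_neg i

lemma mpd_smul {f : R4 → ℝ} {F : R4 → Matrix m n ℝ} (hf : SmoothOn U f) (hF : MSmoothOn U F)
    (hx : x ∈ U) : mpd i (fun y => f y • F y) x = pd i f x • F x + f x • mpd i F x := by
  ext a b
  exact pd_mul i (hf.differentiableAt hx) ((hF a b).differentiableAt hx)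

lemma mpd_mul [Fintype m] {F : R4 → Matrix l m ℝ} {K : R4 → Matrix m n ℝ} (hF : MSmoothOn U F)
    (hK : MSmoothOn U K) (hx : x ∈ U) :
    mpd i (fun y => F y * K y) x = mpd i F x * K x + F x * mpd i K x := by
  ext a b
  simp only [mpd, Matrix.of_apply, Matrix.mul_apply, Matrix.add_apply]
  rw [pd_sum, ← Finset.sum_add_distrib]
  · exact Finset.sum_congr rfl fun j _ =>
      pd_mul i ((hF a j).differentiableAt hx) ((hK j b).differentiableAt hx)
  · exact fun j _ => ((hF a j).differentiableAt hx).mul ((hK j b).differentiableAt hx)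

lemma mpd_sum {ι : Type*} (s : Finset ι) {F : ι → R4 → Matrix m n ℝ}
    (hF : ∀ j ∈ s, MSmoothOn U (F j)) (hx : x ∈ U) :
    mpd i (fun y => ∑ j ∈ s, F j y) x = ∑ j ∈ s, mpd i (F j) x := by
  ext a b
  simp only [mpd, Matrix.of_apply, Matrix.sum_apply]
  exact pd_sum s i fun j hj => (hF j hj a b).differentiableAt hx

lemma mpd_transpose {F : R4 → Matrix m n ℝ} :
    mpd i (fun y => (F y)ᵀ) x = (mpd i F x)ᵀ := rfl

lemma mpd_comm {F : R4 → Matrix m n ℝ} (hF : MSmoothOn U F) (hx : x ∈ U) (j : Fin 4) :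
    mpd i (mpd j F) x = mpd j (mpd i F) x := by
  ext a b
  exact (hF a b).pd_comm hx i j

lemma mpd_inv [Fintype n] [DecidableEq n] (hU : IsOpen U) {F : R4 → Matrix n n ℝ}
    (hF : MSmoothOn U F) (h : ∀ x ∈ U, IsUnit (F x).det) (hx : x ∈ U) :
    mpd i (fun y => (F y)⁻¹) x = - ((F x)⁻¹ * mpd i F x * (F x)⁻¹) := by
  have h1 : mpd i (fun y => (F y)⁻¹ * F y) x = 0 := by
    rw [mpd_congr_on hU (fun y hy => Matrix.nonsing_inv_mul _ (h y hy)) hx, mpd_const]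
  rw [mpd_mul i (hF.inv h) hF hx] at h1
  have h2 := congrArg (· * (F x)⁻¹) h1
  simp only [add_mul, zero_mul, Matrix.mul_assoc, Matrix.mul_nonsing_inv _ (h x hx),
    Matrix.mul_one] at h2
  rw [Matrix.mul_assoc]
  exact eq_neg_of_add_eq_zero_left h2

end mpd

end Coord

namespace Coord

open Filter Topology Matrix

/-! ### The Levi-Civita connection and its curvature -/

/-- A smooth symmetric nondegenerate matrix of components on an open set. -/
structure IsMetricOn (U : Set R4) (G : R4 → Matrix (Fin 4) (Fin 4) ℝ) : Prop where
  isOpen : IsOpen U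
  smooth : MSmoothOn U G
  symm : ∀ x ∈ U, (G x)ᵀ = G x
  det : ∀ x ∈ U, IsUnit (G x).det

/-- The matrix `(Γ_c)^a_b` of Christoffel symbols. -/
noncomputable def chr (G : R4 → Matrix (Fin 4) (Fin 4) ℝ) (c : Fin 4) (x : R4) :
    Matrix (Fin 4) (Fin 4) ℝ := Matrix.of fun a b => christoffel G a c b x

/-- The curvature `∂_c Γ_d - ∂_d Γ_c + [Γ_c, Γ_d]` of a connection on the trivial bundle. -/
noncomputable def curv {n : Type*} [Fintype n] (Γ : Fin 4 → R4 → Matrix n n ℝ) (c d : Fin 4)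
    (x : R4) : Matrix n n ℝ :=
  mpd c (Γ d) x - mpd d (Γ c) x + Γ c x * Γ d x - Γ d x * Γ c x

/-- The matrix of components of the Ricci tensor. -/
noncomputable def ric (G : R4 → Matrix (Fin 4) (Fin 4) ℝ) (x : R4) : Matrix (Fin 4) (Fin 4) ℝ :=
  Matrix.of fun b d => ricci G b d x

/-- The covariant derivative of a field of bilinear forms. -/
noncomputable def covB (Γ : Fin 4 → R4 → Matrix (Fin 4) (Fin 4) ℝ) (c : Fin 4)
    (B : R4 → Matrix (Fin 4) (Fin 4) ℝ) (x : R4) : Matrix (Fin 4) (Fin 4) ℝ :=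
  mpd c B x - (Γ c x)ᵀ * B x - B x * Γ c x

/-- The Christoffel symbols of the first kind. -/
noncomputable def chrLow (G : R4 → Matrix (Fin 4) (Fin 4) ℝ) (c : Fin 4) (x : R4) :
    Matrix (Fin 4) (Fin 4) ℝ :=
  Matrix.of fun a b => (1 / 2 : ℝ) * (mpd c G x a b + mpd b G x a c - mpd a G x c b)

lemma chr_eq (G : R4 → Matrix (Fin 4) (Fin 4) ℝ) (c : Fin 4) (x : R4) :
    chr G c x = (G x)⁻¹ * chrLow G c x := by
  ext a b
  simp only [chr, christoffel, chrLow, Matrix.of_apply, Matrix.mul_apply, mpd, Finset.mul_sum]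
  exact Finset.sum_congr rfl fun d _ => by ring

lemma riemann_eq_curv (G : R4 → Matrix (Fin 4) (Fin 4) ℝ) (a b c d : Fin 4) (x : R4) :
    riemann G a b c d x = curv (chr G) c d x a b := by
  simp only [riemann, curv, Matrix.sub_apply, Matrix.add_apply, Matrix.mul_apply,
    Finset.sum_sub_distrib]
  simp only [mpd, chr, Matrix.of_apply]
  ring

lemma ric_apply (G : R4 → Matrix (Fin 4) (Fin 4) ℝ) (b d : Fin 4) (x : R4) :
    ric G x b d = ∑ a, curv (chr G) a d x a b := by
  simp [ric, ricci, riemann_eq_curv]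

lemma covRicci_eq (G : R4 → Matrix (Fin 4) (Fin 4) ℝ) (a b c : Fin 4) (x : R4) :
    covRicci G a b c x = covB (chr G) a (ric G) x b c := by
  simp only [covRicci, covB, Matrix.sub_apply, Matrix.mul_apply, Matrix.transpose_apply,
    Finset.sum_add_distrib, mpd, ric, chr, Matrix.of_apply]
  rw [sub_sub]
  congr 2
  exact Finset.sum_congr rfl fun d _ => mul_comm _ _

lemma ricciScalar_eq (G : R4 → Matrix (Fin 4) (Fin 4) ℝ) {x : R4} (h : (ric G x)ᵀ = ric G x) :
    ricciScalar G x = ((G x)⁻¹ * ric G x).trace := by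
  simp only [ricciScalar, Matrix.trace, Matrix.diag, Matrix.mul_apply]
  refine Finset.sum_congr rfl fun b _ => Finset.sum_congr rfl fun d _ => ?_
  congr 1
  exact (congrFun (congrFun h d) b)

lemma curv_antisymm {n : Type*} [Fintype n] (Γ : Fin 4 → R4 → Matrix n n ℝ) (c d : Fin 4)
    (x : R4) : curv Γ c d x = - curv Γ d c x := by
  simp only [curv]; abel

section general

variable {n : Type*} [Fintype n] {U : Set R4} {Γ : Fin 4 → R4 → Matrix n n ℝ} {x : R4}

lemma curv_smooth (hΓ : ∀ c, MSmoothOn U (Γ c)) (c d : Fin 4) : MSmoothOn U (curv Γ c d) :=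
  ((((hΓ d).mpd c).sub ((hΓ c).mpd d)).add ((hΓ c).mul (hΓ d))).sub ((hΓ d).mul (hΓ c))

/-- The second Bianchi identity. -/
lemma second_bianchi (hΓ : ∀ c, MSmoothOn U (Γ c)) (hx : x ∈ U) (e c d : Fin 4) :
    (mpd e (curv Γ c d) x + Γ e x * curv Γ c d x - curv Γ c d x * Γ e x)
      + (mpd c (curv Γ d e) x + Γ c x * curv Γ d e x - curv Γ d e x * Γ c x)
      + (mpd d (curv Γ e c) x + Γ d x * curv Γ e c x - curv Γ e c x * Γ d x) = 0 := by
  have key : ∀ e c d, mpd e (curv Γ c d) x = mpd e (mpd c (Γ d)) x - mpd e (mpd d (Γ c)) x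
      + (mpd e (Γ c) x * Γ d x + Γ c x * mpd e (Γ d) x)
      - (mpd e (Γ d) x * Γ c x + Γ d x * mpd e (Γ c) x) := by
    intro e c d
    have h : curv Γ c d = fun y => (mpd c (Γ d) y - mpd d (Γ c) y + Γ c y * Γ d y)
      - Γ d y * Γ c y := rfl
    rw [h, mpd_sub (U := U) e _ ((hΓ d).mul (hΓ c)) hx,
      mpd_add (U := U) e _ ((hΓ c).mul (hΓ d)) hx,
      mpd_sub (U := U) e ((hΓ d).mpd c) ((hΓ c).mpd d) hx, mpd_mul e (hΓ c) (hΓ d) hx,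
      mpd_mul e (hΓ d) (hΓ c) hx]
    · exact ((hΓ d).mpd c).sub ((hΓ c).mpd d)
    · exact (((hΓ d).mpd c).sub ((hΓ c).mpd d)).add ((hΓ c).mul (hΓ d))
  -- Second derivatives of Γ cancel in pairs by symmetry; the quadratic and cubic terms cancel as in
  -- the Jacobi identity. No torsion condition enters.
  rw [key e c d, key c d e, key d e c, mpd_comm c (hΓ e) hx d, mpd_comm e (hΓ d) hx c,
    mpd_comm d (hΓ c) hx e]
  simp only [curv]
  noncomm_ring

end general

section torsionFree

variable {U : Set R4} {Γ : Fin 4 → R4 → Matrix (Fin 4) (Fin 4) ℝ} {x : R4}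

/-- The first Bianchi identity. -/
lemma first_bianchi (hU : IsOpen U) (hsym : ∀ y ∈ U, ∀ a b c, Γ c y a b = Γ b y a c)
    (hx : x ∈ U) (a b c d : Fin 4) :
    curv Γ c d x a b + curv Γ d b x a c + curv Γ b c x a d = 0 := by
  -- Vanishing torsion lets the lower index of Γ_d be exchanged with d, both in ∂_c Γ_d and in Γ_c
  -- Γ_d; the terms of the cyclic sum then cancel in pairs.
  have hp : ∀ a b c d, mpd c (Γ d) x a b = mpd c (Γ b) x a d := fun a b c d =>
    pd_congr_on hU (fun y hy => hsym y hy a b d) hx c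
  have hm : ∀ c d b, (Γ c x * Γ d x) a b = (Γ c x * Γ b x) a d := fun c d b => by
    simp only [Matrix.mul_apply]
    exact Finset.sum_congr rfl fun e _ => by rw [hsym x hx e b d]
  simp only [curv, Matrix.sub_apply, Matrix.add_apply]
  rw [hp a b c d, hp a b d c, hp a c b d, hm c d b, hm d c b, hm b d c]
  ring

end torsionFree

/-- If a connection preserves a bilinear form then so does its curvature. -/
lemma curv_preserves {U : Set R4} (hU : IsOpen U) {Γ : Fin 4 → R4 → Matrix (Fin 4) (Fin 4) ℝ}
    {B : R4 → Matrix (Fin 4) (Fin 4) ℝ} (hΓ : ∀ c, MSmoothOn U (Γ c)) (hB : MSmoothOn U B)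
    (hc : ∀ y ∈ U, ∀ c, mpd c B y = (Γ c y)ᵀ * B y + B y * Γ c y) {x : R4} (hx : x ∈ U)
    (c d : Fin 4) : (curv Γ c d x)ᵀ * B x + B x * curv Γ c d x = 0 := by
  have key : ∀ c d, mpd d (mpd c B) x = (mpd d (Γ c) x)ᵀ * B x + (Γ c x)ᵀ * mpd d B x
      + (mpd d B x * Γ c x + B x * mpd d (Γ c) x) := by
    intro c d
    rw [mpd_congr_on hU (fun y hy => hc y hy c) hx d,
      mpd_add (U := U) d ((hΓ c).transpose.mul hB) (hB.mul (hΓ c)) hx,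
      mpd_mul d (hΓ c).transpose hB hx, mpd_mul d hB (hΓ c) hx, mpd_transpose]
  -- Mixed derivatives of B commute. After substituting the equation for ∂B twice the products ΓᵀBΓ
  -- cancel, and what is left is the curvature acting on B.
  have h := mpd_comm c hB hx d
  rw [key, key, hc x hx, hc x hx] at h
  simp only [curv, Matrix.transpose_sub, Matrix.transpose_add, Matrix.transpose_mul]
  rw [← sub_eq_zero] at h
  rw [← h]
  noncomm_ring

namespace IsMetricOn

variable {U : Set R4} {G : R4 → Matrix (Fin 4) (Fin 4) ℝ} {x : R4}

lemma mono (hG : IsMetricOn U G) {V : Set R4} (hV : IsOpen V) (h : V ⊆ U) : IsMetricOn V G :=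
  ⟨hV, hG.smooth.mono h, fun x hx => hG.symm x (h hx), fun x hx => hG.det x (h hx)⟩

lemma mpd_symm (hG : IsMetricOn U G) (hx : x ∈ U) (c a b : Fin 4) :
    mpd c G x a b = mpd c G x b a :=
  pd_congr_on hG.isOpen (fun y hy => (congrFun (congrFun (hG.symm y hy) a) b).symm) hx c

lemma mul_chr (hG : IsMetricOn U G) (hx : x ∈ U) (c : Fin 4) :
    G x * chr G c x = chrLow G c x := by
  rw [chr_eq, ← Matrix.mul_assoc, Matrix.mul_nonsing_inv _ (hG.det x hx), Matrix.one_mul]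

lemma chr_symm (hG : IsMetricOn U G) (hx : x ∈ U) (a b c : Fin 4) :
    chr G c x a b = chr G b x a c := by
  simp only [chr_eq, Matrix.mul_apply]
  refine Finset.sum_congr rfl fun d _ => ?_
  simp only [chrLow, Matrix.of_apply]
  rw [hG.mpd_symm hx d c b]
  ring

lemma inv_symm (hG : IsMetricOn U G) (hx : x ∈ U) : ((G x)⁻¹)ᵀ = (G x)⁻¹ := by
  rw [Matrix.transpose_nonsing_inv, hG.symm x hx]

/-- The Levi-Civita connection is metric. -/
lemma mpd_eq (hG : IsMetricOn U G) (hx : x ∈ U) (c : Fin 4) :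
    mpd c G x = (chr G c x)ᵀ * G x + G x * chr G c x := by
  have h : (chr G c x)ᵀ * G x = (chrLow G c x)ᵀ := by
    rw [← hG.mul_chr hx, Matrix.transpose_mul, hG.symm x hx]
  rw [h, hG.mul_chr hx]
  ext a b
  simp only [chrLow, Matrix.add_apply, Matrix.transpose_apply, Matrix.of_apply]
  rw [hG.mpd_symm hx c b a, hG.mpd_symm hx b c a, hG.mpd_symm hx a c b]
  ring

/-- The Levi-Civita connection is the only metric torsion-free connection. -/
lemma chr_unique (hG : IsMetricOn U G) (hx : x ∈ U) (Γ : Fin 4 → Matrix (Fin 4) (Fin 4) ℝ)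
    (hsym : ∀ a b c, Γ c a b = Γ b a c)
    (hc : ∀ c, mpd c G x = (Γ c)ᵀ * G x + G x * Γ c) (c : Fin 4) : chr G c x = Γ c := by
  have h1 : ∀ c a b, mpd c G x a b = (G x * Γ c) b a + (G x * Γ c) a b := by
    intro c a b
    have h := congrFun (congrFun (hc c) a) b
    rw [h, Matrix.add_apply]
    congr 1
    have : (Γ c)ᵀ * G x = (G x * Γ c)ᵀ := by rw [Matrix.transpose_mul, hG.symm x hx]
    rw [this, Matrix.transpose_apply]
  have h2 : ∀ a b c, (G x * Γ c) a b = (G x * Γ b) a c := by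
    intro a b c
    simp only [Matrix.mul_apply]
    exact Finset.sum_congr rfl fun d _ => by rw [hsym d b c]
  -- Koszul's formula: with S_c = GΓ_c, metricity expresses ∂_c g through S and vanishing torsion
  -- symmetrises S, so the combination defining `chrLow` isolates S_c.
  have h3 : chrLow G c x = G x * Γ c := by
    ext a b
    simp only [chrLow, Matrix.of_apply, h1]
    rw [h2 b a c, h2 c a b, h2 a c b]
    ring
  rw [chr_eq, h3, ← Matrix.mul_assoc, Matrix.nonsing_inv_mul _ (hG.det x hx), Matrix.one_mul]

lemma smooth_inv (hG : IsMetricOn U G) : MSmoothOn U (fun y => (G y)⁻¹) := hG.smooth.inv hG.det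

lemma smooth_chr (hG : IsMetricOn U G) (c : Fin 4) : MSmoothOn U (chr G c) := by
  have h : chr G c = fun y => (G y)⁻¹ * chrLow G c y := by
    funext y; exact chr_eq G c y
  rw [h]
  refine hG.smooth_inv.mul fun a b => ?_
  exact (SmoothOn.const _).mul
    (((hG.smooth a b).pd c |>.add ((hG.smooth a c).pd b)).sub ((hG.smooth c b).pd a))

lemma smooth_ric (hG : IsMetricOn U G) : MSmoothOn U (ric G) := by
  have h : ric G = fun y => Matrix.of fun b d => ∑ a, curv (chr G) a d y a b := by
    funext y; ext b d; exact ric_apply G b d y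
  rw [h]
  exact fun b d => SmoothOn.sum (s := Finset.univ) fun a _ => curv_smooth hG.smooth_chr a d a b

lemma mpd_inv_eq (hG : IsMetricOn U G) (hx : x ∈ U) (c : Fin 4) :
    mpd c (fun y => (G y)⁻¹) x = - (chr G c x * (G x)⁻¹) - (G x)⁻¹ * (chr G c x)ᵀ := by
  rw [mpd_inv c hG.isOpen hG.smooth hG.det hx, hG.mpd_eq hx c]
  have h1 := Matrix.nonsing_inv_mul _ (hG.det x hx)
  have h2 := Matrix.mul_nonsing_inv _ (hG.det x hx)
  rw [Matrix.mul_add, Matrix.add_mul, ← Matrix.mul_assoc ((G x)⁻¹) (G x), h1, Matrix.one_mul,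
    Matrix.mul_assoc (G x)⁻¹ (_ * G x), Matrix.mul_assoc _ (G x), h2, Matrix.mul_one]
  abel

/-- The contravariantly raised curvature matrix is antisymmetric. -/
lemma curv_mul_inv_antisymm (hG : IsMetricOn U G) (hx : x ∈ U) (c d : Fin 4) :
    (curv (chr G) c d x * (G x)⁻¹)ᵀ = - (curv (chr G) c d x * (G x)⁻¹) := by
  have h := curv_preserves hG.isOpen hG.smooth_chr hG.smooth (fun y hy c => hG.mpd_eq hy c) hx c d
  have h1 := Matrix.nonsing_inv_mul _ (hG.det x hx)
  have h2 := Matrix.mul_nonsing_inv _ (hG.det x hx)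
  have h3 := congrArg (fun M => (G x)⁻¹ * M * (G x)⁻¹) h
  simp only [Matrix.mul_add, Matrix.add_mul, Matrix.mul_zero, Matrix.zero_mul] at h3
  rw [← Matrix.mul_assoc (G x)⁻¹ (G x), h1, Matrix.one_mul,
    Matrix.mul_assoc (G x)⁻¹ (_ * G x), Matrix.mul_assoc _ (G x), h2, Matrix.mul_one] at h3
  rw [Matrix.transpose_mul, hG.inv_symm hx]
  exact eq_neg_of_add_eq_zero_left h3

end IsMetricOn

end Coord

/-! ### Contracted Bianchi identity and constancy of the Ricci scalar. -/

namespace Coord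

open Filter Topology Matrix

namespace IsMetricOn

variable {U : Set R4} {G : R4 → Matrix (Fin 4) (Fin 4) ℝ} {x : R4}

/-- The Ricci tensor as a contraction of the twice contravariant curvature. -/
lemma sum_curv_mul_inv (hG : IsMetricOn U G) (hx : x ∈ U) (f d : Fin 4) :
    ∑ a, (curv (chr G) a d x * (G x)⁻¹) a f = ((G x)⁻¹ * ric G x) f d := by
  simp only [Matrix.mul_apply]
  rw [Finset.sum_comm]
  refine Finset.sum_congr rfl fun b _ => ?_
  rw [← Finset.sum_mul, ric_apply, mul_comm]
  congr 1
  exact congrFun (congrFun (hG.inv_symm hx) f) b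

lemma sum_curv_mul_inv' (hG : IsMetricOn U G) (hx : x ∈ U) (f a : Fin 4) :
    ∑ d, (curv (chr G) a d x * (G x)⁻¹) f d = ((G x)⁻¹ * ric G x) f a := by
  rw [← hG.sum_curv_mul_inv hx]
  refine Finset.sum_congr rfl fun d _ => ?_
  have h := congrFun (congrFun (hG.curv_mul_inv_antisymm hx a d) d) f
  rw [Matrix.transpose_apply] at h
  rw [h, curv_antisymm _ d a, Matrix.neg_mul]

/-- The twice contracted second Bianchi identity. -/
lemma contracted_bianchi (hG : IsMetricOn U G) (hx : x ∈ U) (e : Fin 4) :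
    pd e (fun y => ((G y)⁻¹ * ric G y).trace) x =
      2 * ∑ a, (mpd a (fun y => (G y)⁻¹ * ric G y) x + chr G a x * ((G x)⁻¹ * ric G x)
        - ((G x)⁻¹ * ric G x) * chr G a x) a e := by
  set T : R4 → Matrix (Fin 4) (Fin 4) ℝ := fun y => (G y)⁻¹ * ric G y with hT
  -- A is the curvature R^{af}_{cd} with both matrix indices raised. It is antisymmetric in each
  -- pair, so every mixed contraction is the Ricci endomorphism T up to sign.
  let A : Fin 4 → Fin 4 → R4 → Matrix (Fin 4) (Fin 4) ℝ := fun c d y => curv (chr G) c d y * (G y)⁻¹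
  have hA : ∀ c d, MSmoothOn U (A c d) := fun c d => (curv_smooth hG.smooth_chr c d).mul hG.smooth_inv
  have hA1 : ∀ c d, ∀ y ∈ U, ∀ a b, A c d y a b = - A c d y b a := fun c d y hy a b =>
    congrFun (congrFun (hG.curv_mul_inv_antisymm hy c d) b) a
  have hT1 : ∀ y ∈ U, ∀ f d, ∑ a, A a d y a f = T y f d := fun y hy => hG.sum_curv_mul_inv hy
  have hT2 : ∀ y ∈ U, ∀ f a, ∑ d, A a d y f d = T y f a := fun y hy => hG.sum_curv_mul_inv' hy
  have hA2 : ∀ c d y, A c d y = - A d c y := fun c d y => by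
    simp only [A]; rw [curv_antisymm, Matrix.neg_mul]
  have hT3 : ∀ y ∈ U, ∀ f a, ∑ d, A d a y f d = - T y f a := fun y hy f a => by
    rw [← hT2 y hy, ← Finset.sum_neg_distrib]
    exact Finset.sum_congr rfl fun d _ => by rw [hA2 d a]; rfl
  -- The covariant derivative of A in its upper indices only. The second Bianchi identity holds
  -- without the corrections for c and d; the price is the Γ-terms that appear in the traces `hF`
  -- and `hE`.
  let D : Fin 4 → Fin 4 → Fin 4 → Matrix (Fin 4) (Fin 4) ℝ := fun e c d =>
    mpd e (A c d) x + chr G e x * A c d x + A c d x * (chr G e x)ᵀ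
  have hD : ∀ e c d, D e c d = (mpd e (curv (chr G) c d) x + chr G e x * curv (chr G) c d x
      - curv (chr G) c d x * chr G e x) * (G x)⁻¹ := by
    intro e c d
    simp only [D, A]
    rw [mpd_mul e (curv_smooth hG.smooth_chr c d) hG.smooth_inv hx, hG.mpd_inv_eq hx]
    noncomm_ring
  have hB : ∀ e c d, D e c d + D c d e + D d e c = 0 := by
    intro e c d
    rw [hD, hD, hD, ← add_mul, ← add_mul, second_bianchi hG.smooth_chr hx, zero_mul]
  have hDanti : ∀ e c d a b, D e c d a b = D e d c b a := by
    intro e c d a b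
    have h1 : mpd e (A c d) x a b = mpd e (A d c) x b a :=
      pd_congr_on hG.isOpen (fun y hy => by rw [hA1 c d y hy, hA2 c d]; simp) hx e
    have h2 : ∀ a b, A c d x a b = A d c x b a := fun a b => by
      rw [hA1 c d x hx, hA2 c d]; simp
    simp only [D, Matrix.add_apply, Matrix.mul_apply, Matrix.transpose_apply, h1]
    rw [add_assoc, add_assoc]
    congr 1
    rw [add_comm]
    congr 1 <;> exact Finset.sum_congr rfl fun f _ => by rw [h2]; ring
  -- the three sums
  have hS : ∑ a, ∑ d, D e a d a d + 2 * ∑ a, ∑ d, D a d e a d = 0 := by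
    have h1 : ∑ a, ∑ d, (D e a d a d + D a d e a d + D d e a a d) = 0 := by
      refine Finset.sum_eq_zero fun a _ => Finset.sum_eq_zero fun d _ => ?_
      have := congrFun (congrFun (hB e a d) a) d
      simpa using this
    simp only [Finset.sum_add_distrib] at h1
    have h2 : ∑ a, ∑ d, D d e a a d = ∑ a, ∑ d, D a d e a d := by
      rw [Finset.sum_comm]
      exact Finset.sum_congr rfl fun a _ => Finset.sum_congr rfl fun d _ => hDanti _ _ _ _ _
    rw [h2] at h1
    linarith
  have hF : ∑ a, ∑ d, D e a d a d = pd e (fun y => (T y).trace) x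
      + 2 * ∑ a, (T x * chr G a x) a e := by
    simp only [D, Matrix.add_apply, Finset.sum_add_distrib]
    have h1 : ∑ a, ∑ d, mpd e (A a d) x a d = pd e (fun y => (T y).trace) x := by
      have : pd e (fun y => (T y).trace) x = pd e (fun y => ∑ a, ∑ d, A a d y a d) x := by
        refine pd_congr_on hG.isOpen (fun y hy => ?_) hx e
        rw [Finset.sum_comm]
        simp only [Matrix.trace, Matrix.diag, hT1 y hy]
      rw [this, pd_sum]
      · refine Finset.sum_congr rfl fun a _ => ?_
        rw [pd_sum]
        · rfl
        · exact fun d _ => (hA a d a d).differentiableAt hx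
      · exact fun a _ => (SmoothOn.sum (s := Finset.univ)
          fun d _ => hA a d a d).differentiableAt hx
    have h2 : ∑ a, ∑ d, (chr G e x * A a d x) a d = ∑ a, (T x * chr G a x) a e := by
      simp only [Matrix.mul_apply]
      rw [Finset.sum_congr rfl fun a _ => Finset.sum_comm]
      simp only [← Finset.mul_sum, hT2 x hx]
      rw [Finset.sum_comm]
      exact Finset.sum_congr rfl fun a _ => Finset.sum_congr rfl fun d _ => by
        rw [hG.chr_symm hx d e a]; ring
    have h3 : ∑ a, ∑ d, (A a d x * (chr G e x)ᵀ) a d = ∑ a, (T x * chr G a x) a e := by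
      simp only [Matrix.mul_apply, Matrix.transpose_apply]
      rw [Finset.sum_comm, Finset.sum_congr rfl fun d _ => Finset.sum_comm]
      simp only [← Finset.sum_mul, hT1 x hx]
      rw [Finset.sum_comm]
      exact Finset.sum_congr rfl fun a _ => Finset.sum_congr rfl fun d _ => by
        rw [hG.chr_symm hx d e a]
    rw [h1, h2, h3]; ring
  have hE : ∑ a, ∑ d, D a d e a d = - ∑ a, (mpd a T x + chr G a x * T x) a e := by
    simp only [D, Matrix.add_apply, Finset.sum_add_distrib]
    have h1 : ∑ a, ∑ d, mpd a (A d e) x a d = - ∑ a, mpd a T x a e := by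
      rw [← Finset.sum_neg_distrib]
      refine Finset.sum_congr rfl fun a _ => ?_
      have : - mpd a T x a e = pd a (fun y => ∑ d, A d e y a d) x := by
        rw [pd_congr_on hG.isOpen (fun y hy => hT3 y hy a e) hx a, pd_neg]; rfl
      rw [this, pd_sum]
      · rfl
      · exact fun d _ => (hA d e a d).differentiableAt hx
    have h2 : ∑ a, ∑ d, (chr G a x * A d e x) a d = - ∑ a, (chr G a x * T x) a e := by
      rw [← Finset.sum_neg_distrib]
      refine Finset.sum_congr rfl fun a _ => ?_
      simp only [Matrix.mul_apply]
      rw [Finset.sum_comm]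
      simp only [← Finset.mul_sum, hT3 x hx]
      simp
    -- An index pair in which A is antisymmetric meets the symmetric lower pair of a Christoffel
    -- symbol.
    have h3 : ∑ a, ∑ d, (A d e x * (chr G a x)ᵀ) a d = 0 := by
      have h4 : ∑ a, ∑ d, (A d e x * (chr G a x)ᵀ) a d
          = - ∑ a, ∑ d, (A d e x * (chr G a x)ᵀ) a d := by
        conv_lhs => rw [Finset.sum_comm]
        conv_rhs => rw [Finset.sum_comm]
        rw [← Finset.sum_neg_distrib]
        refine Finset.sum_congr rfl fun d _ => ?_
        simp only [Matrix.mul_apply, Matrix.transpose_apply]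
        refine Finset.sum_comm.trans ?_
        rw [← Finset.sum_neg_distrib]
        refine Finset.sum_congr rfl fun f _ => ?_
        rw [← Finset.sum_neg_distrib]
        refine Finset.sum_congr rfl fun a _ => ?_
        rw [hA1 d e x hx, hG.chr_symm hx d a f]
        ring
      linarith
    rw [h1, h2, h3]; ring
  rw [hF, hE] at hS
  simp only [Matrix.sub_apply, Finset.sum_sub_distrib]
  linarith

/-- For a metric with symmetric covariant derivative of the Ricci tensor, the Ricci scalar has
vanishing differential. -/
lemma pd_trace_of_yang (hG : IsMetricOn U G) (hsym : ∀ y ∈ U, (ric G y)ᵀ = ric G y) (hx : x ∈ U)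
    (hY : ∀ a b c, covB (chr G) a (ric G) x b c = covB (chr G) b (ric G) x a c) (e : Fin 4) :
    pd e (fun y => ((G y)⁻¹ * ric G y).trace) x = 0 := by
  have h1 : ∀ a, mpd a (fun y => (G y)⁻¹ * ric G y) x + chr G a x * ((G x)⁻¹ * ric G x)
      - ((G x)⁻¹ * ric G x) * chr G a x = (G x)⁻¹ * covB (chr G) a (ric G) x := by
    intro a
    rw [mpd_mul a hG.smooth_inv hG.smooth_ric hx, hG.mpd_inv_eq hx, covB]
    noncomm_ring
  have h2 : pd e (fun y => ((G y)⁻¹ * ric G y).trace) x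
      = ((G x)⁻¹ * covB (chr G) e (ric G) x).trace := by
    rw [← h1 e, Matrix.trace_sub, Matrix.trace_add, Matrix.trace_mul_comm (chr G e x),
      add_sub_cancel_right]
    simp only [Matrix.trace, Matrix.diag]
    rw [pd_sum]
    · rfl
    · exact fun d _ => (hG.smooth_inv.mul hG.smooth_ric d d).differentiableAt hx
  have h3 : ∀ a b c, covB (chr G) a (ric G) x b c = covB (chr G) a (ric G) x c b := by
    intro a b c
    have hs : (covB (chr G) a (ric G) x)ᵀ = covB (chr G) a (ric G) x := by
      have h4 : (mpd a (ric G) x)ᵀ = mpd a (ric G) x := by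
        rw [← mpd_transpose]
        exact mpd_congr_on hG.isOpen hsym hx a
      simp only [covB, Matrix.transpose_sub, Matrix.transpose_mul, Matrix.transpose_transpose,
        hsym x hx, h4]
      abel
    exact (congrFun (congrFun hs b) c).symm
  have h5 := hG.contracted_bianchi hx e
  simp only [h1] at h5
  -- Yang's equations turn the divergence ∇^a R_ae into the trace of ∇_e Ric, that is ∂_e R.
  -- Contracted Bianchi then reads ∂_e R = 2 ∂_e R.
  have h6 : ∑ a, ((G x)⁻¹ * covB (chr G) a (ric G) x) a e
      = ((G x)⁻¹ * covB (chr G) e (ric G) x).trace := by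
    simp only [Matrix.trace, Matrix.diag, Matrix.mul_apply]
    refine Finset.sum_congr rfl fun a _ => Finset.sum_congr rfl fun b _ => ?_
    rw [h3 a b e, hY a e b, h3 e a b]
  rw [h6, ← h2] at h5
  linarith

end IsMetricOn

end Coord

namespace Coord

open Filter Topology Matrix

/-! ### Behaviour under changes of coordinates -/

/-- The Jacobian matrix of a map. -/
noncomputable def jac (τ : R4 → R4) (x : R4) : Matrix (Fin 4) (Fin 4) ℝ :=
  Matrix.of fun a b => pd b (fun y => τ y a) x

/-- A smooth local diffeomorphism between open sets. -/
structure IsCoordChange (V U : Set R4) (τ : R4 → R4) : Prop where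
  isOpen : IsOpen V
  mapsTo : ∀ x ∈ V, τ x ∈ U
  smooth : ∀ i, SmoothOn V fun y => τ y i
  det : ∀ x ∈ V, IsUnit (jac τ x).det

lemma contDiffAt_of_components {τ : R4 → R4} {x : R4}
    (h : ∀ i, ContDiffAt ℝ ∞ (fun y => τ y i) x) : ContDiffAt ℝ ∞ τ x :=
  (contDiffAt_piLp 2).2 h

namespace IsCoordChange

variable {V U : Set R4} {τ : R4 → R4} {x : R4}

lemma contDiffAt (h : IsCoordChange V U τ) (hx : x ∈ V) : ContDiffAt ℝ ∞ τ x :=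
  contDiffAt_of_components fun i => h.smooth i x hx

lemma pd_comp (h : IsCoordChange V U τ) {f : R4 → ℝ} (hx : x ∈ V)
    (hf : DifferentiableAt ℝ f (τ x)) (c : Fin 4) :
    pd c (fun y => f (τ y)) x = ∑ d, jac τ x d c * pd d f (τ x) := by
  have hτ : DifferentiableAt ℝ τ x := (h.contDiffAt hx).differentiableAt (by simp)
  have h1 : fderiv ℝ (fun y => f (τ y)) x = (fderiv ℝ f (τ x)).comp (fderiv ℝ τ x) :=
    fderiv_comp x hf hτ
  rw [pd, h1, ContinuousLinearMap.comp_apply, fderiv_eq_sum_pd]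
  refine Finset.sum_congr rfl fun d _ => ?_
  congr 1
  have h2 : HasFDerivAt (fun y => τ y d) ((EuclideanSpace.proj d : R4 →L[ℝ] ℝ).comp
      (fderiv ℝ τ x)) x := (EuclideanSpace.proj d : R4 →L[ℝ] ℝ).hasFDerivAt.comp x hτ.hasFDerivAt
  simp only [jac, Matrix.of_apply, pd, h2.fderiv]
  rfl

lemma comp (h : IsCoordChange V U τ) {f : R4 → ℝ} (hf : SmoothOn U f) :
    SmoothOn V (fun y => f (τ y)) :=
  fun x hx => (hf (τ x) (h.mapsTo x hx)).comp x (h.contDiffAt hx)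

lemma mcomp {m n : Type*} (h : IsCoordChange V U τ) {F : R4 → Matrix m n ℝ} (hF : MSmoothOn U F) :
    MSmoothOn V (fun y => F (τ y)) := fun a b => h.comp (hF a b)

lemma mpd_comp {m n : Type*} (h : IsCoordChange V U τ) {F : R4 → Matrix m n ℝ}
    (hF : MSmoothOn U F) (hx : x ∈ V) (c : Fin 4) :
    mpd c (fun y => F (τ y)) x = ∑ d, jac τ x d c • mpd d F (τ x) := by
  ext a b
  simp only [Matrix.sum_apply, Matrix.smul_apply, smul_eq_mul]
  exact h.pd_comp hx ((hF a b).differentiableAt (h.mapsTo x hx)) c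

lemma smooth_jac (h : IsCoordChange V U τ) : MSmoothOn V (jac τ) := fun a b => (h.smooth a).pd b

lemma pd_jac (h : IsCoordChange V U τ) (hx : x ∈ V) (a b c : Fin 4) :
    pd c (fun y => jac τ y a b) x = pd b (fun y => jac τ y a c) x :=
  (h.smooth a).pd_comm hx c b

variable {Γ Γ' : Fin 4 → R4 → Matrix (Fin 4) (Fin 4) ℝ}

/-- The transformation law of connections, differentiated. -/
lemma jac_mul_curv (h : IsCoordChange V U τ) (hΓ : ∀ c, MSmoothOn U (Γ c))
    (hΓ' : ∀ c, MSmoothOn V (Γ' c))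
    (hc : ∀ y ∈ V, ∀ c, jac τ y * Γ' c y
      = mpd c (jac τ) y + ∑ d, jac τ y d c • (Γ d (τ y) * jac τ y)) (hx : x ∈ V) (c d : Fin 4) :
    jac τ x * curv Γ' c d x
      = ∑ e, ∑ f, (jac τ x e c * jac τ x f d) • (curv Γ e f (τ x) * jac τ x) := by
  have hJ := h.smooth_jac
  -- The law JΓ'_d = ∂_d J + Σ J^e_d Γ_e J is differentiated in direction c and antisymmetrised.
  -- Third derivatives of τ, second derivatives (`h8`) and the mixed terms Γ ∂J are symmetric in c,
  -- d, so only curvature survives.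
  have h1 : ∀ c d, mpd c (jac τ) x * Γ' d x + jac τ x * mpd c (Γ' d) x
      = mpd c (mpd d (jac τ)) x
        + ∑ e, (mpd c (jac τ) x e d • (Γ e (τ x) * jac τ x)
          + jac τ x e d • ((∑ f, jac τ x f c • mpd f (Γ e) (τ x)) * jac τ x
            + Γ e (τ x) * mpd c (jac τ) x)) := by
    intro c d
    rw [← mpd_mul c hJ (hΓ' d) hx, mpd_congr_on h.isOpen (fun y hy => hc y hy d) hx c,
      mpd_add (U := V) c (hJ.mpd d) (MSmoothOn.sum fun e _ =>
        MSmoothOn.smul (hJ e d) ((h.mcomp (hΓ e)).mul hJ)) hx,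
      mpd_sum c _ (fun e _ => MSmoothOn.smul (hJ e d) ((h.mcomp (hΓ e)).mul hJ)) hx]
    congr 1
    refine Finset.sum_congr rfl fun e _ => ?_
    rw [mpd_smul c (hJ e d) ((h.mcomp (hΓ e)).mul hJ) hx, mpd_mul c (h.mcomp (hΓ e)) hJ hx,
      h.mpd_comp (hΓ e) hx]
    rfl
  have h2 : ∀ c d, jac τ x * (Γ' c x * Γ' d x) = mpd c (jac τ) x * Γ' d x
      + ∑ e, jac τ x e c • (Γ e (τ x) * mpd d (jac τ) x)
      + ∑ e, ∑ f, (jac τ x e c * jac τ x f d) • (Γ e (τ x) * Γ f (τ x) * jac τ x) := by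
    intro c d
    rw [← Matrix.mul_assoc, hc x hx c, Matrix.add_mul, Finset.sum_mul, add_assoc]
    congr 1
    rw [← Finset.sum_add_distrib]
    refine Finset.sum_congr rfl fun e _ => ?_
    rw [smul_mul_assoc, Matrix.mul_assoc, hc x hx d, Matrix.mul_add, smul_add, Finset.mul_sum,
      Finset.smul_sum]
    congr 1
    refine Finset.sum_congr rfl fun f _ => ?_
    rw [mul_smul_comm, smul_smul, Matrix.mul_assoc]
  have h3 : ∀ c d, jac τ x * (mpd c (Γ' d) x + Γ' c x * Γ' d x)
      = mpd c (mpd d (jac τ)) x + ∑ e, mpd c (jac τ) x e d • (Γ e (τ x) * jac τ x)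
        + ∑ e, jac τ x e d • (Γ e (τ x) * mpd c (jac τ) x)
        + ∑ e, jac τ x e c • (Γ e (τ x) * mpd d (jac τ) x)
        + ∑ e, ∑ f, (jac τ x e c * jac τ x f d) • ((mpd e (Γ f) (τ x)
          + Γ e (τ x) * Γ f (τ x)) * jac τ x) := by
    intro c d
    have h4 : ∑ e, jac τ x e d • ((∑ f, jac τ x f c • mpd f (Γ e) (τ x)) * jac τ x)
        = ∑ e, ∑ f, (jac τ x e c * jac τ x f d) • (mpd e (Γ f) (τ x) * jac τ x) := by
      rw [Finset.sum_comm]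
      refine Finset.sum_congr rfl fun e _ => ?_
      rw [Finset.sum_mul, Finset.smul_sum]
      refine Finset.sum_congr rfl fun f _ => ?_
      rw [smul_mul_assoc, smul_smul, mul_comm]
    have h5 := h1 c d
    have h6 := h2 c d
    simp only [smul_add, Finset.sum_add_distrib] at h5
    rw [h4] at h5
    rw [Matrix.mul_add, h6, eq_sub_iff_add_eq'.2 h5]
    simp only [Matrix.add_mul, smul_add, Finset.sum_add_distrib]
    abel
  have h7 : jac τ x * curv Γ' c d x = jac τ x * (mpd c (Γ' d) x + Γ' c x * Γ' d x)
      - jac τ x * (mpd d (Γ' c) x + Γ' d x * Γ' c x) := by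
    simp only [curv]; noncomm_ring
  have h8 : ∀ e, mpd c (jac τ) x e d = mpd d (jac τ) x e c := fun e => h.pd_jac hx e d c
  have h9 : ∑ e, ∑ f, (jac τ x e d * jac τ x f c) • ((mpd e (Γ f) (τ x)
      + Γ e (τ x) * Γ f (τ x)) * jac τ x) = ∑ e, ∑ f, (jac τ x e c * jac τ x f d) •
      ((mpd f (Γ e) (τ x) + Γ f (τ x) * Γ e (τ x)) * jac τ x) := by
    rw [Finset.sum_comm]
    exact Finset.sum_congr rfl fun e _ => Finset.sum_congr rfl fun f _ => by rw [mul_comm]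
  have h10 : ∀ e f, curv Γ e f (τ x) * jac τ x
      = (mpd e (Γ f) (τ x) + Γ e (τ x) * Γ f (τ x)) * jac τ x
        - (mpd f (Γ e) (τ x) + Γ f (τ x) * Γ e (τ x)) * jac τ x := by
    intro e f; simp only [curv]; noncomm_ring
  rw [h7, h3, h3, h9, mpd_comm c hJ hx d]
  simp only [h8, h10, smul_sub, Finset.sum_sub_distrib]
  abel

/-- The transformation law of the covariant derivative of a bilinear form. -/
lemma covB_eq (h : IsCoordChange V U τ) {B B' : R4 → Matrix (Fin 4) (Fin 4) ℝ}
    (hB : MSmoothOn U B) (hB' : ∀ y ∈ V, B' y = (jac τ y)ᵀ * B (τ y) * jac τ y) (hx : x ∈ V)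
    (hc : ∀ c, jac τ x * Γ' c x
      = mpd c (jac τ) x + ∑ d, jac τ x d c • (Γ d (τ x) * jac τ x)) (c : Fin 4) :
    covB Γ' c B' x
      = ∑ e, jac τ x e c • ((jac τ x)ᵀ * covB Γ e B (τ x) * jac τ x) := by
  have hJ := h.smooth_jac
  have h1 : (Γ' c x)ᵀ * (jac τ x)ᵀ = (mpd c (jac τ) x)ᵀ
      + ∑ d, jac τ x d c • ((jac τ x)ᵀ * (Γ d (τ x))ᵀ) := by
    rw [← Matrix.transpose_mul, hc c]
    simp [Matrix.transpose_add, Matrix.transpose_sum, Matrix.transpose_mul]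
  rw [covB, mpd_congr_on h.isOpen hB' hx, mpd_mul (U := V) c (hJ.transpose.mul (h.mcomp hB)) hJ hx,
    mpd_mul (U := V) c hJ.transpose (h.mcomp hB) hx, h.mpd_comp hB hx, hB' x hx, mpd_transpose,
    ← Matrix.mul_assoc, ← Matrix.mul_assoc, h1, Matrix.mul_assoc _ (jac τ x) (Γ' c x), hc c]
  simp only [covB, Matrix.mul_sub, Matrix.sub_mul, Matrix.mul_add, Matrix.add_mul, Finset.sum_mul,
    Finset.mul_sum, smul_sub, Finset.sum_sub_distrib, smul_mul_assoc, mul_smul_comm]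
  simp only [Matrix.mul_assoc]
  abel

variable {G G' : R4 → Matrix (Fin 4) (Fin 4) ℝ}

/-- The pullback of a metric is a metric. -/
lemma isMetricOn (h : IsCoordChange V U τ) (hG : IsMetricOn U G)
    (hG' : ∀ y ∈ V, G' y = (jac τ y)ᵀ * G (τ y) * jac τ y) : IsMetricOn V G' where
  isOpen := h.isOpen
  smooth := ((h.smooth_jac.transpose.mul (h.mcomp hG.smooth)).mul h.smooth_jac).congr h.isOpen hG'
  symm y hy := by
    rw [hG' y hy]
    simp [Matrix.transpose_mul, hG.symm _ (h.mapsTo y hy), Matrix.mul_assoc]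
  det y hy := by
    rw [hG' y hy, Matrix.det_mul, Matrix.det_mul, Matrix.det_transpose]
    exact ((h.det y hy).mul (hG.det _ (h.mapsTo y hy))).mul (h.det y hy)

/-- The transformation law of the Christoffel symbols. -/
lemma jac_mul_chr (h : IsCoordChange V U τ) (hG : IsMetricOn U G)
    (hG' : ∀ y ∈ V, G' y = (jac τ y)ᵀ * G (τ y) * jac τ y) (hx : x ∈ V) (c : Fin 4) :
    jac τ x * chr G' c x
      = mpd c (jac τ) x + ∑ d, jac τ x d c • (chr G d (τ x) * jac τ x) := by
  have hM := h.isMetricOn hG hG'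
  set R : Fin 4 → Matrix (Fin 4) (Fin 4) ℝ := fun c =>
    mpd c (jac τ) x + ∑ d, jac τ x d c • (chr G d (τ x) * jac τ x) with hR
  have hJR : ∀ c, jac τ x * ((jac τ x)⁻¹ * R c) = R c := fun c => by
    rw [← Matrix.mul_assoc, Matrix.mul_nonsing_inv _ (h.det x hx), Matrix.one_mul]
  -- Uniqueness replaces any expansion of Christoffel symbols: J⁻¹(∂J + ΣJΓJ) is torsion-free by
  -- symmetry of second derivatives, and metric because `covB_eq` applied to G itself carries 0 to
  -- 0.
  have key := hM.chr_unique hx (fun c => (jac τ x)⁻¹ * R c) ?_ ?_ c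
  · rw [key, hJR]
  · intro a b c
    simp only [Matrix.mul_apply]
    refine Finset.sum_congr rfl fun e _ => ?_
    congr 1
    simp only [hR, Matrix.add_apply, Matrix.sum_apply, Matrix.smul_apply, Matrix.mul_apply,
      smul_eq_mul]
    congr 1
    · exact h.pd_jac hx e b c
    · simp only [Finset.mul_sum]
      refine Finset.sum_comm.trans ?_
      refine Finset.sum_congr rfl fun f _ => Finset.sum_congr rfl fun d _ => ?_
      rw [hG.chr_symm (h.mapsTo x hx) e f d]
      ring
  · intro c
    have h1 : covB (fun c _ => (jac τ x)⁻¹ * R c) c G' x = 0 := by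
      rw [h.covB_eq (Γ := chr G) hG.smooth hG' hx hJR c]
      refine Finset.sum_eq_zero fun e _ => ?_
      have : covB (chr G) e G (τ x) = 0 := by
        rw [covB, hG.mpd_eq (h.mapsTo x hx)]; abel
      rw [this]; simp
    rw [covB, sub_sub, sub_eq_zero] at h1
    exact h1

/-- The Ricci tensor is a tensor. -/
lemma ric_eq (h : IsCoordChange V U τ) (hG : IsMetricOn U G)
    (hG' : ∀ y ∈ V, G' y = (jac τ y)ᵀ * G (τ y) * jac τ y) (hx : x ∈ V) :
    ric G' x = (jac τ x)ᵀ * ric G (τ x) * jac τ x := by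
  have hM := h.isMetricOn hG hG'
  have h1 : ∀ c d, curv (chr G') c d x = ∑ e, ∑ f, (jac τ x e c * jac τ x f d) •
      ((jac τ x)⁻¹ * (curv (chr G) e f (τ x) * jac τ x)) := by
    intro c d
    have := h.jac_mul_curv hG.smooth_chr hM.smooth_chr (fun y hy c => h.jac_mul_chr hG hG' hy c)
      hx c d
    have h2 := congrArg (fun M => (jac τ x)⁻¹ * M) this
    simp only [← Matrix.mul_assoc (jac τ x)⁻¹ (jac τ x), Matrix.nonsing_inv_mul _ (h.det x hx),
      Matrix.one_mul, Finset.mul_sum, mul_smul_comm] at h2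
    exact h2
  have h3 : ∀ e g, ∑ a, jac τ x e a * (jac τ x)⁻¹ a g = if e = g then 1 else 0 := by
    intro e g
    have := congrFun (congrFun (Matrix.mul_nonsing_inv _ (h.det x hx)) e) g
    rw [Matrix.mul_apply, Matrix.one_apply] at this
    exact this
  ext b d
  rw [ric_apply]
  simp only [h1, Matrix.sum_apply, Matrix.smul_apply, smul_eq_mul]
  calc ∑ a, ∑ e, ∑ f, jac τ x e a * jac τ x f d
        * ((jac τ x)⁻¹ * (curv (chr G) e f (τ x) * jac τ x)) a b
      = ∑ f, ∑ e, ∑ g, (∑ a, jac τ x e a * (jac τ x)⁻¹ a g)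
        * (jac τ x f d * (curv (chr G) e f (τ x) * jac τ x) g b) := by
        rw [Finset.sum_comm, Finset.sum_congr rfl fun e _ => Finset.sum_comm, Finset.sum_comm]
        refine Finset.sum_congr rfl fun f _ => Finset.sum_congr rfl fun e _ => ?_
        simp only [Finset.sum_mul, Matrix.mul_apply (M := (jac τ x)⁻¹), Finset.mul_sum]
        rw [Finset.sum_comm]
        exact Finset.sum_congr rfl fun g _ => Finset.sum_congr rfl fun a _ => by ring
    _ = ∑ f, ∑ e, jac τ x f d * (curv (chr G) e f (τ x) * jac τ x) e b := by
        refine Finset.sum_congr rfl fun f _ => Finset.sum_congr rfl fun e _ => ?_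
        simp only [h3, ite_mul, one_mul, zero_mul]
        simp
    _ = _ := by
        simp only [Matrix.mul_apply (N := jac τ x), Matrix.mul_apply (M := (jac τ x)ᵀ),
          Matrix.transpose_apply, ric_apply]
        refine Finset.sum_congr rfl fun f _ => ?_
        rw [← Finset.mul_sum, mul_comm, Finset.sum_comm]
        congr 1
        refine Finset.sum_congr rfl fun e _ => ?_
        rw [← Finset.sum_mul, mul_comm]

/-- Yang's equations are preserved by changes of coordinates. -/
lemma yang_of_yang (h : IsCoordChange V U τ) (hG : IsMetricOn U G)
    (hG' : ∀ y ∈ V, G' y = (jac τ y)ᵀ * G (τ y) * jac τ y) (hx : x ∈ V)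
    (hY : ∀ a b c, covB (chr G) a (ric G) (τ x) b c = covB (chr G) b (ric G) (τ x) a c)
    (a b c : Fin 4) : covB (chr G') a (ric G') x b c = covB (chr G') b (ric G') x a c := by
  have h1 : ∀ a b, covB (chr G') a (ric G') x b c = ∑ e, ∑ f,
      jac τ x e a * jac τ x f b * ∑ g, covB (chr G) e (ric G) (τ x) f g * jac τ x g c := by
    intro a b
    rw [h.covB_eq (Γ := chr G) hG.smooth_ric (fun y hy => h.ric_eq hG hG' hy) hx
      (fun c => h.jac_mul_chr hG hG' hx c) a]
    simp only [Matrix.sum_apply, Matrix.smul_apply, smul_eq_mul]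
    refine Finset.sum_congr rfl fun e _ => ?_
    rw [Matrix.mul_assoc, Matrix.mul_apply, Finset.mul_sum]
    refine Finset.sum_congr rfl fun f _ => ?_
    rw [Matrix.transpose_apply, Matrix.mul_apply, mul_assoc]
  rw [h1, h1, Finset.sum_comm]
  refine Finset.sum_congr rfl fun e _ => Finset.sum_congr rfl fun f _ => ?_
  rw [mul_comm (jac τ x f a)]
  congr 1
  exact Finset.sum_congr rfl fun g _ => by rw [hY]

/-- The Ricci endomorphism transforms by conjugation. -/
lemma inv_mul_ric_eq (h : IsCoordChange V U τ) (hG : IsMetricOn U G)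
    (hG' : ∀ y ∈ V, G' y = (jac τ y)ᵀ * G (τ y) * jac τ y) (hx : x ∈ V) :
    (G' x)⁻¹ * ric G' x = (jac τ x)⁻¹ * ((G (τ x))⁻¹ * ric G (τ x)) * jac τ x := by
  have hdT : IsUnit ((jac τ x)ᵀ).det := by rw [Matrix.det_transpose]; exact h.det x hx
  rw [h.ric_eq hG hG' hx, hG' x hx, Matrix.mul_inv_rev, Matrix.mul_inv_rev]
  simp only [Matrix.mul_assoc]
  rw [← Matrix.mul_assoc ((jac τ x)ᵀ)⁻¹ (jac τ x)ᵀ, Matrix.nonsing_inv_mul _ hdT, Matrix.one_mul]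

end IsCoordChange

end Coord

namespace Coord

open Filter Topology Matrix

/-! ### Parallel sections of flat connections -/

section Frobenius

set_option maxSynthPendingDepth 3

variable {F E : Type*} [NormedAddCommGroup F] [NormedSpace ℝ F] [NormedAddCommGroup E]
  [NormedSpace ℝ E]

/-- Grönwall gives (ε/K)(e^{Kt} − 1). For K ≥ 1 and t ≤ 1 the cruder bound ε e^K holds; it is used
with ε of first and of second order in the displacement of an end point. -/
lemma norm_le_mul_exp_of_deriv_bound {f f' : ℝ → E} {K ε : ℝ} (hK : 1 ≤ K) (hε : 0 ≤ ε)
    (hf : ∀ t ∈ Set.Icc (0 : ℝ) 1, HasDerivWithinAt f (f' t) (Set.Icc 0 1) t) (h0 : f 0 = 0)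
    (bound : ∀ t ∈ Set.Icc (0 : ℝ) 1, ‖f' t‖ ≤ K * ‖f t‖ + ε) :
    ∀ t ∈ Set.Icc (0 : ℝ) 1, ‖f t‖ ≤ ε * Real.exp K := by
  intro t ht
  have h := norm_le_gronwallBound_of_norm_deriv_right_le (f := f) (f' := f') (δ := 0) (K := K)
    (ε := ε) (a := 0) (b := 1) (fun t ht => (hf t ht).continuousWithinAt)
    (fun t ht => ((hf t ⟨ht.1, ht.2.le⟩).mono_of_mem_nhdsWithin
      (Icc_mem_nhdsGE_of_mem ht))) (by simp [h0])
    (fun t ht => bound t ⟨ht.1, ht.2.le⟩) t ht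
  refine h.trans ?_
  rw [gronwallBound_of_K_ne_0 (by linarith)]
  simp only [zero_mul, zero_add, sub_zero]
  have h1 : Real.exp (K * t) ≤ Real.exp K := Real.exp_le_exp.2 (by nlinarith [ht.1, ht.2])
  have h2 : 1 ≤ Real.exp (K * t) := Real.one_le_exp (by nlinarith [ht.1])
  have h3 : ε / K ≤ ε := div_le_self hε hK
  have h4 : 0 ≤ ε / K := by positivity
  nlinarith

/-- Solutions of the radial equation of a linear connection, with a small connection form. -/
lemma exists_radial_solution [CompleteSpace E] {Θ : F → F →L[ℝ] E →L[ℝ] E} {x₀ x : F} {r : ℝ}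
    (hΘ : ContinuousOn Θ (Metric.ball x₀ r)) {M : ℝ}
    (hM : ∀ y ∈ Metric.ball x₀ r, ‖Θ y‖ ≤ M) (hr : M * r ≤ 1 / 2)
    (hx : x ∈ Metric.ball x₀ r) (v : E) :
    ∃ Y : ℝ → E, Y 0 = v ∧ ∀ t ∈ Set.Icc (0 : ℝ) 1,
      HasDerivWithinAt Y (Θ (x₀ + t • (x - x₀)) (x - x₀) (Y t)) (Set.Icc 0 1) t := by
  have hxr : ‖x - x₀‖ < r := by simpa [dist_eq_norm] using hx
  have hM0 : 0 ≤ M := (norm_nonneg _).trans (hM x hx)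
  have hγ : ∀ t ∈ Set.Icc (0 : ℝ) 1, x₀ + t • (x - x₀) ∈ Metric.ball x₀ r := by
    intro t ht
    rw [Metric.mem_ball, dist_eq_norm, add_sub_cancel_left, norm_smul, Real.norm_eq_abs,
      abs_of_nonneg ht.1]
    exact (mul_le_of_le_one_left (norm_nonneg _) ht.2).trans_lt hxr
  have hA : ∀ t ∈ Set.Icc (0 : ℝ) 1, ‖Θ (x₀ + t • (x - x₀)) (x - x₀)‖ ≤ 1 / 2 := fun t ht =>
    (ContinuousLinearMap.le_of_opNorm_le _ (hM _ (hγ t ht)) _).trans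
      ((mul_le_mul_of_nonneg_left hxr.le hM0).trans hr)
  -- On the ball of radius ‖v‖ + 1 about v one has ‖Y‖ ≤ 2‖v‖ + 1. As the coefficient has norm at
  -- most 1/2, the speed is at most ‖v‖ + 1, so the solution stays in the ball up to time 1,
  -- whatever v is.
  have hpl : IsPicardLindelof (fun t Y => Θ (x₀ + t • (x - x₀)) (x - x₀) Y)
      (⟨0, by simp⟩ : Set.Icc (0 : ℝ) 1) v (‖v‖₊ + 1) 0 (‖v‖₊ + 1) (1 / 2) := by
    refine ⟨?_, ?_, ?_, ?_⟩
    · intro t ht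
      have : LipschitzWith (1 / 2) (Θ (x₀ + t • (x - x₀)) (x - x₀)) :=
        (ContinuousLinearMap.lipschitz _).weaken (by exact_mod_cast hA t ht)
      exact this.lipschitzOnWith
    · intro Y _
      have h1 : ContinuousOn (fun t : ℝ => x₀ + t • (x - x₀)) (Set.Icc 0 1) := by fun_prop
      have h2 := hΘ.comp h1 hγ
      exact ((h2.clm_apply continuousOn_const).clm_apply continuousOn_const)
    · intro t ht Y hY
      have h1 : ‖Y‖ ≤ ‖v‖ + (‖v‖ + 1) := by
        have : dist Y v ≤ ‖v‖ + 1 := by simpa using hY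
        rw [dist_eq_norm] at this
        calc ‖Y‖ = ‖v + (Y - v)‖ := by congr 1; abel
          _ ≤ _ := (norm_add_le _ _).trans (by linarith)
      have h2 := ContinuousLinearMap.le_of_opNorm_le _ (hA t ht) Y
      have h3 := norm_nonneg v
      simp only [NNReal.coe_add, coe_nnnorm, NNReal.coe_one]
      linarith
    · simp
  obtain ⟨Y, hY0, hY⟩ := hpl.exists_eq_forall_mem_Icc_hasDerivWithinAt₀
  exact ⟨Y, hY0, hY⟩

/-- A flat linear connection with smooth coefficients has local parallel sections. -/
theorem exists_parallel_section [CompleteSpace E] {U : Set F} (hU : IsOpen U)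
    {Θ : F → F →L[ℝ] E →L[ℝ] E} (hΘ : ∀ x ∈ U, ContDiffAt ℝ ∞ Θ x)
    (hflat : ∀ x ∈ U, ∀ h k : F, fderiv ℝ Θ x k h + (Θ x h).comp (Θ x k)
      = fderiv ℝ Θ x h k + (Θ x k).comp (Θ x h)) {x₀ : F} (hx₀ : x₀ ∈ U) :
    ∃ r > 0, Metric.ball x₀ r ⊆ U ∧ ∀ v : E, ∃ s : F → E, s x₀ = v ∧
      ∀ x ∈ Metric.ball x₀ r, HasFDerivAt s ((Θ x).flip (s x)) x := by
  obtain ⟨K₁, t₁, ht₁, hK₁⟩ := ((hΘ x₀ hx₀).fderiv_right (m := 1)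
    (by norm_cast)).exists_lipschitzOnWith
  have hcd : ContinuousAt (fderiv ℝ Θ) x₀ :=
    ((hΘ x₀ hx₀).fderiv_right (m := ∞) (by simp)).continuousAt
  obtain ⟨M, hM1, hMΘ, hMd⟩ : ∃ M : ℝ, 1 ≤ M ∧ ‖Θ x₀‖ < M ∧ ‖fderiv ℝ Θ x₀‖ < M :=
    ⟨max 1 (max (‖Θ x₀‖ + 1) (‖fderiv ℝ Θ x₀‖ + 1)), le_max_left _ _,
      lt_of_lt_of_le (lt_add_one _) ((le_max_left _ _).trans (le_max_right _ _)),
      lt_of_lt_of_le (lt_add_one _) ((le_max_right _ _).trans (le_max_right _ _))⟩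
  have hn1 : ∀ᶠ y in 𝓝 x₀, ‖Θ y‖ < M := (hΘ x₀ hx₀).continuousAt.norm.eventually_lt_const hMΘ
  have hn2 : ∀ᶠ y in 𝓝 x₀, ‖fderiv ℝ Θ y‖ < M := hcd.norm.eventually_lt_const hMd
  obtain ⟨r₀, hr₀, hball⟩ := Metric.eventually_nhds_iff_ball.1
    (hn1.and (hn2.and ((hU.eventually_mem hx₀).and
      (ht₁ : ∀ᶠ y in 𝓝 x₀, y ∈ t₁))))
  -- M r ≤ 1/2 makes every radial equation solvable up to time 1 with a radius independent of the
  -- initial value v.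
  set r : ℝ := min r₀ (1 / (2 * M)) with hr
  have hM0 : 0 < M := by linarith
  have hrpos : 0 < r := lt_min hr₀ (by positivity)
  have hrM : M * r ≤ 1 / 2 := by
    calc M * r ≤ M * (1 / (2 * M)) := mul_le_mul_of_nonneg_left (min_le_right _ _) hM0.le
      _ = 1 / 2 := by field_simp
  have hr1 : r ≤ 1 := by nlinarith
  have hB : ∀ y ∈ Metric.ball x₀ r, ‖Θ y‖ < M ∧ ‖fderiv ℝ Θ y‖ < M ∧ y ∈ U ∧ y ∈ t₁ :=
    fun y hy => hball y (Metric.ball_subset_ball (min_le_left _ _) hy)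
  refine ⟨r, hrpos, fun y hy => (hB y hy).2.2.1, fun v => ?_⟩
  have hdΘ : ∀ y ∈ Metric.ball x₀ r, HasFDerivAt Θ (fderiv ℝ Θ y) y := fun y hy =>
    ((hΘ y (hB y hy).2.2.1).differentiableAt (by simp)).hasFDerivAt
  have hcont : ContinuousOn Θ (Metric.ball x₀ r) := fun y hy =>
    (hdΘ y hy).continuousAt.continuousWithinAt
  have hconv : Convex ℝ (Metric.ball x₀ r) := convex_ball _ _
  -- Taylor estimates
  have hlip : ∀ y ∈ Metric.ball x₀ r, ∀ z ∈ Metric.ball x₀ r, ‖Θ z - Θ y‖ ≤ M * ‖z - y‖ :=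
    fun y hy z hz => hconv.norm_image_sub_le_of_norm_hasFDerivWithin_le
      (fun w hw => (hdΘ w hw).hasFDerivWithinAt) (fun w hw => (hB w hw).2.1.le) hy hz
  have htay : ∀ y ∈ Metric.ball x₀ r, ∀ z ∈ Metric.ball x₀ r,
      ‖Θ z - Θ y - fderiv ℝ Θ y (z - y)‖ ≤ K₁ * ‖z - y‖ * ‖z - y‖ := by
    intro y hy z hz
    have hseg : segment ℝ y z ⊆ Metric.ball x₀ r := hconv.segment_subset hy hz
    refine (convex_segment y z).norm_image_sub_le_of_norm_hasFDerivWithin_le'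
      (fun w hw => (hdΘ w (hseg hw)).hasFDerivWithinAt) (fun w hw => ?_)
      (left_mem_segment ℝ y z) (right_mem_segment ℝ y z)
    have h1 := hK₁.dist_le_mul w (hB w (hseg hw)).2.2.2 y (hB y hy).2.2.2
    rw [dist_eq_norm, dist_eq_norm] at h1
    refine h1.trans (mul_le_mul_of_nonneg_left ?_ K₁.2)
    obtain ⟨θ, hθ, rfl⟩ := (segment_eq_image' ℝ y z ▸ hw : w ∈ (fun θ : ℝ => y + θ • (z - y)) ''
      Set.Icc 0 1)
    simp only [add_sub_cancel_left, norm_smul, Real.norm_eq_abs, abs_of_nonneg hθ.1]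
    exact mul_le_of_le_one_left (norm_nonneg _) hθ.2
  -- Y x is the solution along the ray from x₀ to x, with default value 0 outside the ball so that a
  -- choice for all x is possible. The section is x ↦ Y x 1.
  have hY : ∀ x : F, ∃ Y : ℝ → E, x ∈ Metric.ball x₀ r → Y 0 = v ∧ ∀ t ∈ Set.Icc (0 : ℝ) 1,
      HasDerivWithinAt Y (Θ (x₀ + t • (x - x₀)) (x - x₀) (Y t)) (Set.Icc 0 1) t := by
    intro x
    by_cases hx : x ∈ Metric.ball x₀ r
    · obtain ⟨Y, hY⟩ := exists_radial_solution hcont (fun y hy => (hB y hy).1.le) hrM hx v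
      exact ⟨Y, fun _ => hY⟩
    · exact ⟨0, fun h => absurd h hx⟩
  choose Y hY using hY
  have hγ : ∀ x ∈ Metric.ball x₀ r, ∀ t ∈ Set.Icc (0 : ℝ) 1,
      x₀ + t • (x - x₀) ∈ Metric.ball x₀ r := fun x hx t ht =>
    hconv.add_smul_sub_mem (Metric.mem_ball_self hrpos) hx ht
  refine ⟨fun x => Y x 1, ?_, fun x hx => ?_⟩
  · have hx := Metric.mem_ball_self (x := x₀) hrpos
    have h1 : ∀ t ∈ Set.Icc (0 : ℝ) 1, HasDerivWithinAt (fun t => Y x₀ t - v)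
        (0 : E) (Set.Icc 0 1) t := by
      intro t ht
      have := ((hY x₀ hx).2 t ht).sub_const v
      simpa using this
    have h2 := norm_le_mul_exp_of_deriv_bound le_rfl le_rfl h1 (by simp [(hY x₀ hx).1])
      (fun t _ => by simp) 1 (by simp)
    simpa [sub_eq_zero] using h2
  · obtain ⟨C, hC⟩ : ∃ C, ∀ t ∈ Set.Icc (0 : ℝ) 1, ‖Y x t‖ ≤ C :=
      isCompact_Icc.exists_bound_of_continuousOn fun t ht =>
        ((hY x hx).2 t ht).continuousWithinAt
    have hC0 : 0 ≤ C := (norm_nonneg _).trans (hC 0 (by simp))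
    have hk : ∀ z ∈ Metric.ball x₀ r, ‖z - x₀‖ ≤ 1 := fun z hz => by
      have : ‖z - x₀‖ < r := by simpa [dist_eq_norm] using hz
      linarith
    -- Lipschitz dependence on the end point
    set C₁ : ℝ := 2 * M * C * Real.exp M with hC₁
    have hC₁0 : 0 ≤ C₁ := by positivity
    have hop : ∀ y ∈ Metric.ball x₀ r, ∀ (a : F) (b : E), ‖Θ y a b‖ ≤ M * ‖a‖ * ‖b‖ :=
      fun y hy a b => (ContinuousLinearMap.le_opNorm₂ _ a b).trans
        (by gcongr; exact (hB y hy).1.le)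
    have hdiff : ∀ (z : F) (t : ℝ), x₀ + t • (z - x₀) - (x₀ + t • (x - x₀)) = t • (z - x) := fun z t => by
      rw [add_sub_add_left_eq_sub, ← smul_sub, sub_sub_sub_cancel_right]
    have hnt : ∀ z : F, ∀ t ∈ Set.Icc (0 : ℝ) 1, ‖t • (z - x)‖ ≤ ‖z - x‖ := fun z t ht => by
      rw [norm_smul, Real.norm_eq_abs, abs_of_nonneg ht.1]
      exact mul_le_of_le_one_left (norm_nonneg _) ht.2
    have hΘd : ∀ z ∈ Metric.ball x₀ r, ∀ t ∈ Set.Icc (0 : ℝ) 1, ∀ (a : F) (b : E),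
        ‖(Θ (x₀ + t • (z - x₀)) - Θ (x₀ + t • (x - x₀))) a b‖ ≤ M * ‖z - x‖ * ‖a‖ * ‖b‖ := by
      intro z hz t ht a b
      refine (ContinuousLinearMap.le_opNorm₂ _ a b).trans ?_
      have h1 := hlip _ (hγ x hx t ht) _ (hγ z hz t ht)
      rw [hdiff] at h1
      have h2 := h1.trans (mul_le_mul_of_nonneg_left (hnt z t ht) hM0.le)
      gcongr
    have hΔ : ∀ z ∈ Metric.ball x₀ r, ∀ t ∈ Set.Icc (0 : ℝ) 1,
        ‖Y z t - Y x t‖ ≤ C₁ * ‖z - x‖ := by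
      intro z hz t ht
      have h1 := norm_le_mul_exp_of_deriv_bound (f := fun t => Y z t - Y x t)
        (ε := 2 * M * C * ‖z - x‖) hM1 (by positivity)
        (fun t ht => ((hY z hz).2 t ht).sub ((hY x hx).2 t ht))
        (by simp [(hY z hz).1, (hY x hx).1]) (fun t ht => ?_) t ht
      · calc _ ≤ _ := h1
          _ = _ := by rw [hC₁]; ring
      · have e : Θ (x₀ + t • (z - x₀)) (z - x₀) (Y z t) - Θ (x₀ + t • (x - x₀)) (x - x₀) (Y x t)
            = Θ (x₀ + t • (z - x₀)) (z - x₀) (Y z t - Y x t)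
              + ((Θ (x₀ + t • (z - x₀)) - Θ (x₀ + t • (x - x₀))) (z - x₀) (Y x t)
              + Θ (x₀ + t • (x - x₀)) (z - x) (Y x t)) := by
          have : z - x = (z - x₀) - (x - x₀) := by abel
          rw [this]
          simp only [map_sub, _root_.sub_apply]
          abel
        rw [e]
        have b1 := hop _ (hγ z hz t ht) (z - x₀) (Y z t - Y x t)
        have b2 := hΘd z hz t ht (z - x₀) (Y x t)
        have b3 := hop _ (hγ x hx t ht) (z - x) (Y x t)
        have b4 : M * ‖z - x₀‖ * ‖Y z t - Y x t‖ ≤ M * ‖Y z t - Y x t‖ := by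
          have := hk z hz
          have : M * ‖z - x₀‖ ≤ M * 1 := by gcongr
          rw [mul_one] at this
          gcongr
        have b5 : M * ‖z - x‖ * ‖z - x₀‖ * ‖Y x t‖ ≤ M * ‖z - x‖ * 1 * C := by
          have := hk z hz
          have := hC t ht
          gcongr
        have b6 : M * ‖z - x‖ * ‖Y x t‖ ≤ M * ‖z - x‖ * C := by
          have := hC t ht
          gcongr
        refine (norm_add_le _ _).trans ?_
        have := norm_add_le ((Θ (x₀ + t • (z - x₀)) - Θ (x₀ + t • (x - x₀))) (z - x₀) (Y x t))
          (Θ (x₀ + t • (x - x₀)) (z - x) (Y x t))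
        linarith
    -- the quadratic remainder
    set C₂ : ℝ := (M * C₁ + M * (C + 2 * C₁) + M * C₁ + K₁ * C) * Real.exp M with hC₂
    have hK0 : (0 : ℝ) ≤ K₁ := K₁.2
    have hrem : ∀ z ∈ Metric.ball x₀ r,
        ‖Y z 1 - Y x 1 - Θ x (z - x) (Y x 1)‖ ≤ C₂ * ‖z - x‖ ^ 2 := by
      intro z hz
      set h := z - x with hh
      have hh2 : ‖h‖ ≤ 2 := by
        have : h = (z - x₀) - (x - x₀) := by rw [hh]; abel
        rw [this]
        exact (norm_sub_le _ _).trans (by linarith [hk z hz, hk x hx])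
      set k := x - x₀ with hkdef
      -- The expected first-order variation of Y x t under x ↦ x + h is t Θ(h) Y x t. The error of
      -- this guess vanishes at t = 0; by flatness its derivative is Θ(k) applied to the error plus
      -- terms quadratic in h, so Grönwall bounds it by C₂‖h‖².
      have hD : ∀ t ∈ Set.Icc (0 : ℝ) 1, HasDerivWithinAt
          (fun t => Y z t - Y x t - t • Θ (x₀ + t • k) h (Y x t))
          (Θ (x₀ + t • (z - x₀)) (z - x₀) (Y z t) - Θ (x₀ + t • k) k (Y x t)
            - (Θ (x₀ + t • k) h (Y x t) + t • (fderiv ℝ Θ (x₀ + t • k) k h (Y x t)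
              + Θ (x₀ + t • k) h (Θ (x₀ + t • k) k (Y x t))))) (Set.Icc 0 1) t := by
        intro t ht
        have d1 : HasDerivWithinAt (fun t : ℝ => x₀ + t • k) k (Set.Icc 0 1) t := by
          have := ((hasDerivAt_id t).smul_const k).const_add x₀
          simpa using this.hasDerivWithinAt
        have d2 : HasDerivWithinAt (fun t : ℝ => Θ (x₀ + t • k)) (fderiv ℝ Θ (x₀ + t • k) k)
          (Set.Icc 0 1) t := (hdΘ _ (hγ x hx t ht)).comp_hasDerivWithinAt t d1
        have d3 := ((d2.clm_apply (hasDerivWithinAt_const t _ h)).clm_apply ((hY x hx).2 t ht))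
        have d4 := (hasDerivWithinAt_id t (Set.Icc (0 : ℝ) 1)).smul d3
        refine ((((hY z hz).2 t ht).sub ((hY x hx).2 t ht)).sub d4).congr_deriv ?_
        simp only [map_zero, add_zero, id, one_smul]
        rw [add_comm (t • _)]
      have hmain := norm_le_mul_exp_of_deriv_bound
        (ε := (M * C₁ + M * (C + 2 * C₁) + M * C₁ + K₁ * C) * ‖h‖ ^ 2) hM1 (by positivity) hD
        (by simp [(hY z hz).1, (hY x hx).1]) (fun t ht => ?_) 1 (by simp)
      · simp only [one_smul, hkdef, add_sub_cancel] at hmain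
        calc _ ≤ _ := hmain
          _ = _ := by rw [hC₂]; ring
      · set y := x₀ + t • k with hy
        have hyB : y ∈ Metric.ball x₀ r := hγ x hx t ht
        set w := x₀ + t • (z - x₀) with hw
        have hwB : w ∈ Metric.ball x₀ r := hγ z hz t ht
        have hwy : w - y = t • h := hdiff z t
        -- The only use of flatness: it trades ∂_kΘ(h) + Θ(h)Θ(k) for ∂_hΘ(k) + Θ(k)Θ(h), whose
        -- first term is the linear part of Θ w − Θ y.
        have hfl := congrArg (fun A : E →L[ℝ] E => A (Y x t)) (hflat y (hB y hyB).2.2.1 h k)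
        simp only [_root_.add_apply, ContinuousLinearMap.comp_apply] at hfl
        have hzk : z - x₀ = k + h := by rw [hh, hkdef]; abel
        have e : Θ w (z - x₀) (Y z t) - Θ y k (Y x t)
            - (Θ y h (Y x t) + t • (fderiv ℝ Θ y k h (Y x t) + Θ y h (Θ y k (Y x t))))
            = Θ y k (Y z t - Y x t - t • Θ y h (Y x t)) + Θ y h (Y z t - Y x t)
              + (Θ w - Θ y) h (Y z t) + (Θ w - Θ y) k (Y z t - Y x t)
              + (Θ w - Θ y - fderiv ℝ Θ y (w - y)) k (Y x t) := by
          rw [hfl, hzk, hwy]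
          simp only [map_sub, map_add, map_smul, _root_.sub_apply,
            _root_.add_apply, _root_.smul_apply, smul_add]
          abel
        rw [e]
        have hkx : ‖k‖ ≤ 1 := hk x hx
        have hYz : ‖Y z t‖ ≤ C + 2 * C₁ := by
          have h1 : Y z t = Y x t + (Y z t - Y x t) := by abel
          rw [h1]
          refine (norm_add_le _ _).trans ?_
          have h2 := hΔ z hz t ht
          have h3 : C₁ * ‖h‖ ≤ C₁ * 2 := by gcongr
          linarith [hC t ht]
        have b1 : ‖Θ y k (Y z t - Y x t - t • Θ y h (Y x t))‖
            ≤ M * ‖Y z t - Y x t - t • Θ y h (Y x t)‖ := by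
          refine (hop y hyB _ _).trans ?_
          have : M * ‖k‖ ≤ M * 1 := by gcongr
          rw [mul_one] at this
          gcongr
        have b2 : ‖Θ y h (Y z t - Y x t)‖ ≤ M * ‖h‖ * (C₁ * ‖h‖) := by
          refine (hop y hyB _ _).trans ?_
          have := hΔ z hz t ht
          gcongr
        have b3 : ‖(Θ w - Θ y) h (Y z t)‖ ≤ M * ‖h‖ * ‖h‖ * (C + 2 * C₁) := by
          refine (hΘd z hz t ht _ _).trans ?_
          gcongr
        have b4 : ‖(Θ w - Θ y) k (Y z t - Y x t)‖ ≤ M * ‖h‖ * 1 * (C₁ * ‖h‖) := by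
          refine (hΘd z hz t ht _ _).trans ?_
          have := hΔ z hz t ht
          gcongr
        have b5 : ‖(Θ w - Θ y - fderiv ℝ Θ y (w - y)) k (Y x t)‖
            ≤ K₁ * ‖h‖ * ‖h‖ * 1 * C := by
          refine (ContinuousLinearMap.le_opNorm₂ _ _ _).trans ?_
          have h1 := htay y hyB w hwB
          rw [hwy] at h1 ⊢
          have h2 := hnt z t ht
          have h3 : K₁ * ‖t • h‖ * ‖t • h‖ ≤ K₁ * ‖h‖ * ‖h‖ := by gcongr
          have h4 := h1.trans h3
          have := hC t ht
          gcongr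
        refine (norm_add_le _ _).trans ?_
        refine (add_le_add_left (norm_add_le _ _) _).trans ?_
        refine (add_le_add_left (add_le_add_left (norm_add_le _ _) _) _).trans ?_
        refine (add_le_add_left (add_le_add_left (add_le_add_left (norm_add_le _ _) _) _) _).trans ?_
        nlinarith
    rw [hasFDerivAt_iff_isLittleO]
    refine (Asymptotics.IsBigO.of_bound C₂ ?_).trans_isLittleO
      (g := fun z => ‖z - x‖ ^ 2) ?_
    · filter_upwards [Metric.isOpen_ball.mem_nhds hx] with z hz
      simpa using hrem z hz
    · have := Asymptotics.isLittleO_pow_sub_sub x (m := 2) (by norm_num)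
      exact this

end Frobenius

end Coord

/-! ### Poincaré lemma and flat linear systems on open subsets of ℝ⁴. -/

namespace Coord

open Filter Topology Matrix

lemma proj_eucl_apply (a : Fin 4) (h : R4) : (EuclideanSpace.proj a : R4 →L[ℝ] ℝ) h = h a := rfl

lemma fderiv_eq_sum_smul_proj (f : R4 → ℝ) (x : R4) :
    fderiv ℝ f x = ∑ a, pd a f x • (EuclideanSpace.proj a : R4 →L[ℝ] ℝ) := by
  ext v
  rw [fderiv_eq_sum_pd]
  simp [_root_.sum_apply, mul_comm]

lemma contDiffOn_succ_of_pd {B : Set R4} (hB : IsOpen B) {f : R4 → ℝ} (hf : DifferentiableOn ℝ f B)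
    {n : ℕ} (h : ∀ a, ContDiffOn ℝ n (pd a f) B) : ContDiffOn ℝ (n + 1 : ℕ) f B := by
  have : ContDiffOn ℝ ((n : WithTop ℕ∞) + 1) f B := by
    rw [contDiffOn_succ_iff_fderiv_of_isOpen hB]
    refine ⟨hf, by simp, ?_⟩
    have : fderiv ℝ f = fun x => ∑ a, pd a f x • (EuclideanSpace.proj a : R4 →L[ℝ] ℝ) :=
      funext fun x => fderiv_eq_sum_smul_proj f x
    rw [this]
    exact ContDiffOn.sum fun a _ => (h a).smul contDiffOn_const
  exact_mod_cast this

lemma SmoothOn.contDiffOn {U : Set R4} {f : R4 → ℝ} (h : SmoothOn U f) : ContDiffOn ℝ ∞ f U :=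
  fun x hx => (h x hx).contDiffWithinAt

lemma smoothOn_of_contDiffOn_nat {B : Set R4} (hB : IsOpen B) {f : R4 → ℝ}
    (h : ∀ n : ℕ, ContDiffOn ℝ n f B) : SmoothOn B f := fun _ hx =>
  (contDiffOn_infty.2 h).contDiffAt (hB.mem_nhds hx)

/-- The Poincaré lemma for smooth one-forms on a ball of `ℝ⁴`. -/
lemma exists_potential {x₀ : R4} {r : ℝ} {w : Fin 4 → R4 → ℝ}
    (hw : ∀ a, SmoothOn (Metric.ball x₀ r) (w a))
    (hc : ∀ x ∈ Metric.ball x₀ r, ∀ a b, pd a (w b) x = pd b (w a) x) :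
    ∃ f : R4 → ℝ, SmoothOn (Metric.ball x₀ r) f ∧
      ∀ x ∈ Metric.ball x₀ r, ∀ a, pd a f x = w a x := by
  let Θ : R4 → R4 →L[ℝ] ℝ := fun x => ∑ a, w a x • (EuclideanSpace.proj a : R4 →L[ℝ] ℝ)
  have hd : ∀ x ∈ Metric.ball x₀ r, HasFDerivAt Θ
      (∑ a, (fderiv ℝ (w a) x).smulRight (EuclideanSpace.proj a : R4 →L[ℝ] ℝ)) x := by
    intro x hx
    exact HasFDerivAt.fun_sum fun a _ => ((hw a).differentiableAt hx).hasFDerivAt.smul_const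
      (EuclideanSpace.proj a : R4 →L[ℝ] ℝ)
  have hsymm : ∀ x ∈ Metric.ball x₀ r, ∀ u v, fderiv ℝ Θ x u v = fderiv ℝ Θ x v u := by
    intro x hx u v
    rw [(hd x hx).fderiv]
    simp only [_root_.sum_apply, ContinuousLinearMap.smulRight_apply,
      _root_.smul_apply, proj_eucl_apply, fderiv_eq_sum_pd, smul_eq_mul, Finset.sum_mul]
    rw [Finset.sum_comm]
    refine Finset.sum_congr rfl fun a _ => Finset.sum_congr rfl fun b _ => ?_
    rw [hc x hx a b]; ring
  have hdiff : DifferentiableOn ℝ Θ (Metric.ball x₀ r) :=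
    fun x hx => (hd x hx).differentiableAt.differentiableWithinAt
  obtain ⟨f, hf⟩ := (convex_ball x₀ r).exists_forall_hasFDerivAt_of_fderiv_symmetric
    Metric.isOpen_ball hdiff hsymm
  have hpd : ∀ x ∈ Metric.ball x₀ r, ∀ a, pd a f x = w a x := by
    intro x hx a
    rw [pd, (hf x hx).fderiv]
    simp [Θ, _root_.sum_apply]
  refine ⟨f, smoothOn_of_contDiffOn_nat Metric.isOpen_ball fun n => ?_, hpd⟩
  have h1 : ContDiffOn ℝ (n + 1 : ℕ) f (Metric.ball x₀ r) :=
    contDiffOn_succ_of_pd Metric.isOpen_ball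
      (fun x hx => (hf x hx).differentiableAt.differentiableWithinAt) fun a =>
      ((hw a).contDiffOn.of_le (by exact_mod_cast le_top)).congr fun x hx => hpd x hx a
  exact h1.of_le (by exact_mod_cast n.le_succ)

set_option maxSynthPendingDepth 3 in
/-- Local parallel sections of a smooth flat connection on a trivial bundle over an open set of
`ℝ⁴`. -/
theorem exists_parallel {n : Type*} [Fintype n] [DecidableEq n] {U : Set R4} (hU : IsOpen U)
    {M : Fin 4 → R4 → Matrix n n ℝ} (hM : ∀ a, MSmoothOn U (M a))
    (hflat : ∀ x ∈ U, ∀ a b, mpd b (M a) x + M a x * M b x = mpd a (M b) x + M b x * M a x)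
    {x₀ : R4} (hx₀ : x₀ ∈ U) :
    ∃ r > 0, Metric.ball x₀ r ⊆ U ∧ ∀ v : n → ℝ, ∃ s : R4 → n → ℝ, s x₀ = v ∧
      (∀ i, SmoothOn (Metric.ball x₀ r) fun y => s y i) ∧
      ∀ x ∈ Metric.ball x₀ r, ∀ a i, pd a (fun y => s y i) x = ∑ j, M a x i j * s x j := by
  let C : Fin 4 → n → n → R4 →L[ℝ] (n → ℝ) →L[ℝ] (n → ℝ) := fun a i j =>
    (EuclideanSpace.proj a : R4 →L[ℝ] ℝ).smulRight
      ((ContinuousLinearMap.proj j : (n → ℝ) →L[ℝ] ℝ).smulRight (Pi.single i (1 : ℝ)))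
  let Θ : R4 → R4 →L[ℝ] (n → ℝ) →L[ℝ] (n → ℝ) := fun x => ∑ a, ∑ i, ∑ j, M a x i j • C a i j
  have hCap : ∀ (c : Fin 4 → n → n → ℝ) (h : R4) (v : n → ℝ) (l : n),
      (∑ a, ∑ i, ∑ j, c a i j • C a i j) h v l = ∑ a, ∑ j, h a * c a l j * v j := by
    intro c h v l
    simp only [C, _root_.sum_apply, _root_.smul_apply,
      ContinuousLinearMap.smulRight_apply, proj_eucl_apply, ContinuousLinearMap.proj_apply,
      Finset.sum_apply, Pi.smul_apply, smul_eq_mul, Pi.single_apply]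
    refine Finset.sum_congr rfl fun a _ => ?_
    rw [Finset.sum_comm]
    refine Finset.sum_congr rfl fun j _ => ?_
    simp only [mul_ite, mul_one, mul_zero, Finset.sum_ite_eq, Finset.mem_univ, if_true]
    ring
  have hΘap : ∀ (x h : R4) (v : n → ℝ) (l : n), Θ x h v l = ∑ a, ∑ j, h a * M a x l j * v j :=
    fun x => hCap fun a i j => M a x i j
  have hΘ : ∀ x ∈ U, ContDiffAt ℝ ∞ Θ x := fun x hx =>
    ContDiffAt.sum fun a _ => ContDiffAt.sum fun i _ => ContDiffAt.sum fun j _ =>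
      (hM a i j x hx).smul contDiffAt_const
  have hd : ∀ x ∈ U, ∀ k : R4, fderiv ℝ Θ x k
      = ∑ a, ∑ i, ∑ j, (fderiv ℝ (fun y => M a y i j) x k) • C a i j := by
    intro x hx k
    have : HasFDerivAt Θ (∑ a, ∑ i, ∑ j, (fderiv ℝ (fun y => M a y i j) x).smulRight (C a i j)) x :=
      HasFDerivAt.fun_sum fun a _ => HasFDerivAt.fun_sum fun i _ => HasFDerivAt.fun_sum fun j _ =>
        ((hM a i j).differentiableAt hx).hasFDerivAt.smul_const _
    rw [this.fderiv]
    simp [_root_.sum_apply]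
  have hfl : ∀ x ∈ U, ∀ h k : R4, fderiv ℝ Θ x k h + (Θ x h).comp (Θ x k)
      = fderiv ℝ Θ x h k + (Θ x k).comp (Θ x h) := by
    intro x hx h k
    have key : ∀ h k : R4, ∀ (v : n → ℝ) (l : n),
        (fderiv ℝ Θ x k h + (Θ x h).comp (Θ x k)) v l
          = ∑ a, ∑ b, h a * k b * ∑ j, (mpd b (M a) x + M a x * M b x) l j * v j := by
      intro h k v l
      rw [_root_.add_apply, ContinuousLinearMap.comp_apply, Pi.add_apply, hd x hx, hCap, hΘap]
      rw [← Finset.sum_add_distrib]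
      refine Finset.sum_congr rfl fun a _ => ?_
      have e1 : ∑ j, h a * fderiv ℝ (fun y => M a y l j) x k * v j
          = ∑ b, h a * k b * ∑ j, mpd b (M a) x l j * v j := by
        simp only [Finset.mul_sum, fderiv_eq_sum_pd, Finset.sum_mul]
        rw [Finset.sum_comm]
        exact Finset.sum_congr rfl fun b _ => Finset.sum_congr rfl fun j _ => by
          simp only [mpd, Matrix.of_apply]; ring
      have e2 : ∑ j, h a * M a x l j * Θ x k v j
          = ∑ b, h a * k b * ∑ j, (M a x * M b x) l j * v j := by
        simp only [hΘap, Finset.mul_sum, Matrix.mul_apply, Finset.sum_mul]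
        rw [Finset.sum_comm]
        refine Finset.sum_congr rfl fun b _ => ?_
        rw [Finset.sum_comm]
        exact Finset.sum_congr rfl fun j _ => Finset.sum_congr rfl fun i _ => by ring
      rw [e1, e2, ← Finset.sum_add_distrib]
      refine Finset.sum_congr rfl fun b _ => ?_
      rw [← mul_add, ← Finset.sum_add_distrib]
      simp only [Matrix.add_apply, add_mul]
    refine ContinuousLinearMap.ext fun v => funext fun l => ?_
    rw [key, key, Finset.sum_comm]
    exact Finset.sum_congr rfl fun a _ => Finset.sum_congr rfl fun b _ => by
      rw [hflat x hx a b, mul_comm (h b)]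
  obtain ⟨r, hr, hball, hs⟩ := exists_parallel_section hU hΘ hfl hx₀
  refine ⟨r, hr, hball, fun v => ?_⟩
  obtain ⟨s, hs0, hs⟩ := hs v
  have hdi : ∀ i, ∀ x ∈ Metric.ball x₀ r, HasFDerivAt (fun y => s y i)
      ((ContinuousLinearMap.proj i : (n → ℝ) →L[ℝ] ℝ).comp ((Θ x).flip (s x))) x :=
    fun i x hx => (ContinuousLinearMap.proj i : (n → ℝ) →L[ℝ] ℝ).hasFDerivAt.comp x (hs x hx)
  have hpd : ∀ x ∈ Metric.ball x₀ r, ∀ a i, pd a (fun y => s y i) x = ∑ j, M a x i j * s x j := by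
    intro x hx a i
    rw [pd, (hdi i x hx).fderiv]
    simp only [ContinuousLinearMap.comp_apply, ContinuousLinearMap.flip_apply,
      ContinuousLinearMap.proj_apply, hΘap]
    simp
  refine ⟨s, hs0, fun i => ?_, hpd⟩
  -- Bootstrap: ∂_a s = M_a s is as regular as s, so each pass gains one derivative.
  have hn : ∀ m : ℕ, ∀ i, ContDiffOn ℝ m (fun y => s y i) (Metric.ball x₀ r) := by
    intro m
    induction m with
    | zero =>
      intro i
      exact_mod_cast contDiffOn_zero.2 fun x hx => (hdi i x hx).continuousAt.continuousWithinAt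
    | succ m ih =>
      intro i
      refine contDiffOn_succ_of_pd Metric.isOpen_ball
        (fun x hx => (hdi i x hx).differentiableAt.differentiableWithinAt) fun a => ?_
      refine ContDiffOn.congr (f := fun x => ∑ j, M a x i j * s x j) ?_ fun x hx => hpd x hx a i
      refine ContDiffOn.sum fun j _ => ContDiffOn.mul ?_ (ih j)
      exact (((hM a i j).mono hball).contDiffOn).of_le (by exact_mod_cast le_top)
  exact smoothOn_of_contDiffOn_nat Metric.isOpen_ball fun m => hn m i

end Coord

namespace Coord

open Filter Topology Matrix

/-! ### Ricci tensors of Segré type `{1,(111)}` -/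

/-- The Ricci endomorphism. -/
noncomputable def ricUp (G : R4 → Matrix (Fin 4) (Fin 4) ℝ) (x : R4) : Matrix (Fin 4) (Fin 4) ℝ :=
  (G x)⁻¹ * ric G x

/-- The traceless part of a matrix. -/
noncomputable def traceless (S : Matrix (Fin 4) (Fin 4) ℝ) : Matrix (Fin 4) (Fin 4) ℝ :=
  S - (S.trace / 4) • (1 : Matrix (Fin 4) (Fin 4) ℝ)

/-- The difference of the simple and the triple eigenvalue of a matrix. -/
noncomputable def eigGap (S : Matrix (Fin 4) (Fin 4) ℝ) : ℝ :=
  2 * (traceless S * traceless S * traceless S).trace / (traceless S * traceless S).trace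

/-- The simple eigenvalue of a matrix with eigenvalues of multiplicities one and three. -/
noncomputable def eigOne (S : Matrix (Fin 4) (Fin 4) ℝ) : ℝ := S.trace / 4 + 3 / 4 * eigGap S

/-- The triple eigenvalue of a matrix with eigenvalues of multiplicities one and three. -/
noncomputable def eigThree (S : Matrix (Fin 4) (Fin 4) ℝ) : ℝ := S.trace / 4 - 1 / 4 * eigGap S

lemma trace_conj {P : Matrix (Fin 4) (Fin 4) ℝ} (hP : IsUnit P.det)
    (S : Matrix (Fin 4) (Fin 4) ℝ) : (P⁻¹ * S * P).trace = S.trace := by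
  rw [Matrix.trace_mul_comm, ← Matrix.mul_assoc, Matrix.mul_nonsing_inv _ hP, Matrix.one_mul]

lemma traceless_conj {P : Matrix (Fin 4) (Fin 4) ℝ} (hP : IsUnit P.det)
    (S : Matrix (Fin 4) (Fin 4) ℝ) : traceless (P⁻¹ * S * P) = P⁻¹ * traceless S * P := by
  simp only [traceless, trace_conj hP, Matrix.mul_sub, Matrix.sub_mul, mul_smul_comm,
    smul_mul_assoc, Matrix.mul_one, Matrix.nonsing_inv_mul _ hP]

lemma conj_mul {P : Matrix (Fin 4) (Fin 4) ℝ} (hP : IsUnit P.det)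
    (S T : Matrix (Fin 4) (Fin 4) ℝ) : P⁻¹ * S * P * (P⁻¹ * T * P) = P⁻¹ * (S * T) * P := by
  simp only [Matrix.mul_assoc]
  rw [← Matrix.mul_assoc P P⁻¹, Matrix.mul_nonsing_inv _ hP, Matrix.one_mul]

lemma eigGap_conj {P : Matrix (Fin 4) (Fin 4) ℝ} (hP : IsUnit P.det)
    (S : Matrix (Fin 4) (Fin 4) ℝ) : eigGap (P⁻¹ * S * P) = eigGap S := by
  simp only [eigGap, traceless_conj hP, conj_mul hP, trace_conj hP]

lemma eigOne_conj {P : Matrix (Fin 4) (Fin 4) ℝ} (hP : IsUnit P.det)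
    (S : Matrix (Fin 4) (Fin 4) ℝ) : eigOne (P⁻¹ * S * P) = eigOne S := by
  simp only [eigOne, eigGap_conj hP, trace_conj hP]

lemma eigThree_conj {P : Matrix (Fin 4) (Fin 4) ℝ} (hP : IsUnit P.det)
    (S : Matrix (Fin 4) (Fin 4) ℝ) : eigThree (P⁻¹ * S * P) = eigThree S := by
  simp only [eigThree, eigGap_conj hP, trace_conj hP]

lemma traceless_diagonal (a b : ℝ) : traceless (Matrix.diagonal ![a, b, b, b])
    = Matrix.diagonal ![3 / 4 * (a - b), -(a - b) / 4, -(a - b) / 4, -(a - b) / 4] := by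
  ext i j
  fin_cases i <;> fin_cases j <;>
    simp [traceless, Matrix.trace, Matrix.diagonal, Fin.sum_univ_four] <;> ring

lemma trace_sq_traceless_diagonal (a b : ℝ) :
    (traceless (Matrix.diagonal ![a, b, b, b]) * traceless (Matrix.diagonal ![a, b, b, b])).trace
      = 3 / 4 * (a - b) ^ 2 := by
  simp only [traceless_diagonal, Matrix.diagonal_mul_diagonal, Matrix.trace_diagonal,
    Fin.sum_univ_four]
  simp
  ring

/-- With δ = a − b the traceless part is δ diag(3/4, −1/4, −1/4, −1/4); its square has trace 3δ²/4
and its cube 3δ³/8, whence the factor 2 in `eigGap`. Eigenvalues written as rational invariants of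
the matrix are smooth functions of the point. -/
lemma eigGap_diagonal {a b : ℝ} (h : a ≠ b) : eigGap (Matrix.diagonal ![a, b, b, b]) = a - b := by
  have h' := sub_ne_zero.2 h
  rw [eigGap, trace_sq_traceless_diagonal]
  simp only [traceless_diagonal, Matrix.diagonal_mul_diagonal, Matrix.trace_diagonal,
    Fin.sum_univ_four]
  simp
  field_simp
  ring

lemma trace_diagonal' (a b : ℝ) : (Matrix.diagonal ![a, b, b, b]).trace = a + 3 * b := by
  simp [Matrix.trace_diagonal, Fin.sum_univ_four]; ring

lemma eigOne_diagonal {a b : ℝ} (h : a ≠ b) : eigOne (Matrix.diagonal ![a, b, b, b]) = a := by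
  rw [eigOne, eigGap_diagonal h, trace_diagonal']; ring

lemma eigThree_diagonal {a b : ℝ} (h : a ≠ b) : eigThree (Matrix.diagonal ![a, b, b, b]) = b := by
  rw [eigThree, eigGap_diagonal h, trace_diagonal']; ring

/-- The Segré type `{1,(111)}` condition at a point. -/
def SegreAt (G : R4 → Matrix (Fin 4) (Fin 4) ℝ) (x : R4) : Prop :=
  ∃ (P : Matrix (Fin 4) (Fin 4) ℝ) (ρ₁ ρ₂ : ℝ), ρ₁ ≠ ρ₂ ∧
    Pᵀ * G x * P = Matrix.diagonal ![-1, 1, 1, 1] ∧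
    (G x)⁻¹ * ric G x * P = P * Matrix.diagonal ![ρ₁, ρ₂, ρ₂, ρ₂]

lemma minkowski_mul_self : (Matrix.diagonal ![(-1 : ℝ), 1, 1, 1])
    * Matrix.diagonal ![-1, 1, 1, 1] = 1 := by
  rw [Matrix.diagonal_mul_diagonal, ← Matrix.diagonal_one]
  congr 1
  ext i; fin_cases i <;> simp

lemma isUnit_det_of_orthonormal {P g : Matrix (Fin 4) (Fin 4) ℝ}
    (h : Pᵀ * g * P = Matrix.diagonal ![-1, 1, 1, 1]) : IsUnit P.det ∧ IsUnit g.det := by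
  have h1 := congrArg Matrix.det h
  rw [Matrix.det_mul, Matrix.det_mul, Matrix.det_transpose, Matrix.det_diagonal] at h1
  simp [Fin.prod_univ_four] at h1
  refine ⟨isUnit_iff_ne_zero.2 fun h0 => ?_, isUnit_iff_ne_zero.2 fun h0 => ?_⟩ <;>
    simp [h0] at h1

lemma SegreAt.det {G : R4 → Matrix (Fin 4) (Fin 4) ℝ} {x : R4} (h : SegreAt G x) :
    IsUnit (G x).det := by
  obtain ⟨P, _, _, _, hP, _⟩ := h
  exact (isUnit_det_of_orthonormal hP).2

/-- The algebraic form of a Ricci tensor of Segré type `{1,(111)}`, together with an adapted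
orthonormal frame. -/
lemma SegreAt.exists_frame {G : R4 → Matrix (Fin 4) (Fin 4) ℝ} {x : R4} (h : SegreAt G x)
    (hsym : (G x)ᵀ = G x) :
    eigOne (ricUp G x) ≠ eigThree (ricUp G x) ∧ (traceless (ricUp G x) * traceless (ricUp G x)).trace ≠ 0 ∧
    ∃ P : Matrix (Fin 4) (Fin 4) ℝ, ∃ u : Matrix (Fin 4) Unit ℝ,
      Pᵀ * G x * P = Matrix.diagonal ![-1, 1, 1, 1] ∧
      u = G x * (P.submatrix id fun _ => 0) ∧
      uᵀ * ((G x)⁻¹ * u) = -1 ∧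
      ric G x = eigThree (ricUp G x) • G x
        + (eigThree (ricUp G x) - eigOne (ricUp G x)) • (u * uᵀ) := by
  obtain ⟨P, ρ₁, ρ₂, hne, hP, hS⟩ := h
  obtain ⟨hPu, hGu⟩ := isUnit_det_of_orthonormal hP
  set η := Matrix.diagonal ![(-1 : ℝ), 1, 1, 1] with hη
  have hPi : P⁻¹ = η * Pᵀ * G x := by
    refine Matrix.inv_eq_left_inv ?_
    rw [Matrix.mul_assoc, Matrix.mul_assoc, ← Matrix.mul_assoc Pᵀ, hP, minkowski_mul_self]
  have hSP : ricUp G x = P⁻¹⁻¹ * Matrix.diagonal ![ρ₁, ρ₂, ρ₂, ρ₂] * P⁻¹ := by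
    rw [Matrix.nonsing_inv_nonsing_inv _ hPu, ← hS, Matrix.mul_assoc, Matrix.mul_nonsing_inv _ hPu,
      Matrix.mul_one, ricUp]
  have hPiu : IsUnit (P⁻¹).det := Matrix.isUnit_nonsing_inv_det P hPu
  have e1 : eigOne (ricUp G x) = ρ₁ := by rw [hSP, eigOne_conj hPiu, eigOne_diagonal hne]
  have e2 : eigThree (ricUp G x) = ρ₂ := by rw [hSP, eigThree_conj hPiu, eigThree_diagonal hne]
  refine ⟨by rw [e1, e2]; exact hne, ?_, P, _, hP, rfl, ?_, ?_⟩
  · rw [hSP, traceless_conj hPiu, conj_mul hPiu, trace_conj hPiu, trace_sq_traceless_diagonal]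
    have := sub_ne_zero.2 hne
    positivity
  · rw [← Matrix.mul_assoc (G x)⁻¹, Matrix.nonsing_inv_mul _ hGu, Matrix.one_mul,
      Matrix.transpose_mul, hsym]
    have h1 := congrFun (congrFun hP 0) 0
    ext i j
    rw [Matrix.mul_apply] at h1
    rw [Matrix.mul_apply]
    simp only [Matrix.mul_apply, Matrix.transpose_apply, Matrix.submatrix_apply, id] at h1 ⊢
    rw [h1]
    simp [hη]
  · rw [e1, e2]
    have h1 : ric G x = G x * ricUp G x := by
      rw [ricUp, ← Matrix.mul_assoc, Matrix.mul_nonsing_inv _ hGu, Matrix.one_mul]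
    -- A multiple of the identity plus a rank-one term. Since P⁻¹ = ηPᵀg, conjugation and lowering
    -- turn the rank-one term into u uᵀ, with a sign from η₀₀ = −1.
    have h2 : Matrix.diagonal ![ρ₁, ρ₂, ρ₂, ρ₂] = ρ₂ • (1 : Matrix (Fin 4) (Fin 4) ℝ)
        + (ρ₁ - ρ₂) • Matrix.single 0 0 1 := by
      ext i j
      fin_cases i <;> fin_cases j <;> simp [Matrix.single]
    have h3 : P * Matrix.single (0 : Fin 4) (0 : Fin 4) (1 : ℝ) * η * Pᵀ
        = - ((P.submatrix id fun _ : Unit => 0) * (P.submatrix id fun _ : Unit => 0)ᵀ) := by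
      ext i j
      simp [Matrix.mul_apply, Fin.sum_univ_four, Matrix.single, hη, Matrix.diagonal]
    rw [h1, hSP, Matrix.nonsing_inv_nonsing_inv _ hPu, h2, Matrix.mul_add, Matrix.add_mul,
      Matrix.mul_add, mul_smul_comm, Matrix.mul_one, smul_mul_assoc, Matrix.mul_nonsing_inv _ hPu,
      mul_smul_comm, Matrix.mul_one, hPi, Matrix.transpose_mul, hsym]
    congr 1
    simp only [mul_smul_comm, smul_mul_assoc]
    rw [← Matrix.mul_assoc (P * _), ← Matrix.mul_assoc (P * _), h3, Matrix.neg_mul,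
      Matrix.mul_neg, smul_neg, ← neg_smul, neg_sub]
    simp only [Matrix.mul_assoc]

lemma SegreAt.ric_symm {G : R4 → Matrix (Fin 4) (Fin 4) ℝ} {x : R4} (h : SegreAt G x)
    (hsym : (G x)ᵀ = G x) : (ric G x)ᵀ = ric G x := by
  obtain ⟨_, _, P, u, _, _, _, h⟩ := h.exists_frame hsym
  rw [h]
  simp [Matrix.transpose_add, Matrix.transpose_smul, Matrix.transpose_mul, hsym]

/-! ### The pointwise algebra of Yang's equations -/

/-- Here r = dρ₂, σ = ρ₂ − ρ₁, N = ∇u and q is u raised; the 4 in `E` comes from dσ = 4 dρ₂.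
Contraction with q gives the antisymmetric part of N in terms of r; a trace with g⁻¹ then forces r
to be proportional to u, so N is symmetric, and one more contraction with q determines N. -/
lemma yang_algebra {g gi : Matrix (Fin 4) (Fin 4) ℝ} {u q r : Fin 4 → ℝ} {σ : ℝ}
    {N : Fin 4 → Fin 4 → ℝ} (hσ : σ ≠ 0)
    (htr : ∀ a c, ∑ b, gi a b * g b c = if a = c then 1 else 0)
    (hq : ∀ a, q a = ∑ b, gi a b * u b) (hgq : ∀ a, ∑ b, g a b * q b = u a)
    (huq : ∑ a, u a * q a = -1) (hN : ∀ a, ∑ b, N a b * q b = 0) (hg : ∀ a b, g a b = g b a)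
    (hgi : ∀ a b, gi a b = gi b a)
    (E : ∀ a b c, r a * g b c + 4 * r a * (u b * u c) + σ * (N a b * u c + u b * N a c)
      = r b * g a c + 4 * r b * (u a * u c) + σ * (N b a * u c + u a * N b c)) :
    ∃ H : ℝ, (∀ a, r a = H * σ * u a) ∧ ∀ a b, N a b = H * (g a b + u a * u b) := by
  simp only [Fin.sum_univ_four] at hgq huq hN hq
  set α := r 0 * q 0 + r 1 * q 1 + r 2 * q 2 + r 3 * q 3 with hα
  -- Contraction of `E` with q in the index c; N q = 0 removes half of the N-terms.
  have h1 : ∀ a b, σ * (N a b - N b a) = -3 * (r a * u b - r b * u a) := by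
    intro a b
    linear_combination (-q 0) * E a b 0 - q 1 * E a b 1 - q 2 * E a b 2 - q 3 * E a b 3
      + r a * hgq b - r b * hgq a
      + (4 * r a * u b - 4 * r b * u a + σ * (N a b - N b a)) * huq + σ * u b * hN a
      - σ * u a * hN b
  have E' : ∀ a b c, r a * g b c - r b * g a c + (r a * u b - r b * u a) * u c
      + σ * (u b * N a c - u a * N b c) = 0 := by
    intro a b c
    linear_combination E a b c - u c * h1 a b
  -- Trace of `E'` with g⁻¹ over b and c.
  have hr₀ : ∀ a, 2 * r a = (α + σ * ∑ b, ∑ c, gi b c * N b c) * u a := by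
    intro a
    have A0 : ∑ b, ∑ c, gi b c * (r a * g b c - r b * g a c + (r a * u b - r b * u a) * u c
        + σ * (u b * N a c - u a * N b c)) = 0 :=
      Finset.sum_eq_zero fun b _ => Finset.sum_eq_zero fun c _ => by rw [E', mul_zero]
    have A1 : ∑ b, ∑ c, gi b c * g b c = 4 := by
      rw [Finset.sum_congr rfl fun b _ => (Finset.sum_congr rfl fun c _ =>
        by rw [hg b c]).trans (htr b b)]
      simp
    have A2 : ∑ b, r b * ∑ c, gi b c * g a c = r a := by
      rw [Finset.sum_congr rfl fun b _ => by
        rw [(Finset.sum_congr rfl fun c _ => by rw [hg a c]).trans (htr b a)]]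
      simp
    have A3 : ∑ c, N a c * ∑ b, gi c b * u b = 0 := by
      simp only [Fin.sum_univ_four]
      linear_combination hN a - N a 0 * hq 0 - N a 1 * hq 1 - N a 2 * hq 2 - N a 3 * hq 3
    have A4 : ∑ b, u b * ∑ c, gi b c * u c = -1 := by
      simp only [Fin.sum_univ_four]
      linear_combination huq - u 0 * hq 0 - u 1 * hq 1 - u 2 * hq 2 - u 3 * hq 3
    have A5 : ∑ b, r b * ∑ c, gi b c * u c = α := by
      simp only [Fin.sum_univ_four]
      linear_combination -hα - r 0 * hq 0 - r 1 * hq 1 - r 2 * hq 2 - r 3 * hq 3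
    have A6 : 2 * r a = (α + σ * ∑ b, ∑ c, gi b c * N b c) * u a := by
      have h01 := hgi 0 1
      have h02 := hgi 0 2
      have h03 := hgi 0 3
      have h12 := hgi 1 2
      have h13 := hgi 1 3
      have h23 := hgi 2 3
      simp only [Fin.sum_univ_four] at A0 A1 A2 A3 A4 A5 ⊢
      rw [← h01, ← h02, ← h03, ← h12, ← h13, ← h23] at *
      linear_combination A0 - r a * A1 + A2 - r a * A4 + u a * A5 - σ * A3
    exact A6
  have hr : ∀ a, r a = - α * u a := by
    intro a
    have A7 : 2 * α = - (α + σ * ∑ b, ∑ c, gi b c * N b c) := by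
      linear_combination 2 * hα + q 0 * hr₀ 0 + q 1 * hr₀ 1 + q 2 * hr₀ 2 + q 3 * hr₀ 3
        + (α + σ * ∑ b, ∑ c, gi b c * N b c) * huq
    linear_combination hr₀ a / 2 + u a / 2 * A7
  refine ⟨-α / σ, fun a => ?_, fun a b => ?_⟩
  · rw [hr a]; field_simp
  · have hn : N 0 b * q 0 + N 1 b * q 1 + N 2 b * q 2 + N 3 b * q 3 = 0 := by
      have : σ * (N 0 b * q 0 + N 1 b * q 1 + N 2 b * q 2 + N 3 b * q 3) = 0 := by
        linear_combination (-q 0) * h1 b 0 - q 1 * h1 b 1 - q 2 * h1 b 2 - q 3 * h1 b 3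
          + σ * hN b + 3 * r b * huq + 3 * u b * hα - 3 * hr b
      exact (mul_eq_zero.1 this).resolve_left hσ
    have h2 : σ * N a b = - α * (g a b + u a * u b) := by
      linear_combination (-q 0) * E' a 0 b - q 1 * E' a 1 b - q 2 * E' a 2 b - q 3 * E' a 3 b
        - (g a b + u a * u b) * hα + (r a * u b + σ * N a b) * huq - σ * u a * hn
        + r a * hgq b + r a * (q 0 * hg 0 b + q 1 * hg 1 b + q 2 * hg 2 b + q 3 * hg 3 b)
    field_simp
    linear_combination h2

end Coord

/-! ### From Yang's equations to a geodesic, irrotational, shear-free flow. -/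

namespace Coord

open Filter Topology Matrix

/-- The covariant derivative of a one-form. -/
noncomputable def covV (Γ : Fin 4 → R4 → Matrix (Fin 4) (Fin 4) ℝ) (a : Fin 4)
    (u : R4 → Matrix (Fin 4) Unit ℝ) (x : R4) : Matrix (Fin 4) Unit ℝ :=
  mpd a u x - (Γ a x)ᵀ * u x

/-- The Ricci tensor is `ρ₂ g + (ρ₂ - ρ₁) u ⊗ u` with a unit timelike, geodesic, shear- and
vorticity-free one-form `u` of expansion `3 H`, constant `ρ₁ + 3 ρ₂`, and all these scalars
constant orthogonally to `u`. -/
structure RWFrame (W : Set R4) (G : R4 → Matrix (Fin 4) (Fin 4) ℝ)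
    (u : R4 → Matrix (Fin 4) Unit ℝ) (ρ₁ ρ₂ H : R4 → ℝ) : Prop where
  metric : IsMetricOn W G
  smooth_u : MSmoothOn W u
  smooth_one : SmoothOn W ρ₁
  smooth_two : SmoothOn W ρ₂
  smooth_H : SmoothOn W H
  ne : ∀ x ∈ W, ρ₁ x ≠ ρ₂ x
  norm : ∀ x ∈ W, (u x)ᵀ * ((G x)⁻¹ * u x) = -1
  ric_eq : ∀ x ∈ W, ric G x = ρ₂ x • G x + (ρ₂ x - ρ₁ x) • (u x * (u x)ᵀ)
  cov : ∀ x ∈ W, ∀ a b, covV (chr G) a u x b () = H x * (G x a b + u x a () * u x b ())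
  pd_one : ∀ x ∈ W, ∀ a, pd a ρ₁ x = -3 * (H x * (ρ₂ x - ρ₁ x)) * u x a ()
  pd_two : ∀ x ∈ W, ∀ a, pd a ρ₂ x = H x * (ρ₂ x - ρ₁ x) * u x a ()
  frame : ∀ x ∈ W, ∃ E : Matrix (Fin 4) (Fin 3) ℝ, Eᵀ * G x * E = 1 ∧ (u x)ᵀ * E = 0

lemma covB_rank_one {W : Set R4} {G : R4 → Matrix (Fin 4) (Fin 4) ℝ} (hG : IsMetricOn W G)
    {u : R4 → Matrix (Fin 4) Unit ℝ} (hu : MSmoothOn W u) {ρ σ : R4 → ℝ} (hρ : SmoothOn W ρ)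
    (hσ : SmoothOn W σ) {x : R4} (hx : x ∈ W) (a : Fin 4)
    (hric : ∀ y ∈ W, ric G y = ρ y • G y + σ y • (u y * (u y)ᵀ)) :
    covB (chr G) a (ric G) x = pd a ρ x • G x + pd a σ x • (u x * (u x)ᵀ)
      + σ x • (covV (chr G) a u x * (u x)ᵀ + u x * (covV (chr G) a u x)ᵀ) := by
  have huu : MSmoothOn W fun y => u y * (u y)ᵀ := hu.mul hu.transpose
  rw [covB, mpd_congr_on hG.isOpen hric hx,
    mpd_add (U := W) a (MSmoothOn.smul hρ hG.smooth) (MSmoothOn.smul hσ huu) hx,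
    mpd_smul a hρ hG.smooth hx, mpd_smul a hσ huu hx, mpd_mul a hu hu.transpose hx, mpd_transpose,
    hric x hx, hG.mpd_eq hx]
  simp only [covV, Matrix.transpose_sub, Matrix.transpose_mul, Matrix.transpose_transpose,
    Matrix.mul_add, Matrix.add_mul, Matrix.mul_sub, Matrix.sub_mul, mul_smul_comm, smul_mul_assoc,
    smul_add, smul_sub, Matrix.mul_assoc]
  abel

/-- The derivative of the constant g⁻¹(u, u) is twice the pairing of ∇_a u with u. -/
lemma covV_orthogonal {W : Set R4} {G : R4 → Matrix (Fin 4) (Fin 4) ℝ} (hG : IsMetricOn W G)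
    {u : R4 → Matrix (Fin 4) Unit ℝ} (hu : MSmoothOn W u) {x : R4} (hx : x ∈ W) (a : Fin 4)
    {c : Matrix Unit Unit ℝ} (hn : ∀ y ∈ W, (u y)ᵀ * ((G y)⁻¹ * u y) = c) :
    (covV (chr G) a u x)ᵀ * ((G x)⁻¹ * u x) = 0 := by
  have h1 := mpd_congr_on hG.isOpen hn hx a
  rw [mpd_const, mpd_mul (U := W) a hu.transpose (hG.smooth_inv.mul hu) hx,
    mpd_mul a hG.smooth_inv hu hx, mpd_transpose, hG.mpd_inv_eq hx] at h1
  have h2 : (covV (chr G) a u x)ᵀ * ((G x)⁻¹ * u x)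
      + ((covV (chr G) a u x)ᵀ * ((G x)⁻¹ * u x))ᵀ = 0 := by
    rw [← h1]
    simp only [covV, Matrix.transpose_sub, Matrix.transpose_mul, Matrix.transpose_transpose,
      hG.inv_symm hx, Matrix.mul_add, Matrix.mul_sub, Matrix.sub_mul, Matrix.mul_assoc,
      Matrix.neg_mul, Matrix.mul_neg]
    abel
  ext i j
  have h3 := congrFun (congrFun h2 i) j
  rw [Matrix.add_apply, Matrix.transpose_apply] at h3
  simp only [Matrix.zero_apply] at h3 ⊢
  have : i = j := rfl
  subst this
  linarith

lemma unit_mul_apply {m n : Type*} (A : Matrix m Unit ℝ) (B : Matrix Unit n ℝ) (i : m) (j : n) :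
    (A * B) i j = A i () * B () j := by
  simp [Matrix.mul_apply]

/-- The Segré condition gives u only pointwise and up to sign. But Q = u⊗u = (Ric − ρ₂ g)/(ρ₂ − ρ₁)
is smooth, and where some Q_bb ≠ 0 its b-th column divided by √Q_bb is a smooth choice of u. The
rest is `yang_algebra` at each point. -/
theorem exists_rwFrame {U : Set R4} {G : R4 → Matrix (Fin 4) (Fin 4) ℝ} (hG : IsMetricOn U G)
    (hS : ∀ x ∈ U, SegreAt G x)
    (hY : ∀ x ∈ U, ∀ a b c, covB (chr G) a (ric G) x b c = covB (chr G) b (ric G) x a c)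
    {x₀ : R4} (hx₀ : x₀ ∈ U) :
    ∃ W ⊆ U, x₀ ∈ W ∧ ∃ u H, RWFrame W G u (fun x => eigOne (ricUp G x))
      (fun x => eigThree (ricUp G x)) H := by
  set ρ₁ : R4 → ℝ := fun x => eigOne (ricUp G x) with hρ₁
  set ρ₂ : R4 → ℝ := fun x => eigThree (ricUp G x) with hρ₂
  have hfr := fun x hx => (hS x hx).exists_frame (hG.symm x hx)
  have hup : MSmoothOn U (ricUp G) := hG.smooth_inv.mul hG.smooth_ric
  have htr : MSmoothOn U fun x => traceless (ricUp G x) :=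
    hup.sub (MSmoothOn.smul (hup.trace.div (SmoothOn.const 4) fun _ _ => by norm_num)
      (MSmoothOn.const 1))
  have hgap : SmoothOn U fun x => eigGap (ricUp G x) :=
    ((SmoothOn.const 2).mul ((htr.mul htr).mul htr).trace).div (htr.mul htr).trace
      fun x hx => (hfr x hx).2.1
  have hs1 : SmoothOn U ρ₁ := (hup.trace.div (SmoothOn.const 4) fun _ _ => by norm_num).add
    ((SmoothOn.const (3 / 4)).mul hgap)
  have hs2 : SmoothOn U ρ₂ := (hup.trace.div (SmoothOn.const 4) fun _ _ => by norm_num).sub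
    ((SmoothOn.const (1 / 4)).mul hgap)
  have hne : ∀ x ∈ U, ρ₂ x - ρ₁ x ≠ 0 := fun x hx => sub_ne_zero.2 (hfr x hx).1.symm
  let Q : R4 → Matrix (Fin 4) (Fin 4) ℝ := fun y => (1 / (ρ₂ y - ρ₁ y)) • (ric G y - ρ₂ y • G y)
  have hQs : MSmoothOn U Q := MSmoothOn.smul ((SmoothOn.const 1).div (hs2.sub hs1) hne)
    (hG.smooth_ric.sub (MSmoothOn.smul hs2 hG.smooth))
  have hQ : ∀ x ∈ U, ∃ P : Matrix (Fin 4) (Fin 4) ℝ, ∃ u : Matrix (Fin 4) Unit ℝ,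
      Pᵀ * G x * P = Matrix.diagonal ![-1, 1, 1, 1] ∧ u = G x * (P.submatrix id fun _ => 0) ∧
      uᵀ * ((G x)⁻¹ * u) = -1 ∧ Q x = u * uᵀ := by
    intro x hx
    obtain ⟨_, _, P, u, h1, h2, h3, h4⟩ := hfr x hx
    refine ⟨P, u, h1, h2, h3, ?_⟩
    simp only [Q]
    rw [h4, add_sub_cancel_left, smul_smul, one_div_mul_cancel (hne x hx), one_smul]
  obtain ⟨b, hb⟩ : ∃ b, Q x₀ b b ≠ 0 := by
    obtain ⟨P, u, _, _, h3, h4⟩ := hQ x₀ hx₀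
    by_contra! h
    have h0 : u = 0 := by
      ext i j
      have := h i
      rw [h4, unit_mul_apply, Matrix.transpose_apply, mul_self_eq_zero] at this
      exact this
    rw [h0] at h3
    have := congrFun (congrFun h3 ()) ()
    simp at this
  set W : Set R4 := {x | x ∈ U ∧ Q x b b ≠ 0} with hW
  have hWU : W ⊆ U := fun x hx => hx.1
  have hWo : IsOpen W := by
    have := (hQs b b).continuousOn.isOpen_inter_preimage hG.isOpen (isOpen_compl_singleton (x := 0))
    exact this
  let u : R4 → Matrix (Fin 4) Unit ℝ := fun x => Matrix.of fun a _ => Q x a b / Real.sqrt (Q x b b)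
  have hGW := hG.mono hWo hWU
  have hus : MSmoothOn W u := fun a _ => ((hQs a b).mono hWU).div
    (((hQs b b).mono hWU).sqrt fun x hx => hx.2) fun x hx => by
      obtain ⟨P, v, _, _, h3, h4⟩ := hQ x hx.1
      have h5 : Q x b b = v b () * v b () := by rw [h4, unit_mul_apply, Matrix.transpose_apply]
      have h6 := hx.2
      have : 0 < Q x b b := lt_of_le_of_ne (by rw [h5]; exact mul_self_nonneg _) (Ne.symm h6)
      exact (Real.sqrt_pos.2 this).ne'
  have huv : ∀ x ∈ W, ∃ P : Matrix (Fin 4) (Fin 4) ℝ, ∃ ε : ℝ, ε * ε = 1 ∧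
      Pᵀ * G x * P = Matrix.diagonal ![-1, 1, 1, 1] ∧
      u x = ε • (G x * (P.submatrix id fun _ => 0)) ∧
      (u x)ᵀ * ((G x)⁻¹ * u x) = -1 ∧ Q x = u x * (u x)ᵀ := by
    intro x hx
    obtain ⟨P, v, h1, h2, h3, h4⟩ := hQ x hx.1
    have h5 : ∀ a, Q x a b = v a () * v b () := fun a => by
      rw [h4, unit_mul_apply, Matrix.transpose_apply]
    have hvb : v b () ≠ 0 := fun h => hx.2 (by rw [h5, h, mul_zero])
    have hε : v b () / |v b ()| * (v b () / |v b ()|) = 1 := by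
      rw [div_mul_div_comm, abs_mul_abs_self, div_self (mul_ne_zero hvb hvb)]
    have huε : u x = (v b () / |v b ()|) • v := by
      ext a j
      simp only [u, Matrix.of_apply, Matrix.smul_apply, smul_eq_mul, h5, Real.sqrt_mul_self_eq_abs]
      ring
    refine ⟨P, v b () / |v b ()|, hε, h1, by rw [huε, h2], ?_, ?_⟩
    · rw [huε, Matrix.transpose_smul, Matrix.mul_smul, Matrix.mul_smul, Matrix.smul_mul, smul_smul,
        hε, one_smul, h3]
    · rw [huε, Matrix.transpose_smul, Matrix.mul_smul, Matrix.smul_mul, smul_smul, hε, one_smul, h4]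
  have hric : ∀ x ∈ W, ric G x = ρ₂ x • G x + (ρ₂ x - ρ₁ x) • (u x * (u x)ᵀ) := by
    intro x hx
    obtain ⟨_, _, _, _, _, _, h⟩ := huv x hx
    rw [← h]
    simp only [Q]
    rw [smul_smul, mul_one_div_cancel (hne x hx.1), one_smul]
    abel
  have hnorm : ∀ x ∈ W, (u x)ᵀ * ((G x)⁻¹ * u x) = -1 := fun x hx => by
    obtain ⟨_, _, _, _, _, h, _⟩ := huv x hx
    exact h
  -- `yang_algebra` supplies H only pointwise. Contracting dρ₂ = Hσu with the dual vector, where u·q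
  -- = −1, gives a smooth formula for it.
  let H : R4 → ℝ := fun x => - (∑ a, pd a ρ₂ x * ((G x)⁻¹ * u x) a ()) / (ρ₂ x - ρ₁ x)
  have hHs : SmoothOn W H := ((SmoothOn.sum fun a _ => ((hs2.pd a).mono hWU).mul
    ((hGW.smooth_inv.mul hus) a ())).neg).div ((hs2.sub hs1).mono hWU) fun x hx => hne x hx.1
  -- R = ρ₁ + 3ρ₂, so σ = 4ρ₂ − R; constancy of R gives dσ = 4 dρ₂.
  have hσ : (fun x => ρ₂ x - ρ₁ x) = fun x => 4 * ρ₂ x - ((G x)⁻¹ * ric G x).trace := by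
    funext x
    simp only [hρ₁, hρ₂, eigThree, eigOne, ricUp]
    ring
  have hpdσ : ∀ x ∈ W, ∀ a, pd a (fun x => ρ₂ x - ρ₁ x) x = 4 * pd a ρ₂ x := by
    intro x hx a
    have hd2 := hs2.differentiableAt hx.1
    rw [hσ, pd_sub (f := fun x => 4 * ρ₂ x) (g := fun x => ((G x)⁻¹ * ric G x).trace) a
      (hd2.const_mul 4) (hup.trace.differentiableAt hx.1),
      hG.pd_trace_of_yang (fun y hy => (hS y hy).ric_symm (hG.symm y hy)) hx.1 (hY x hx.1),
      pd_mul (f := fun _ => 4) a (differentiableAt_const _) hd2, pd_const]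
    ring
  have hmain : ∀ x ∈ W, (∀ a, pd a ρ₂ x = H x * (ρ₂ x - ρ₁ x) * u x a ()) ∧
      ∀ a b, covV (chr G) a u x b () = H x * (G x a b + u x a () * u x b ()) := by
    intro x hx
    have hnq : ∑ a, u x a () * ((G x)⁻¹ * u x) a () = -1 := by
      have := congrFun (congrFun (hnorm x hx) ()) ()
      rw [Matrix.mul_apply] at this
      simpa using this
    have hGq : ∀ a, ∑ b, G x a b * ((G x)⁻¹ * u x) b () = u x a () := by
      intro a
      rw [← Matrix.mul_apply, ← Matrix.mul_assoc, Matrix.mul_nonsing_inv _ (hG.det x hx.1),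
        Matrix.one_mul]
    have hcov := fun a => covB_rank_one hGW hus (hs2.mono hWU) ((hs2.sub hs1).mono hWU) hx a hric
    obtain ⟨h, h1, h2⟩ := yang_algebra (g := G x) (gi := (G x)⁻¹) (u := fun a => u x a ())
      (q := fun a => ((G x)⁻¹ * u x) a ()) (r := fun a => pd a ρ₂ x)
      (N := fun a b => covV (chr G) a u x b ()) (hne x hx.1)
      (fun a c => by
        rw [← Matrix.mul_apply, Matrix.nonsing_inv_mul _ (hG.det x hx.1), Matrix.one_apply])
      (fun a => Matrix.mul_apply) hGq hnq
      (fun a => by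
        have := congrFun (congrFun (covV_orthogonal hGW hus hx a hnorm) ()) ()
        rw [Matrix.mul_apply] at this
        simpa using this)
      (fun a b => (congrFun (congrFun (hG.symm x hx.1) a) b).symm)
      (fun a b => (congrFun (congrFun (hG.inv_symm hx.1) a) b).symm)
      (fun a b c => by
        have := hY x hx.1 a b c
        rw [hcov, hcov, hpdσ x hx, hpdσ x hx] at this
        simpa [unit_mul_apply, mul_add] using this)
    have hH : H x = h := by
      simp only [H, h1]
      rw [Finset.sum_congr rfl fun a _ => mul_assoc _ _ _, ← Finset.mul_sum, hnq]
      have := hne x hx.1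
      field_simp
    rw [hH]
    exact ⟨h1, h2⟩
  refine ⟨W, hWU, ⟨hx₀, hb⟩, u, H, hGW, hus, hs1.mono hWU, hs2.mono hWU, hHs,
    fun x hx => (hfr x hx.1).1, hnorm, hric, fun x hx => (hmain x hx).2, ?_,
    fun x hx => (hmain x hx).1, ?_⟩
  · intro x hx a
    have h1 := hpdσ x hx a
    rw [pd_sub a (hs2.differentiableAt hx.1) (hs1.differentiableAt hx.1)] at h1
    have h2 := (hmain x hx).1 a
    linear_combination -h1 - 3 * h2
  · intro x hx
    obtain ⟨P, ε, _, h1, h2, _, _⟩ := huv x hx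
    -- The spacelike columns of the tetrad.
    refine ⟨P.submatrix id Fin.succ, ?_, ?_⟩
    · ext i j
      have := congrFun (congrFun h1 i.succ) j.succ
      rw [Matrix.diagonal_apply] at this
      have h3 : ((P.submatrix id Fin.succ)ᵀ * G x * P.submatrix id Fin.succ) i j
          = (Pᵀ * G x * P) i.succ j.succ := by
        simp [Matrix.mul_apply]
      rw [h3, this, Matrix.one_apply]
      fin_cases i <;> fin_cases j <;> simp
    · rw [h2, Matrix.transpose_smul, Matrix.transpose_mul, hG.symm x hx.1, Matrix.smul_mul]
      ext i j
      have := congrFun (congrFun h1 0) j.succ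
      have h3 : ((P.submatrix id fun _ : Unit => 0)ᵀ * G x * P.submatrix id Fin.succ) i j
          = (Pᵀ * G x * P) 0 j.succ := by
        simp [Matrix.mul_apply]
      rw [Matrix.smul_apply, h3, this]
      fin_cases j <;> simp

end Coord

namespace Coord

open Filter Topology Matrix

/-! ### The product connection of a Robertson–Walker metric -/

/-- The vector field dual to the one-form `u`. -/
noncomputable def dualV (G : R4 → Matrix (Fin 4) (Fin 4) ℝ) (u : R4 → Matrix (Fin 4) Unit ℝ)
    (x : R4) : Matrix (Fin 4) Unit ℝ := (G x)⁻¹ * u x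

/-- The spatial metric `g + u ⊗ u`. -/
noncomputable def spaceMetric (G : R4 → Matrix (Fin 4) (Fin 4) ℝ) (u : R4 → Matrix (Fin 4) Unit ℝ)
    (x : R4) : Matrix (Fin 4) (Fin 4) ℝ := G x + u x * (u x)ᵀ

/-- The projection onto the orthogonal complement of `u`. -/
noncomputable def spaceProj (G : R4 → Matrix (Fin 4) (Fin 4) ℝ) (u : R4 → Matrix (Fin 4) Unit ℝ)
    (x : R4) : Matrix (Fin 4) (Fin 4) ℝ := 1 + dualV G u x * (u x)ᵀ

/-- The difference between the Levi-Civita connection and the product connection. -/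
noncomputable def prodDiff (G : R4 → Matrix (Fin 4) (Fin 4) ℝ) (u : R4 → Matrix (Fin 4) Unit ℝ)
    (H : R4 → ℝ) (d : Fin 4) (x : R4) : Matrix (Fin 4) (Fin 4) ℝ :=
  Matrix.of fun a b => - H x * (u x d () * spaceProj G u x a b + u x b () * spaceProj G u x a d)
    + H x * spaceMetric G u x d b * dualV G u x a ()

/-- The connection preserving `u` and, up to scale, the spatial metric. -/
noncomputable def prodConn (G : R4 → Matrix (Fin 4) (Fin 4) ℝ) (u : R4 → Matrix (Fin 4) Unit ℝ)
    (H : R4 → ℝ) (d : Fin 4) (x : R4) : Matrix (Fin 4) (Fin 4) ℝ :=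
  chr G d x - prodDiff G u H d x

/-- The curvature of the space sections. -/
noncomputable def spaceCurv (ρ₁ ρ₂ H : R4 → ℝ) (x : R4) : ℝ :=
  (ρ₂ x - ρ₁ x / 3 - 2 * H x ^ 2) / 2

/-- A parallel section is annihilated by the curvature. -/
lemma curv_mul_parallel {n m : Type*} [Fintype n] {U : Set R4} (hU : IsOpen U)
    {Γ : Fin 4 → R4 → Matrix n n ℝ} (hΓ : ∀ c, MSmoothOn U (Γ c)) {s : R4 → Matrix n m ℝ}
    (hs : MSmoothOn U s) (h : ∀ y ∈ U, ∀ c, mpd c s y = - (Γ c y * s y)) {x : R4} (hx : x ∈ U)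
    (c d : Fin 4) : curv Γ c d x * s x = 0 := by
  have key : ∀ c d, mpd d (mpd c s) x = - (mpd d (Γ c) x * s x) + Γ c x * (Γ d x * s x) := by
    intro c d
    rw [mpd_congr_on hU (fun y hy => h y hy c) hx d, mpd_neg, mpd_mul d (hΓ c) hs hx, h x hx,
      neg_add, Matrix.mul_neg, neg_neg]
  have h1 := mpd_comm c hs hx d
  rw [key, key, ← sub_eq_zero] at h1
  rw [← neg_eq_zero, ← h1]
  simp only [curv, Matrix.add_mul, Matrix.sub_mul, Matrix.mul_assoc]
  abel

namespace RWFrame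

variable {W : Set R4} {G : R4 → Matrix (Fin 4) (Fin 4) ℝ} {u : R4 → Matrix (Fin 4) Unit ℝ}
  {ρ₁ ρ₂ H : R4 → ℝ} {x : R4}

lemma smooth_dualV (F : RWFrame W G u ρ₁ ρ₂ H) : MSmoothOn W (dualV G u) :=
  F.metric.smooth_inv.mul F.smooth_u

lemma smooth_spaceMetric (F : RWFrame W G u ρ₁ ρ₂ H) : MSmoothOn W (spaceMetric G u) :=
  F.metric.smooth.add (F.smooth_u.mul F.smooth_u.transpose)

lemma smooth_spaceProj (F : RWFrame W G u ρ₁ ρ₂ H) : MSmoothOn W (spaceProj G u) :=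
  (MSmoothOn.const 1).add (F.smooth_dualV.mul F.smooth_u.transpose)

lemma smooth_prodDiff (F : RWFrame W G u ρ₁ ρ₂ H) (d : Fin 4) : MSmoothOn W (prodDiff G u H d) :=
  fun a b => (F.smooth_H.neg.mul (((F.smooth_u d ()).mul (F.smooth_spaceProj a b)).add
    ((F.smooth_u b ()).mul (F.smooth_spaceProj a d)))).add
    ((F.smooth_H.mul (F.smooth_spaceMetric d b)).mul (F.smooth_dualV a ()))

lemma smooth_prodConn (F : RWFrame W G u ρ₁ ρ₂ H) (d : Fin 4) : MSmoothOn W (prodConn G u H d) :=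
  (F.metric.smooth_chr d).sub (F.smooth_prodDiff d)

lemma smooth_spaceCurv (F : RWFrame W G u ρ₁ ρ₂ H) : SmoothOn W (spaceCurv ρ₁ ρ₂ H) :=
  ((F.smooth_two.sub (F.smooth_one.div (SmoothOn.const 3) fun _ _ => by norm_num)).sub
    ((SmoothOn.const 2).mul (F.smooth_H.pow 2))).div (SmoothOn.const 2) fun _ _ => by norm_num

/-! Algebraic identities. -/

lemma metric_symm (F : RWFrame W G u ρ₁ ρ₂ H) (hx : x ∈ W) (a b : Fin 4) : G x a b = G x b a :=
  (congrFun (congrFun (F.metric.symm x hx) a) b).symm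

lemma space_symm (F : RWFrame W G u ρ₁ ρ₂ H) (hx : x ∈ W) (a b : Fin 4) :
    spaceMetric G u x a b = spaceMetric G u x b a := by
  simp only [spaceMetric, Matrix.add_apply, unit_mul_apply, Matrix.transpose_apply,
    F.metric_symm hx a b]
  ring

lemma u_dual (F : RWFrame W G u ρ₁ ρ₂ H) (hx : x ∈ W) : (u x)ᵀ * dualV G u x = -1 := F.norm x hx

lemma dual_u (F : RWFrame W G u ρ₁ ρ₂ H) (hx : x ∈ W) : (dualV G u x)ᵀ * u x = -1 := by
  have := congrArg Matrix.transpose (F.u_dual hx)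
  rw [Matrix.transpose_mul, Matrix.transpose_transpose] at this
  rw [this]; simp

lemma metric_dual (F : RWFrame W G u ρ₁ ρ₂ H) (hx : x ∈ W) : G x * dualV G u x = u x := by
  rw [dualV, ← Matrix.mul_assoc, Matrix.mul_nonsing_inv _ (F.metric.det x hx), Matrix.one_mul]

lemma space_dual (F : RWFrame W G u ρ₁ ρ₂ H) (hx : x ∈ W) :
    spaceMetric G u x * dualV G u x = 0 := by
  rw [spaceMetric, Matrix.add_mul, F.metric_dual hx, Matrix.mul_assoc, F.u_dual hx]
  simp

lemma proj_dual (F : RWFrame W G u ρ₁ ρ₂ H) (hx : x ∈ W) : spaceProj G u x * dualV G u x = 0 := by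
  rw [spaceProj, Matrix.add_mul, Matrix.mul_assoc, F.u_dual hx]
  simp

lemma u_proj (F : RWFrame W G u ρ₁ ρ₂ H) (hx : x ∈ W) : (u x)ᵀ * spaceProj G u x = 0 := by
  rw [spaceProj, Matrix.mul_add, ← Matrix.mul_assoc, F.u_dual hx]
  simp

lemma proj_proj (F : RWFrame W G u ρ₁ ρ₂ H) (hx : x ∈ W) :
    spaceProj G u x * spaceProj G u x = spaceProj G u x := by
  conv_lhs => rw [spaceProj, Matrix.add_mul, Matrix.mul_assoc, ← spaceProj, F.u_proj hx]
  simp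

lemma metric_proj (F : RWFrame W G u ρ₁ ρ₂ H) (hx : x ∈ W) :
    G x * spaceProj G u x = spaceMetric G u x := by
  rw [spaceProj, Matrix.mul_add, ← Matrix.mul_assoc, F.metric_dual hx, Matrix.mul_one, spaceMetric]

lemma space_proj (F : RWFrame W G u ρ₁ ρ₂ H) (hx : x ∈ W) :
    spaceMetric G u x * spaceProj G u x = spaceMetric G u x := by
  rw [spaceMetric, Matrix.add_mul, F.metric_proj hx, Matrix.mul_assoc, F.u_proj hx]
  simp [spaceMetric]

lemma inv_space (F : RWFrame W G u ρ₁ ρ₂ H) (hx : x ∈ W) :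
    (G x)⁻¹ * spaceMetric G u x = spaceProj G u x := by
  rw [spaceMetric, Matrix.mul_add, Matrix.nonsing_inv_mul _ (F.metric.det x hx), ← Matrix.mul_assoc]
  rfl

lemma trace_proj (F : RWFrame W G u ρ₁ ρ₂ H) (hx : x ∈ W) : (spaceProj G u x).trace = 3 := by
  rw [spaceProj, Matrix.trace_add, Matrix.trace_mul_comm, F.u_dual hx]
  simp [Matrix.trace]
  norm_num

/-! Differential identities. -/

lemma prodConn_symm (F : RWFrame W G u ρ₁ ρ₂ H) (hx : x ∈ W) (a b c : Fin 4) :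
    prodConn G u H c x a b = prodConn G u H b x a c := by
  simp only [prodConn, Matrix.sub_apply, F.metric.chr_symm hx a b c, prodDiff, Matrix.of_apply,
    F.space_symm hx b c]
  ring

/-- The one-form `u` is parallel for the product connection. -/
lemma pd_u (F : RWFrame W G u ρ₁ ρ₂ H) (hx : x ∈ W) (a b : Fin 4) :
    pd a (fun y => u y b ()) x = ∑ e, prodConn G u H a x e b * u x e () := by
  have h1 := F.cov x hx a b
  have h2 : covV (chr G) a u x b () = pd a (fun y => u y b ()) x - ∑ e, chr G a x e b * u x e () := by
    simp only [covV, Matrix.sub_apply, Matrix.mul_apply, Matrix.transpose_apply]; rfl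
  have h3 := congrFun (congrFun (F.u_dual hx) ()) ()
  have h4 := fun b => congrFun (congrFun (F.u_proj hx) ()) b
  have h5 : spaceMetric G u x a b = G x a b + u x a () * u x b () := by
    simp [spaceMetric, unit_mul_apply]
  simp only [Matrix.mul_apply, Matrix.transpose_apply, Fin.sum_univ_four, Matrix.neg_apply,
    Matrix.one_apply_eq, Matrix.zero_apply] at h3 h4
  rw [h2] at h1
  simp only [prodConn, Matrix.sub_apply, prodDiff, Matrix.of_apply, Fin.sum_univ_four] at h1 ⊢
  linear_combination h1 - H x * h5 + H x * spaceMetric G u x a b * h3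
    - H x * u x a () * h4 b - H x * u x b () * h4 a

lemma mpd_u (F : RWFrame W G u ρ₁ ρ₂ H) (hx : x ∈ W) (a : Fin 4) :
    mpd a u x = (prodConn G u H a x)ᵀ * u x := by
  ext b j
  simp only [Matrix.mul_apply, Matrix.transpose_apply]
  exact F.pd_u hx a b

/-- The one-form `u` is closed. -/
lemma closed_u (F : RWFrame W G u ρ₁ ρ₂ H) (hx : x ∈ W) (a b : Fin 4) :
    pd a (fun y => u y b ()) x = pd b (fun y => u y a ()) x := by
  rw [F.pd_u hx, F.pd_u hx]
  exact Finset.sum_congr rfl fun e _ => by rw [F.prodConn_symm hx e b a]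

lemma prodDiff_dual (F : RWFrame W G u ρ₁ ρ₂ H) (hx : x ∈ W) (d a : Fin 4) :
    (prodDiff G u H d x * dualV G u x) a () = H x * spaceProj G u x a d := by
  have h3 := congrFun (congrFun (F.u_dual hx) ()) ()
  have h4 := congrFun (congrFun (F.proj_dual hx) a) ()
  have h5 := congrFun (congrFun (F.space_dual hx) d) ()
  simp only [Matrix.mul_apply, Matrix.transpose_apply, Fin.sum_univ_four, Matrix.neg_apply,
    Matrix.one_apply_eq, Matrix.zero_apply] at h3 h4 h5
  simp only [Matrix.mul_apply, prodDiff, Matrix.of_apply, Fin.sum_univ_four]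
  linear_combination - H x * spaceProj G u x a d * h3 - H x * u x d () * h4
    + H x * dualV G u x a () * h5

/-- The vector field dual to `u` is parallel for the product connection. -/
lemma mpd_dual (F : RWFrame W G u ρ₁ ρ₂ H) (hx : x ∈ W) (c : Fin 4) :
    mpd c (dualV G u) x = - (prodConn G u H c x * dualV G u x) := by
  have h1 : mpd c (dualV G u) x = - (chr G c x * dualV G u x)
      + (G x)⁻¹ * covV (chr G) c u x := by
    have : dualV G u = fun y => (G y)⁻¹ * u y := rfl
    rw [this, mpd_mul c F.metric.smooth_inv F.smooth_u hx, F.metric.mpd_inv_eq hx, covV]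
    simp only [Matrix.mul_sub, Matrix.sub_mul, Matrix.neg_mul, Matrix.mul_assoc]
    abel
  have h2 : (G x)⁻¹ * covV (chr G) c u x = prodDiff G u H c x * dualV G u x := by
    ext a j
    have h3 := congrFun (congrFun (F.inv_space hx) a) c
    rw [Matrix.mul_apply] at h3
    rw [show j = () from rfl, F.prodDiff_dual hx, Matrix.mul_apply, ← h3, Finset.mul_sum]
    refine Finset.sum_congr rfl fun b _ => ?_
    rw [F.cov x hx, F.space_symm hx b c]
    simp only [spaceMetric, Matrix.add_apply, unit_mul_apply, Matrix.transpose_apply]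
    ring
  rw [h1, h2, prodConn, Matrix.sub_mul]
  abel

/-- The spatial projection is parallel for the product connection. -/
lemma mpd_proj (F : RWFrame W G u ρ₁ ρ₂ H) (hx : x ∈ W) (c : Fin 4) :
    mpd c (spaceProj G u) x = - (prodConn G u H c x * spaceProj G u x)
      + spaceProj G u x * prodConn G u H c x := by
  have : spaceProj G u = fun y => 1 + dualV G u y * (u y)ᵀ := rfl
  rw [this, mpd_add (U := W) c (MSmoothOn.const 1) (F.smooth_dualV.mul F.smooth_u.transpose) hx,
    mpd_const, mpd_mul c F.smooth_dualV F.smooth_u.transpose hx, mpd_transpose, F.mpd_dual hx,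
    F.mpd_u hx]
  simp only [Matrix.transpose_mul, Matrix.transpose_transpose, Matrix.mul_add, Matrix.add_mul,
    Matrix.mul_one, Matrix.one_mul, Matrix.neg_mul, Matrix.mul_assoc]
  abel

/-- The spatial metric is parallel up to scale for the product connection. -/
lemma mpd_space (F : RWFrame W G u ρ₁ ρ₂ H) (hx : x ∈ W) (c : Fin 4) :
    mpd c (spaceMetric G u) x = (prodConn G u H c x)ᵀ * spaceMetric G u x
      + spaceMetric G u x * prodConn G u H c x
      - (2 * H x * u x c ()) • spaceMetric G u x := by
  have h1 : mpd c (spaceMetric G u) x = (chr G c x)ᵀ * spaceMetric G u x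
      + spaceMetric G u x * chr G c x + (covV (chr G) c u x * (u x)ᵀ
      + u x * (covV (chr G) c u x)ᵀ) := by
    have : spaceMetric G u = fun y => G y + u y * (u y)ᵀ := rfl
    rw [this, mpd_add (U := W) c F.metric.smooth (F.smooth_u.mul F.smooth_u.transpose) hx,
      mpd_mul c F.smooth_u F.smooth_u.transpose hx, mpd_transpose, F.metric.mpd_eq hx, covV]
    simp only [Matrix.transpose_mul, Matrix.transpose_transpose, Matrix.mul_add, Matrix.add_mul,
      Matrix.transpose_sub, Matrix.sub_mul, Matrix.mul_sub, Matrix.mul_assoc]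
    abel
  have h2 : ∀ a b, (spaceMetric G u x * prodDiff G u H c x) a b
      = - H x * (u x c () * spaceMetric G u x a b + u x b () * spaceMetric G u x a c) := by
    intro a b
    have h3 := fun b => congrFun (congrFun (F.space_proj hx) a) b
    have h5 := congrFun (congrFun (F.space_dual hx) a) ()
    simp only [Matrix.mul_apply, Fin.sum_univ_four, Matrix.zero_apply] at h3 h5
    simp only [Matrix.mul_apply, prodDiff, Matrix.of_apply, Fin.sum_univ_four]
    linear_combination - H x * u x c () * h3 b - H x * u x b () * h3 c
      + H x * spaceMetric G u x c b * h5
  have hst : (spaceMetric G u x)ᵀ = spaceMetric G u x := by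
    ext a b; exact F.space_symm hx b a
  have h4 : (prodDiff G u H c x)ᵀ * spaceMetric G u x = (spaceMetric G u x * prodDiff G u H c x)ᵀ := by
    rw [Matrix.transpose_mul, hst]
  have hs : ∀ a b, spaceMetric G u x a b = G x a b + u x a () * u x b () := fun a b => by
    simp [spaceMetric, unit_mul_apply]
  rw [h1, prodConn, Matrix.transpose_sub, Matrix.sub_mul, Matrix.mul_sub, h4]
  ext a b
  simp only [Matrix.add_apply, Matrix.sub_apply, Matrix.transpose_apply, Matrix.smul_apply, h2,
    unit_mul_apply, F.cov x hx, smul_eq_mul]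
  rw [← hs c a, ← hs c b, F.space_symm hx b a, F.space_symm hx c a, F.space_symm hx c b]
  ring

/-- The expansion is constant on the space sections. -/
lemma exists_pd_H (F : RWFrame W G u ρ₁ ρ₂ H) (hx : x ∈ W) :
    ∃ η : ℝ, ∀ a, pd a H x = η * u x a () := by
  have hσs : SmoothOn W fun y => H y * (ρ₂ y - ρ₁ y) :=
    F.smooth_H.mul (F.smooth_two.sub F.smooth_one)
  have h1 : ∀ a b, pd b (pd a ρ₂) x = (pd b H x * (ρ₂ x - ρ₁ x)
      + H x * (4 * (H x * (ρ₂ x - ρ₁ x)) * u x b ())) * u x a ()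
      + H x * (ρ₂ x - ρ₁ x) * pd b (fun y => u y a ()) x := by
    intro a b
    rw [pd_congr_on F.metric.isOpen (fun y hy => F.pd_two y hy a) hx b,
      pd_mul b (hσs.differentiableAt hx) ((F.smooth_u a ()).differentiableAt hx),
      pd_mul (g := fun y => ρ₂ y - ρ₁ y) b (F.smooth_H.differentiableAt hx)
        ((F.smooth_two.sub F.smooth_one).differentiableAt hx),
      pd_sub b (F.smooth_two.differentiableAt hx) (F.smooth_one.differentiableAt hx),
      F.pd_one x hx, F.pd_two x hx]
    ring
  have hσ : ρ₂ x - ρ₁ x ≠ 0 := sub_ne_zero.2 (F.ne x hx).symm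
  -- Apply d to dρ₂ = Hσu. Since u is closed and dσ is a multiple of u, only σ dH ∧ u = 0 remains.
  have h2 : ∀ a b, pd b H x * u x a () = pd a H x * u x b () := by
    intro a b
    have h3 := F.smooth_two.pd_comm hx a b
    rw [h1, h1, F.closed_u hx a b] at h3
    have : (ρ₂ x - ρ₁ x) * (pd b H x * u x a ()) = (ρ₂ x - ρ₁ x) * (pd a H x * u x b ()) := by
      linear_combination -h3
    exact mul_left_cancel₀ hσ this
  refine ⟨- ∑ b, pd b H x * dualV G u x b (), fun a => ?_⟩
  have h3 := congrFun (congrFun (F.u_dual hx) ()) ()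
  simp only [Matrix.mul_apply, Matrix.transpose_apply, Fin.sum_univ_four, Matrix.neg_apply,
    Matrix.one_apply_eq] at h3
  rw [Fin.sum_univ_four]
  linear_combination pd a H x * h3 + dualV G u x 0 () * h2 a 0 + dualV G u x 1 () * h2 a 1
    + dualV G u x 2 () * h2 a 2 + dualV G u x 3 () * h2 a 3

end RWFrame

end Coord

namespace Coord

open Filter Topology Matrix

/-! ### Curvature of the product connection -/

/-- In dimension three, curvature is determined by its Ricci tensor: the case of an isotropic
Ricci tensor. -/
lemma curvature_dim_three {r : Fin 3 → Fin 3 → Fin 3 → Fin 3 → ℝ} {K : ℝ}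
    (h₁ : ∀ i j k l, r i j k l = - r j i k l) (h₂ : ∀ i j k l, r i j k l = - r i j l k)
    (h₃ : ∀ i j k l, r i j k l + r i k l j + r i l j k = 0)
    (hr : ∀ j l, ∑ i, r i j i l = 2 * K * (1 : Matrix (Fin 3) (Fin 3) ℝ) j l) (i j k l : Fin 3) :
    r i j k l = K * ((1 : Matrix (Fin 3) (Fin 3) ℝ) i k * (1 : Matrix (Fin 3) (Fin 3) ℝ) j l
      - (1 : Matrix (Fin 3) (Fin 3) ℝ) i l * (1 : Matrix (Fin 3) (Fin 3) ℝ) j k) := by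
  -- Pair symmetry, a consequence of the two antisymmetries and the first Bianchi identity.
  have hp : ∀ i j k l, r i j k l = r k l i j := by
    intro i j k l
    linarith [h₃ i j k l, h₃ j i k l, h₃ k i j l, h₃ l i j k, h₁ i j k l, h₁ i j l k, h₁ i k j l,
      h₁ i k l j, h₁ i l j k, h₁ i l k j, h₁ j k i l, h₁ j k l i, h₁ j l i k, h₁ j l k i,
      h₁ k l i j, h₁ k l j i, h₂ i j k l, h₂ i k j l, h₂ i l j k, h₂ j k i l, h₂ j l i k,
      h₂ k l i j, h₂ j i k l, h₂ k i j l, h₂ l i j k, h₂ k j i l, h₂ l j i k, h₂ l k i j]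
  have z₁ : ∀ i k l, r i i k l = 0 := fun i k l => by linarith [h₁ i i k l]
  have z₂ : ∀ i j k, r i j k k = 0 := fun i j k => by linarith [h₂ i j k k]
  simp only [Fin.sum_univ_three] at hr
  have d0 := hr 0 0
  have d1 := hr 1 1
  have d2 := hr 2 2
  have e0 := hr 0 1
  have e1 := hr 0 2
  have e2 := hr 1 2
  simp only [z₁, z₂, Matrix.one_apply_eq, h₁ 1 0, h₁ 2 0, h₁ 2 1, h₂ 0 1 1 0, h₂ 0 2 2 0,
    h₂ 1 2 2 1, h₂ _ _ 1 0, h₂ _ _ 2 0, h₂ _ _ 2 1] at d0 d1 d2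
  rw [Matrix.one_apply_ne (by decide)] at e0 e1 e2
  simp only [z₁, z₂, h₁ 1 0, h₁ 2 0, h₁ 2 1, h₂ _ _ 1 0, h₂ _ _ 2 0, h₂ _ _ 2 1] at e0 e1 e2
  -- The three diagonal Ricci entries are the pairwise sums of the three sectional curvatures, which
  -- are therefore all K; each off-diagonal entry is a single remaining component.
  have a0 : r 0 1 0 1 = K := by linarith
  have a1 : r 0 2 0 2 = K := by linarith
  have a2 : r 1 2 1 2 = K := by linarith
  have b0 : r 0 2 1 2 = 0 := by linarith [hp 0 2 1 2]
  have b1 : r 0 1 1 2 = 0 := by linarith [hp 0 1 1 2]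
  have b2 : r 0 1 0 2 = 0 := by linarith [hp 0 1 0 2]
  have c0 : r 1 2 0 2 = 0 := by rw [hp]; exact b0
  have c1 : r 1 2 0 1 = 0 := by rw [hp]; exact b1
  have c2 : r 0 2 0 1 = 0 := by rw [hp]; exact b2
  fin_cases i <;> fin_cases j <;> fin_cases k <;> fin_cases l <;>
    simp [z₁, z₂, h₁ 1 0, h₁ 2 0, h₁ 2 1, h₂ _ _ 1 0, h₂ _ _ 2 0, h₂ _ _ 2 1, a0, a1, a2, b0, b1, b2,
      c0, c1, c2]

/-- Expansion of a covector annihilating `q` in a frame of the complement. -/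
lemma eq_sum_frame {E : Matrix (Fin 4) (Fin 3) ℝ} {θ : Matrix (Fin 3) (Fin 4) ℝ} {u q : Fin 4 → ℝ}
    (h : ∀ a b, ∑ i, E a i * θ i b = (1 : Matrix (Fin 4) (Fin 4) ℝ) a b + q a * u b) {f : Fin 4 → ℝ}
    (hf : ∑ a, f a * q a = 0) (b : Fin 4) : f b = ∑ i, θ i b * ∑ a, E a i * f a := by
  calc f b = ∑ a, f a * ((1 : Matrix (Fin 4) (Fin 4) ℝ) a b + q a * u b) := by
        simp only [mul_add, Finset.sum_add_distrib, Matrix.one_apply, mul_ite, mul_one, mul_zero,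
          Finset.sum_ite_eq', Finset.mem_univ, if_true, ← mul_assoc, ← Finset.sum_mul, hf]
        simp
    _ = ∑ a, ∑ i, θ i b * (E a i * f a) := by
        refine Finset.sum_congr rfl fun a _ => ?_
        rw [← h, Finset.mul_sum]
        exact Finset.sum_congr rfl fun i _ => by ring
    _ = _ := by
        rw [Finset.sum_comm]
        simp only [Finset.mul_sum]

/-- A curvature-like tensor on a four-dimensional space annihilating a vector `q`, with isotropic
Ricci tensor. -/
lemma curvature_space {R : Fin 4 → Fin 4 → Fin 4 → Fin 4 → ℝ} {K : ℝ} {h : Matrix (Fin 4) (Fin 4) ℝ}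
    {E : Matrix (Fin 4) (Fin 3) ℝ} {θ : Matrix (Fin 3) (Fin 4) ℝ} {u q : Fin 4 → ℝ}
    (hE : ∀ a b, ∑ i, E a i * θ i b = (1 : Matrix (Fin 4) (Fin 4) ℝ) a b + q a * u b)
    (hθ : ∀ a b, ∑ i, θ i a * θ i b = h a b)
    (hEh : ∀ j l, ∑ b, ∑ d, E b j * E d l * h b d = (1 : Matrix (Fin 3) (Fin 3) ℝ) j l)
    (h₁ : ∀ a b c d, R a b c d = - R b a c d) (h₂ : ∀ a b c d, R a b c d = - R a b d c)
    (h₃ : ∀ a b c d, R a b c d + R a c d b + R a d b c = 0)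
    (hq : ∀ a c d, ∑ b, R a b c d * q b = 0)
    (hr : ∀ b d, ∑ i, ∑ a, ∑ c, E a i * E c i * R a b c d = 2 * K * h b d) (a b c d : Fin 4) :
    R a b c d = K * (h a c * h b d - h a d * h b c) := by
  have hp : ∀ i j k l, R i j k l = R k l i j := by
    intro i j k l
    linarith [h₃ i j k l, h₃ j i k l, h₃ k i j l, h₃ l i j k, h₁ i j k l, h₁ i j l k, h₁ i k j l,
      h₁ i k l j, h₁ i l j k, h₁ i l k j, h₁ j k i l, h₁ j k l i, h₁ j l i k, h₁ j l k i,
      h₁ k l i j, h₁ k l j i, h₂ i j k l, h₂ i k j l, h₂ i l j k, h₂ j k i l, h₂ j l i k,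
      h₂ k l i j, h₂ j i k l, h₂ k i j l, h₂ l i j k, h₂ k j i l, h₂ l j i k, h₂ l k i j]
  have hq4 : ∀ a b c, ∑ d, R a b c d * q d = 0 := by
    intro a b c
    rw [← hq c a b]
    exact Finset.sum_congr rfl fun d _ => by rw [hp]
  have hq1 : ∀ b c d, ∑ a, R a b c d * q a = 0 := by
    intro b c d
    rw [← neg_eq_zero, ← hq b c d, ← Finset.sum_neg_distrib]
    exact Finset.sum_congr rfl fun a _ => by rw [h₁]; ring
  have hq3 : ∀ a b d, ∑ c, R a b c d * q c = 0 := by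
    intro a b d
    rw [← neg_eq_zero, ← hq4 a b d, ← Finset.sum_neg_distrib]
    exact Finset.sum_congr rfl fun c _ => by rw [h₂]; ring
  -- Components in the frame E. As R kills q in every slot, it is recovered from them through the
  -- coframe θ (`key`), and the three-dimensional lemma determines them.
  set r : Fin 3 → Fin 3 → Fin 3 → Fin 3 → ℝ := fun i j k l =>
    ∑ d, E d l * ∑ c, E c k * ∑ b, E b j * ∑ a, E a i * R a b c d with hrdef
  have hrr : ∀ i j k l, r i j k l = ∑ d, ∑ c, ∑ b, ∑ a, E d l * E c k * E b j * E a i * R a b c d := by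
    intro i j k l
    simp only [hrdef, Finset.mul_sum, mul_assoc]
  have key : R a b c d = ∑ i, θ i a * ∑ j, θ j b * ∑ k, θ k c * ∑ l, θ l d * r i j k l := by
    rw [eq_sum_frame hE (hq1 b c d) a]
    refine Finset.sum_congr rfl fun i _ => ?_
    congr 1
    rw [eq_sum_frame hE (f := fun b => ∑ a, E a i * R a b c d) ?_ b]
    · refine Finset.sum_congr rfl fun j _ => ?_
      congr 1
      rw [eq_sum_frame hE (f := fun c => ∑ b, E b j * ∑ a, E a i * R a b c d) ?_ c]
      · refine Finset.sum_congr rfl fun k _ => ?_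
        congr 1
        rw [eq_sum_frame hE (f := fun d => ∑ c, E c k * ∑ b, E b j * ∑ a, E a i * R a b c d) ?_ d]
        simp only [Finset.sum_mul, Finset.mul_sum]
        rw [Finset.sum_comm]
        refine Finset.sum_eq_zero fun c _ => ?_
        rw [Finset.sum_comm]
        refine Finset.sum_eq_zero fun b _ => ?_
        rw [Finset.sum_comm]
        refine Finset.sum_eq_zero fun a _ => ?_
        simp only [mul_assoc, ← Finset.mul_sum, hq4, mul_zero]
      · simp only [Finset.sum_mul, Finset.mul_sum]
        rw [Finset.sum_comm]
        refine Finset.sum_eq_zero fun b _ => ?_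
        rw [Finset.sum_comm]
        refine Finset.sum_eq_zero fun a _ => ?_
        simp only [mul_assoc, ← Finset.mul_sum, hq3, mul_zero]
    · simp only [Finset.sum_mul]
      rw [Finset.sum_comm]
      refine Finset.sum_eq_zero fun a _ => ?_
      simp only [mul_assoc, ← Finset.mul_sum, hq, mul_zero]
  have hr3 := curvature_dim_three (r := r) (K := K) ?_ ?_ ?_ ?_
  · rw [key]
    simp only [hr3, ← hθ, Fin.sum_univ_three, Matrix.one_apply]
    simp
    ring
  · intro i j k l
    rw [hrr, hrr, ← Finset.sum_neg_distrib]
    refine Finset.sum_congr rfl fun d _ => ?_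
    rw [← Finset.sum_neg_distrib]
    refine Finset.sum_congr rfl fun c _ => ?_
    rw [Finset.sum_comm, ← Finset.sum_neg_distrib]
    refine Finset.sum_congr rfl fun b _ => ?_
    rw [← Finset.sum_neg_distrib]
    exact Finset.sum_congr rfl fun a _ => by rw [h₁]; ring
  · intro i j k l
    rw [hrr, hrr, Finset.sum_comm, ← Finset.sum_neg_distrib]
    refine Finset.sum_congr rfl fun d _ => ?_
    rw [← Finset.sum_neg_distrib]
    refine Finset.sum_congr rfl fun c _ => ?_
    rw [← Finset.sum_neg_distrib]
    refine Finset.sum_congr rfl fun b _ => ?_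
    rw [← Finset.sum_neg_distrib]
    exact Finset.sum_congr rfl fun a _ => by rw [h₂]; ring
  · intro i j k l
    have e2 : r i k l j = ∑ d, ∑ c, ∑ b, ∑ a, E d l * E c k * E b j * E a i * R a c d b := by
      rw [hrr, Finset.sum_comm]
      refine Finset.sum_congr rfl fun d _ => ?_
      rw [Finset.sum_comm]
      refine Finset.sum_congr rfl fun c _ => Finset.sum_congr rfl fun b _ =>
        Finset.sum_congr rfl fun a _ => by ring
    have e3 : r i l j k = ∑ d, ∑ c, ∑ b, ∑ a, E d l * E c k * E b j * E a i * R a d b c := by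
      rw [hrr, Finset.sum_congr rfl fun c _ => Finset.sum_comm, Finset.sum_comm]
      refine Finset.sum_congr rfl fun d _ => Finset.sum_congr rfl fun c _ =>
        Finset.sum_congr rfl fun b _ => Finset.sum_congr rfl fun a _ => by ring
    rw [hrr, e2, e3]
    simp only [← Finset.sum_add_distrib, ← mul_add, h₃, mul_zero, Finset.sum_const_zero]
  · intro j l
    calc ∑ i, r i j i l = ∑ i, ∑ b, ∑ d, E b j * E d l * ∑ a, ∑ c, E a i * E c i * R a b c d := by
          refine Finset.sum_congr rfl fun i _ => ?_
          rw [hrr]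
          rw [Finset.sum_congr rfl fun c _ => Finset.sum_comm, Finset.sum_comm]
          refine Finset.sum_congr rfl fun b _ => Finset.sum_congr rfl fun d _ => ?_
          rw [Finset.sum_comm, Finset.mul_sum]
          refine Finset.sum_congr rfl fun a _ => ?_
          rw [Finset.mul_sum]
          exact Finset.sum_congr rfl fun c _ => by ring
      _ = ∑ b, ∑ d, E b j * E d l * ∑ i, ∑ a, ∑ c, E a i * E c i * R a b c d := by
          rw [Finset.sum_comm]
          refine Finset.sum_congr rfl fun b _ => ?_
          rw [Finset.sum_comm]
          exact Finset.sum_congr rfl fun d _ => (Finset.mul_sum _ _ _).symm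
      _ = _ := by
          rw [← hEh, Finset.mul_sum]
          refine Finset.sum_congr rfl fun b _ => ?_
          rw [Finset.mul_sum]
          exact Finset.sum_congr rfl fun d _ => by rw [hr]; ring

namespace RWFrame

variable {W : Set R4} {G : R4 → Matrix (Fin 4) (Fin 4) ℝ} {u : R4 → Matrix (Fin 4) Unit ℝ}
  {ρ₁ ρ₂ H : R4 → ℝ} {x : R4}

lemma pd_dual_apply (F : RWFrame W G u ρ₁ ρ₂ H) (hx : x ∈ W) (c a : Fin 4) :
    pd c (fun y => dualV G u y a ()) x = - ∑ e, prodConn G u H c x a e * dualV G u x e () := by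
  have := congrFun (congrFun (F.mpd_dual hx c) a) ()
  simp only [Matrix.neg_apply, Matrix.mul_apply] at this
  exact this

lemma pd_proj_apply (F : RWFrame W G u ρ₁ ρ₂ H) (hx : x ∈ W) (c a b : Fin 4) :
    pd c (fun y => spaceProj G u y a b) x = - ∑ e, prodConn G u H c x a e * spaceProj G u x e b
      + ∑ e, spaceProj G u x a e * prodConn G u H c x e b := by
  have := congrFun (congrFun (F.mpd_proj hx c) a) b
  simp only [Matrix.add_apply, Matrix.neg_apply, Matrix.mul_apply] at this
  exact this

lemma pd_space_apply (F : RWFrame W G u ρ₁ ρ₂ H) (hx : x ∈ W) (c a b : Fin 4) :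
    pd c (fun y => spaceMetric G u y a b) x = ∑ e, prodConn G u H c x e a * spaceMetric G u x e b
      + ∑ e, spaceMetric G u x a e * prodConn G u H c x e b
      - 2 * H x * u x c () * spaceMetric G u x a b := by
  have := congrFun (congrFun (F.mpd_space hx c) a) b
  simp only [Matrix.add_apply, Matrix.sub_apply, Matrix.mul_apply, Matrix.transpose_apply,
    Matrix.smul_apply, smul_eq_mul] at this
  exact this

/-- The covariant derivative of the difference tensor. -/
lemma mpd_prodDiff (F : RWFrame W G u ρ₁ ρ₂ H) (hx : x ∈ W) {η : ℝ}
    (hη : ∀ a, pd a H x = η * u x a ()) (c d a b : Fin 4) :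
    mpd c (prodDiff G u H d) x a b
      = - (η * u x c () * (u x d () * spaceProj G u x a b + u x b () * spaceProj G u x a d))
        + (η - 2 * H x ^ 2) * u x c () * dualV G u x a () * spaceMetric G u x d b
        - (prodConn G u H c x * prodDiff G u H d x) a b
        + (prodDiff G u H d x * prodConn G u H c x) a b
        + ∑ e, prodConn G u H c x e d * prodDiff G u H e x a b := by
  -- For the product connection u, its dual and the projection are parallel, and h scales by −2Hu.
  -- Apart from connection terms, only dH = ηu and this scaling contribute.
  have hd : mpd c (prodDiff G u H d) x a b = pd c (fun y => (- H y) * (u y d () * spaceProj G u y a b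
      + u y b () * spaceProj G u y a d) + (H y * spaceMetric G u y d b) * dualV G u y a ()) x := rfl
  have s1 := F.smooth_u d ()
  have s2 := F.smooth_u b ()
  have s3 := F.smooth_spaceProj a b
  have s4 := F.smooth_spaceProj a d
  have s5 := F.smooth_spaceMetric d b
  have s6 := F.smooth_dualV a ()
  have s7 := F.smooth_H
  rw [hd, pd_add c (((s7.neg).mul ((s1.mul s3).add (s2.mul s4))).differentiableAt hx)
      (((s7.mul s5).mul s6).differentiableAt hx),
    pd_mul c (s7.neg.differentiableAt hx) (((s1.mul s3).add (s2.mul s4)).differentiableAt hx),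
    pd_mul c ((s7.mul s5).differentiableAt hx) (s6.differentiableAt hx),
    pd_mul c (s7.differentiableAt hx) (s5.differentiableAt hx), pd_neg,
    pd_add c ((s1.mul s3).differentiableAt hx) ((s2.mul s4).differentiableAt hx),
    pd_mul c (s1.differentiableAt hx) (s3.differentiableAt hx),
    pd_mul c (s2.differentiableAt hx) (s4.differentiableAt hx), F.pd_u hx, F.pd_u hx,
    F.pd_dual_apply hx, F.pd_proj_apply hx, F.pd_proj_apply hx, F.pd_space_apply hx, hη]
  simp only [Matrix.mul_apply, prodDiff, Matrix.of_apply, Fin.sum_univ_four]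
  ring

lemma prodDiff_mul (F : RWFrame W G u ρ₁ ρ₂ H) (hx : x ∈ W) (c d a b : Fin 4) :
    (prodDiff G u H c x * prodDiff G u H d x) a b
      = H x ^ 2 * (u x c () * (u x d () * spaceProj G u x a b + u x b () * spaceProj G u x a d)
        + spaceProj G u x a c * spaceMetric G u x d b
        - dualV G u x a () * (u x d () * spaceMetric G u x c b
          + u x b () * spaceMetric G u x c d)) := by
  have h1 := congrFun (congrFun (F.u_dual hx) ()) ()
  have h2 := fun b => congrFun (congrFun (F.u_proj hx) ()) b
  have h3 := fun a b => congrFun (congrFun (F.proj_proj hx) a) b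
  have h4 := congrFun (congrFun (F.proj_dual hx) a) ()
  have h5 := congrFun (congrFun (F.space_dual hx) c) ()
  have h6 := fun a b => congrFun (congrFun (F.space_proj hx) a) b
  simp only [Matrix.mul_apply, Matrix.transpose_apply, Fin.sum_univ_four, Matrix.neg_apply,
    Matrix.one_apply_eq, Matrix.zero_apply] at h1 h2 h3 h4 h5 h6
  simp only [Matrix.mul_apply, prodDiff, Matrix.of_apply, Fin.sum_univ_four]
  linear_combination H x ^ 2 * (u x c () * u x d () * h3 a b + u x c () * u x b () * h3 a d
    + spaceProj G u x a c * (u x d () * h2 b + u x b () * h2 d)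
    - spaceMetric G u x d b * (u x c () * h4 + spaceProj G u x a c * h1)
    - dualV G u x a () * (u x d () * h6 c b + u x b () * h6 c d)
    + spaceMetric G u x d b * dualV G u x a () * h5)

/-- The curvature of the metric in terms of the curvature of the product connection. -/
lemma curv_eq (F : RWFrame W G u ρ₁ ρ₂ H) (hx : x ∈ W) {η : ℝ}
    (hη : ∀ a, pd a H x = η * u x a ()) (c d a b : Fin 4) :
    curv (chr G) c d x a b = curv (prodConn G u H) c d x a b
      + (H x ^ 2 - η) * (u x b () * (u x c () * spaceProj G u x a d - u x d () * spaceProj G u x a c)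
        - dualV G u x a () * (u x c () * spaceMetric G u x d b - u x d () * spaceMetric G u x c b))
      + H x ^ 2 * (spaceProj G u x a c * spaceMetric G u x d b
        - spaceProj G u x a d * spaceMetric G u x c b) := by
  have hc : ∀ c, mpd c (chr G d) x = mpd c (prodConn G u H d) x + mpd c (prodDiff G u H d) x := by
    intro c
    rw [← mpd_add c (F.smooth_prodConn d) (F.smooth_prodDiff d) hx]
    exact mpd_congr_on F.metric.isOpen (fun y _ => by simp [prodConn]) hx c
  have hd : ∀ d, mpd d (chr G c) x = mpd d (prodConn G u H c) x + mpd d (prodDiff G u H c) x := by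
    intro d
    rw [← mpd_add d (F.smooth_prodConn c) (F.smooth_prodDiff c) hx]
    exact mpd_congr_on F.metric.isOpen (fun y _ => by simp [prodConn]) hx d
  have hch : ∀ c, chr G c x = prodConn G u H c x + prodDiff G u H c x := fun c => by simp [prodConn]
  -- The correction for the form index of the difference tensor is symmetric in c, d because the
  -- product connection is torsion-free; it drops out of the curvature.
  have hsum : ∑ e, prodConn G u H c x e d * prodDiff G u H e x a b
      = ∑ e, prodConn G u H d x e c * prodDiff G u H e x a b :=
    Finset.sum_congr rfl fun e _ => by rw [F.prodConn_symm hx e d c]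
  simp only [curv, hc, hd, hch, Matrix.add_apply, Matrix.sub_apply, Matrix.add_mul, Matrix.mul_add,
    F.mpd_prodDiff hx hη, F.prodDiff_mul hx, hsum, F.space_symm hx d c]
  ring

end RWFrame

end Coord

/-! ### Constant curvature of the space sections. -/

namespace Coord

open Filter Topology Matrix

/-- If a connection preserves a bilinear form up to a closed conformal factor then its curvature
preserves the bilinear form. -/
lemma curv_preserves_conformal {U : Set R4} (hU : IsOpen U)
    {Γ : Fin 4 → R4 → Matrix (Fin 4) (Fin 4) ℝ} {B : R4 → Matrix (Fin 4) (Fin 4) ℝ}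
    {w : Fin 4 → R4 → ℝ} (hΓ : ∀ c, MSmoothOn U (Γ c)) (hB : MSmoothOn U B)
    (hw : ∀ c, SmoothOn U (w c))
    (hc : ∀ y ∈ U, ∀ c, mpd c B y = (Γ c y)ᵀ * B y + B y * Γ c y - w c y • B y) {x : R4} (hx : x ∈ U)
    (hcl : ∀ c d, pd c (w d) x = pd d (w c) x) (c d : Fin 4) :
    (curv Γ c d x)ᵀ * B x + B x * curv Γ c d x = 0 := by
  have key : ∀ c d, mpd d (mpd c B) x = (mpd d (Γ c) x)ᵀ * B x + (Γ c x)ᵀ * mpd d B x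
      + (mpd d B x * Γ c x + B x * mpd d (Γ c) x) - (pd d (w c) x • B x + w c x • mpd d B x) := by
    intro c d
    rw [mpd_congr_on hU (fun y hy => hc y hy c) hx d,
      mpd_sub (U := U) d (((hΓ c).transpose.mul hB).add (hB.mul (hΓ c))) (MSmoothOn.smul (hw c) hB) hx,
      mpd_smul d (hw c) hB hx,
      mpd_add (U := U) d ((hΓ c).transpose.mul hB) (hB.mul (hΓ c)) hx,
      mpd_mul d (hΓ c).transpose hB hx, mpd_mul d hB (hΓ c) hx, mpd_transpose]
  have h := mpd_comm c hB hx d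
  rw [key, key, hc x hx, hc x hx, hcl d c] at h
  simp only [curv, Matrix.transpose_sub, Matrix.transpose_add, Matrix.transpose_mul]
  rw [← sub_eq_zero] at h
  rw [← h]
  simp only [mul_add, add_mul, mul_sub, sub_mul, Matrix.mul_assoc, smul_add, smul_sub, mul_smul_comm,
    smul_mul_assoc]
  module

namespace RWFrame

variable {W : Set R4} {G : R4 → Matrix (Fin 4) (Fin 4) ℝ} {u : R4 → Matrix (Fin 4) Unit ℝ}
  {ρ₁ ρ₂ H : R4 → ℝ} {x : R4}

/-- The rows −uᵀ, Eᵀg are a left inverse of the columns q, E, where q is dual to u. For square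
matrices this is also a right inverse, which reads E Eᵀ g − q uᵀ = 1. -/
lemma frame_mul (F : RWFrame W G u ρ₁ ρ₂ H) (hx : x ∈ W) {E : Matrix (Fin 4) (Fin 3) ℝ}
    (hE : Eᵀ * G x * E = 1) (huE : (u x)ᵀ * E = 0) : E * (Eᵀ * G x) = spaceProj G u x := by
  have h1 : Matrix.fromRows (-(u x)ᵀ) (Eᵀ * G x) * Matrix.fromCols (dualV G u x) E = 1 := by
    have : Eᵀ * u x = 0 := by
      have := congrArg Matrix.transpose huE
      simpa [Matrix.transpose_mul] using this
    rw [Matrix.fromRows_mul_fromCols, Matrix.neg_mul, Matrix.neg_mul, F.u_dual hx, huE,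
      Matrix.mul_assoc, F.metric_dual hx, this, hE, neg_neg, neg_zero, Matrix.fromBlocks_one]
  have e : Fin 4 ≃ Unit ⊕ Fin 3 := Fintype.equivOfCardEq (by simp)
  have h2 := (Matrix.mul_eq_one_comm_of_equiv e.symm).1 h1
  rw [Matrix.fromCols_mul_fromRows, Matrix.mul_neg] at h2
  rw [spaceProj, ← h2]
  abel

/-- The conformal factor 2Hu is closed, since du = 0 and dH is a multiple of u, so the rescaling of
h leaves no trace in the curvature. -/
lemma prodConn_curv_preserves (F : RWFrame W G u ρ₁ ρ₂ H) (hx : x ∈ W) (c d : Fin 4) :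
    (curv (prodConn G u H) c d x)ᵀ * spaceMetric G u x
      + spaceMetric G u x * curv (prodConn G u H) c d x = 0 := by
  obtain ⟨η, hη⟩ := F.exists_pd_H hx
  refine curv_preserves_conformal F.metric.isOpen F.smooth_prodConn F.smooth_spaceMetric
    (w := fun c y => 2 * H y * u y c ())
    (fun c => ((SmoothOn.const 2).mul F.smooth_H).mul (F.smooth_u c ()))
    (fun y hy c => F.mpd_space hy c) hx (fun c d => ?_) c d
  have h : ∀ c d, pd c (fun y => 2 * H y * u y d ()) x
      = 2 * (η * u x c ()) * u x d () + 2 * H x * pd c (fun y => u y d ()) x := by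
    intro c d
    rw [pd_mul c (((SmoothOn.const 2).mul F.smooth_H).differentiableAt hx)
      ((F.smooth_u d ()).differentiableAt hx),
      pd_mul c ((SmoothOn.const (U := W) 2).differentiableAt hx) (F.smooth_H.differentiableAt hx),
      pd_const, hη]
    ring
  rw [h, h, F.closed_u hx d c]
  ring

lemma prodConn_curv_dual (F : RWFrame W G u ρ₁ ρ₂ H) (hx : x ∈ W) (c d : Fin 4) :
    curv (prodConn G u H) c d x * dualV G u x = 0 :=
  curv_mul_parallel F.metric.isOpen F.smooth_prodConn F.smooth_dualV
    (fun _ hy c => F.mpd_dual hy c) hx c d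

/-- The curvature preserves u⊗u because u is parallel; evaluating on the dual vector, which the
curvature kills, isolates u. -/
lemma u_prodConn_curv (F : RWFrame W G u ρ₁ ρ₂ H) (hx : x ∈ W) (c d : Fin 4) :
    (u x)ᵀ * curv (prodConn G u H) c d x = 0 := by
  have h := curv_preserves F.metric.isOpen F.smooth_prodConn (F.smooth_u.mul F.smooth_u.transpose)
    (fun y hy c => by
      rw [mpd_mul c F.smooth_u F.smooth_u.transpose hy, mpd_transpose, F.mpd_u hy,
        Matrix.transpose_mul, Matrix.transpose_transpose, Matrix.mul_assoc, Matrix.mul_assoc]) hx c d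
  have h1 := congrArg (fun M => M * dualV G u x) h
  simp only [Matrix.add_mul, Matrix.mul_assoc, F.u_dual hx, F.prodConn_curv_dual hx] at h1
  simp only [Matrix.mul_neg, Matrix.mul_one, Matrix.mul_zero, add_zero, Matrix.zero_mul,
    neg_eq_zero] at h1
  rw [← Matrix.transpose_eq_zero, Matrix.transpose_mul, Matrix.transpose_transpose, h1]

/-- The trace of `curv_eq`, compared with the given form of the Ricci tensor of g. -/
lemma sum_curv_prodConn (F : RWFrame W G u ρ₁ ρ₂ H) (hx : x ∈ W) {η : ℝ}
    (hη : ∀ a, pd a H x = η * u x a ()) (b d : Fin 4) :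
    ∑ a, curv (prodConn G u H) a d x a b
      = (ρ₂ x - (H x ^ 2 - η) - 2 * H x ^ 2) * spaceMetric G u x b d
        + (3 * (H x ^ 2 - η) - ρ₁ x) * (u x b () * u x d ()) := by
  have h0 := congrFun (congrFun (F.ric_eq x hx) b) d
  have h1 := congrFun (congrFun (F.u_dual hx) ()) ()
  have h2 := congrFun (congrFun (F.u_proj hx) ()) d
  have h3 := F.trace_proj hx
  have h5 := congrFun (congrFun (F.space_dual hx) b) ()
  have h6 := congrFun (congrFun (F.space_proj hx) b) d
  have h7 : spaceMetric G u x b d = G x b d + u x b () * u x d () := by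
    simp [spaceMetric, unit_mul_apply]
  simp only [Matrix.trace, Matrix.diag, Matrix.mul_apply, Matrix.transpose_apply,
    Fin.sum_univ_four, Matrix.neg_apply, Matrix.one_apply_eq, Matrix.zero_apply] at h1 h2 h3 h5 h6
  rw [ric_apply] at h0
  simp only [F.curv_eq hx hη, Matrix.add_apply, Matrix.smul_apply, smul_eq_mul, unit_mul_apply,
    Matrix.transpose_apply, Fin.sum_univ_four, F.space_symm hx _ b] at h0 ⊢
  linear_combination h0 - ρ₂ x * h7 - (H x ^ 2 - η) * (u x b () * (h2 - u x d () * h3)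
    - (spaceMetric G u x b d * h1 - u x d () * h5)) - H x ^ 2 * (spaceMetric G u x b d * h3 - h6)

/-- The Raychaudhuri equation. -/
lemma pd_H (F : RWFrame W G u ρ₁ ρ₂ H) (hx : x ∈ W) (a : Fin 4) :
    pd a H x = (H x ^ 2 - ρ₁ x / 3) * u x a () := by
  obtain ⟨η, hη⟩ := F.exists_pd_H hx
  have h1 := congrFun (congrFun (F.u_dual hx) ()) ()
  have h5 := fun d => congrFun (congrFun (F.space_dual hx) d) ()
  -- The contracted product curvature kills the dual vector, whereas `sum_curv_prodConn` evaluates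
  -- it there to a multiple of u; the coefficient 3(H² − η) − ρ₁ must vanish.
  have h8 : ∀ d, ∑ b, (∑ a, curv (prodConn G u H) a d x a b) * dualV G u x b () = 0 := by
    intro d
    simp only [Finset.sum_mul]
    rw [Finset.sum_comm]
    refine Finset.sum_eq_zero fun a _ => ?_
    have := congrFun (congrFun (F.prodConn_curv_dual hx a d) a) ()
    rwa [Matrix.mul_apply] at this
  simp only [F.sum_curv_prodConn hx hη, Matrix.mul_apply, Matrix.transpose_apply,
    Fin.sum_univ_four, Matrix.neg_apply, Matrix.one_apply_eq, Matrix.zero_apply] at h1 h5 h8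
  have h9 : ∀ d, (3 * (H x ^ 2 - η) - ρ₁ x) * u x d () = 0 := by
    intro d
    have h8d := h8 d
    simp only [F.space_symm hx _ d] at h8d
    linear_combination (3 * (H x ^ 2 - η) - ρ₁ x) * u x d () * h1 - h8d
      + (ρ₂ x - (H x ^ 2 - η) - 2 * H x ^ 2) * h5 d
  rw [hη]
  linear_combination - h9 a / 3

lemma ric_prodConn (F : RWFrame W G u ρ₁ ρ₂ H) (hx : x ∈ W) (b d : Fin 4) :
    ∑ a, curv (prodConn G u H) a d x a b
      = 2 * spaceCurv ρ₁ ρ₂ H x * spaceMetric G u x b d := by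
  rw [F.sum_curv_prodConn hx fun a => F.pd_H hx a, spaceCurv]
  ring

/-- The product connection has constant curvature on the space sections. -/
lemma curv_prodConn (F : RWFrame W G u ρ₁ ρ₂ H) (hx : x ∈ W) (c d a b : Fin 4) :
    curv (prodConn G u H) c d x a b = spaceCurv ρ₁ ρ₂ H x
      * (spaceProj G u x a c * spaceMetric G u x b d
        - spaceProj G u x a d * spaceMetric G u x b c) := by
  obtain ⟨E, hE, huE⟩ := F.frame x hx
  have hP := F.frame_mul hx hE huE
  have hsT : (spaceMetric G u x)ᵀ = spaceMetric G u x := by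
    ext a b; exact F.space_symm hx b a
  have hEP : E * Eᵀ = spaceProj G u x * (G x)⁻¹ := by
    rw [← hP]
    simp only [Matrix.mul_assoc, Matrix.mul_nonsing_inv _ (F.metric.det x hx), Matrix.mul_one]
  -- With its upper index lowered by h, the product curvature is an algebraic curvature tensor on
  -- the complement of u whose Ricci tensor is 2Kh.
  have key := curvature_space (R := fun a b c d =>
      (spaceMetric G u x * curv (prodConn G u H) c d x) a b) (K := spaceCurv ρ₁ ρ₂ H x)
    (h := spaceMetric G u x) (E := E) (θ := Eᵀ * G x) (u := fun a => u x a ())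
    (q := fun a => dualV G u x a ()) ?_ ?_ ?_ ?_ ?_ ?_ ?_ ?_
  · have h1 : curv (prodConn G u H) c d x
        = (G x)⁻¹ * (spaceMetric G u x * curv (prodConn G u H) c d x) := by
      rw [← Matrix.mul_assoc, F.inv_space hx, spaceProj, Matrix.add_mul, Matrix.mul_assoc,
        F.u_prodConn_curv hx]
      simp
    rw [h1, Matrix.mul_apply]
    simp only [key, ← F.inv_space hx, Matrix.mul_apply, Finset.sum_mul, Finset.mul_sum,
      ← Finset.sum_sub_distrib]
    exact Finset.sum_congr rfl fun e _ => by ring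
  · intro a b
    have := congrFun (congrFun hP a) b
    rw [Matrix.mul_apply] at this
    rw [this]
    simp [spaceProj, unit_mul_apply]
  · intro a b
    have h1 : (Eᵀ * G x)ᵀ * (Eᵀ * G x) = spaceMetric G u x := by
      rw [Matrix.transpose_mul, Matrix.transpose_transpose, F.metric.symm x hx, Matrix.mul_assoc, hP,
        F.metric_proj hx]
    have := congrFun (congrFun h1 a) b
    rwa [Matrix.mul_apply] at this
  · intro j l
    have h1 : Eᵀ * spaceMetric G u x * E = 1 := by
      rw [spaceMetric, Matrix.mul_add, Matrix.add_mul, hE, Matrix.mul_assoc, Matrix.mul_assoc, huE]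
      simp
    have := congrFun (congrFun h1 j) l
    rw [← this]
    simp only [Matrix.mul_apply, Finset.sum_mul, Matrix.transpose_apply]
    rw [Finset.sum_comm]
    exact Finset.sum_congr rfl fun b _ => Finset.sum_congr rfl fun d _ => by ring
  · intro a b c d
    have h := F.prodConn_curv_preserves hx c d
    have h1 : (curv (prodConn G u H) c d x)ᵀ * spaceMetric G u x
        = (spaceMetric G u x * curv (prodConn G u H) c d x)ᵀ := by
      rw [Matrix.transpose_mul, hsT]
    rw [h1] at h
    have := congrFun (congrFun h a) b
    simp only [Matrix.add_apply, Matrix.transpose_apply, Matrix.zero_apply] at this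
    linarith
  · intro a b c d
    rw [curv_antisymm, Matrix.mul_neg, Matrix.neg_apply]
  · intro a b c d
    simp only [Matrix.mul_apply, ← Finset.sum_add_distrib, ← mul_add]
    refine Finset.sum_eq_zero fun e _ => ?_
    rw [first_bianchi F.metric.isOpen (fun y hy a b c => F.prodConn_symm hy a b c) hx, mul_zero]
  · intro a c d
    have : (spaceMetric G u x * curv (prodConn G u H) c d x) * dualV G u x = 0 := by
      rw [Matrix.mul_assoc, F.prodConn_curv_dual hx, Matrix.mul_zero]
    have := congrFun (congrFun this a) ()
    rwa [Matrix.mul_apply] at this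
  · intro b d
    rw [← F.ric_prodConn hx]
    have hEPs : ∀ c a, ∑ i, E a i * E c i = (E * Eᵀ) c a := fun c a => by
      rw [Matrix.mul_apply]
      exact Finset.sum_congr rfl fun i _ => by rw [Matrix.transpose_apply, mul_comm]
    have h1 : ∀ c, E * Eᵀ * (spaceMetric G u x * curv (prodConn G u H) c d x)
        = curv (prodConn G u H) c d x := by
      intro c
      rw [hEP, Matrix.mul_assoc, ← Matrix.mul_assoc (G x)⁻¹, F.inv_space hx, ← Matrix.mul_assoc,
        F.proj_proj hx, spaceProj, Matrix.add_mul, Matrix.mul_assoc, F.u_prodConn_curv hx]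
      simp
    calc ∑ i, ∑ a, ∑ c, E a i * E c i * (spaceMetric G u x * curv (prodConn G u H) c d x) a b
        = ∑ c, ∑ a, (∑ i, E a i * E c i) *
            (spaceMetric G u x * curv (prodConn G u H) c d x) a b := by
          rw [Finset.sum_congr rfl fun i _ => Finset.sum_comm, Finset.sum_comm]
          refine Finset.sum_congr rfl fun c _ => ?_
          rw [Finset.sum_comm]
          exact Finset.sum_congr rfl fun a _ => (Finset.sum_mul _ _ _).symm
      _ = _ := by
          refine Finset.sum_congr rfl fun c _ => ?_
          simp only [hEPs]
          rw [← Matrix.mul_apply, h1]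

/-- The curvature of the space sections is inversely proportional to the square of the scale
factor. -/
lemma pd_spaceCurv (F : RWFrame W G u ρ₁ ρ₂ H) (hx : x ∈ W) (a : Fin 4) :
    pd a (spaceCurv ρ₁ ρ₂ H) x = 2 * H x * spaceCurv ρ₁ ρ₂ H x * u x a () := by
  have h : spaceCurv ρ₁ ρ₂ H = fun y => (1 / 2) * (ρ₂ y - (1 / 3) * ρ₁ y - 2 * (H y * H y)) := by
    funext y; rw [spaceCurv]; ring
  have s1 := F.smooth_one
  have s2 := F.smooth_two
  have s3 := F.smooth_H
  have t1 := (SmoothOn.const (U := W) (1 / 3)).mul s1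
  have t2 := (SmoothOn.const (U := W) 2).mul (s3.mul s3)
  rw [h, pd_mul a ((SmoothOn.const (U := W) (1 / 2)).differentiableAt hx)
      (((s2.sub t1).sub t2).differentiableAt hx),
    pd_sub a ((s2.sub t1).differentiableAt hx) (t2.differentiableAt hx),
    pd_sub a (s2.differentiableAt hx) (t1.differentiableAt hx),
    pd_mul a ((SmoothOn.const (U := W) (1 / 3)).differentiableAt hx) (s1.differentiableAt hx),
    pd_mul a ((SmoothOn.const (U := W) 2).differentiableAt hx) ((s3.mul s3).differentiableAt hx),
    pd_mul a (s3.differentiableAt hx) (s3.differentiableAt hx), F.pd_one x hx, F.pd_two x hx,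
    F.pd_H hx]
  simp only [pd_const]
  ring

end RWFrame

end Coord

namespace Coord

open Filter Topology Matrix

/-! ### Adapted functions of a Robertson–Walker metric -/

/-- The inverse of the spatial metric. -/
noncomputable def spaceInv (G : R4 → Matrix (Fin 4) (Fin 4) ℝ) (u : R4 → Matrix (Fin 4) Unit ℝ)
    (x : R4) : Matrix (Fin 4) (Fin 4) ℝ := (G x)⁻¹ + dualV G u x * (dualV G u x)ᵀ

/-- The linear system `∂_a ξ_b = Γ'^c_{ab} ξ_c - K h_{ab} X`, `∂_a X = P^c_a ξ_c`. -/
noncomputable def flatSystem (G : R4 → Matrix (Fin 4) (Fin 4) ℝ) (u : R4 → Matrix (Fin 4) Unit ℝ)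
    (ρ₁ ρ₂ H : R4 → ℝ) (a : Fin 4) (x : R4) : Matrix (Fin 4 ⊕ Unit) (Fin 4 ⊕ Unit) ℝ :=
  Matrix.fromBlocks (prodConn G u H a x)ᵀ
    (Matrix.of fun i _ => - (spaceCurv ρ₁ ρ₂ H x * spaceMetric G u x i a))
    (Matrix.of fun _ j => spaceProj G u x j a) 0

/-- A function with vanishing derivatives on a ball is constant. -/
lemma eq_of_pd_eq_zero {x₀ : R4} {r : ℝ} {f : R4 → ℝ} (hf : SmoothOn (Metric.ball x₀ r) f)
    (h : ∀ x ∈ Metric.ball x₀ r, ∀ a, pd a f x = 0) {x : R4} (hx : x ∈ Metric.ball x₀ r) :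
    f x = f x₀ := by
  have hr : x₀ ∈ Metric.ball x₀ r := Metric.mem_ball_self (Metric.pos_of_mem_ball hx)
  exact Metric.isOpen_ball.is_const_of_fderiv_eq_zero (convex_ball x₀ r).isPreconnected
    (fun y hy => (hf.differentiableAt hy).differentiableWithinAt)
    (fun y hy => eq_zero_of_pd (h y hy)) hx hr

namespace RWFrame

variable {W : Set R4} {G : R4 → Matrix (Fin 4) (Fin 4) ℝ} {u : R4 → Matrix (Fin 4) Unit ℝ}
  {ρ₁ ρ₂ H : R4 → ℝ} {x : R4}

lemma smooth_flatSystem (F : RWFrame W G u ρ₁ ρ₂ H) (a : Fin 4) :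
    MSmoothOn W (flatSystem G u ρ₁ ρ₂ H a) := by
  rintro (i | i) (j | j)
  · exact F.smooth_prodConn a j i
  · exact (F.smooth_spaceCurv.mul (F.smooth_spaceMetric i a)).neg
  · exact F.smooth_spaceProj j a
  · exact SmoothOn.const 0

/-- Integrability, block by block: the formula for the product curvature; Kh is parallel, as dK =
2HKu offsets the scaling −2Hu of h; the projection is parallel; h is symmetric. -/
lemma flat_flatSystem (F : RWFrame W G u ρ₁ ρ₂ H) (hx : x ∈ W) (a b : Fin 4) :
    mpd b (flatSystem G u ρ₁ ρ₂ H a) x + flatSystem G u ρ₁ ρ₂ H a x * flatSystem G u ρ₁ ρ₂ H b x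
      = mpd a (flatSystem G u ρ₁ ρ₂ H b) x
        + flatSystem G u ρ₁ ρ₂ H b x * flatSystem G u ρ₁ ρ₂ H a x := by
  ext i j
  rcases i with i | i <;> rcases j with j | j
  · have h := F.curv_prodConn hx b a j i
    have hd : ∀ a b, mpd b (flatSystem G u ρ₁ ρ₂ H a) x (Sum.inl i) (Sum.inl j)
        = mpd b (prodConn G u H a) x j i := fun a b => rfl
    simp only [curv, Matrix.sub_apply, Matrix.add_apply] at h
    simp only [Matrix.add_apply, hd]
    simp only [Matrix.mul_apply, Fintype.sum_sum_type, flatSystem, Matrix.fromBlocks_apply₁₁,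
      Matrix.fromBlocks_apply₁₂, Matrix.fromBlocks_apply₂₁, Matrix.transpose_apply,
      Matrix.of_apply, Finset.univ_unique, Finset.sum_singleton] at h ⊢
    simp only [Fin.sum_univ_four] at h ⊢
    linear_combination h
  · have hd : ∀ a b, mpd b (flatSystem G u ρ₁ ρ₂ H a) x (Sum.inl i) (Sum.inr j)
        = - (spaceCurv ρ₁ ρ₂ H x * ∑ e, prodConn G u H b x e i * spaceMetric G u x e a)
          - spaceCurv ρ₁ ρ₂ H x * ∑ e, spaceMetric G u x i e * prodConn G u H b x e a := by
      intro a b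
      have : mpd b (flatSystem G u ρ₁ ρ₂ H a) x (Sum.inl i) (Sum.inr j)
        = pd b (fun y => - (spaceCurv ρ₁ ρ₂ H y * spaceMetric G u y i a)) x := rfl
      rw [this, pd_neg, pd_mul b (F.smooth_spaceCurv.differentiableAt hx)
        ((F.smooth_spaceMetric i a).differentiableAt hx), F.pd_spaceCurv hx, F.pd_space_apply hx]
      ring
    simp only [Matrix.add_apply, hd]
    simp only [Matrix.mul_apply, Fintype.sum_sum_type, flatSystem, Matrix.fromBlocks_apply₁₁,
      Matrix.fromBlocks_apply₁₂, Matrix.fromBlocks_apply₂₂, Matrix.transpose_apply,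
      Matrix.of_apply, Finset.univ_unique, Finset.sum_singleton, Matrix.zero_apply]
    simp only [Fin.sum_univ_four, F.prodConn_symm hx _ b a]
    ring
  · have hd : ∀ a b, mpd b (flatSystem G u ρ₁ ρ₂ H a) x (Sum.inr i) (Sum.inl j)
        = - ∑ e, prodConn G u H b x j e * spaceProj G u x e a
      + ∑ e, spaceProj G u x j e * prodConn G u H b x e a := fun a b => F.pd_proj_apply hx b j a
    simp only [Matrix.add_apply, hd]
    simp only [Matrix.mul_apply, Fintype.sum_sum_type, flatSystem, Matrix.fromBlocks_apply₁₁,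
      Matrix.fromBlocks_apply₂₁, Matrix.fromBlocks_apply₂₂, Matrix.transpose_apply,
      Matrix.of_apply, Finset.univ_unique, Finset.sum_singleton, Matrix.zero_apply]
    simp only [Fin.sum_univ_four, F.prodConn_symm hx _ b a]
    ring
  · have hd : ∀ a b, mpd b (flatSystem G u ρ₁ ρ₂ H a) x (Sum.inr i) (Sum.inr j) = 0 := fun a b =>
      pd_const b 0 x
    have h1 := congrFun (congrFun (F.space_proj hx) a) b
    have h2 := congrFun (congrFun (F.space_proj hx) b) a
    simp only [Matrix.add_apply, hd]
    simp only [Matrix.mul_apply, Fintype.sum_sum_type, flatSystem, Matrix.fromBlocks_apply₂₁,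
      Matrix.fromBlocks_apply₁₂, Matrix.fromBlocks_apply₂₂, Matrix.transpose_apply,
      Matrix.of_apply, Finset.univ_unique, Finset.sum_singleton, Matrix.zero_apply] at h1 h2 ⊢
    simp only [Fin.sum_univ_four] at h1 h2 ⊢
    rw [F.space_symm hx 0 a, F.space_symm hx 1 a, F.space_symm hx 2 a, F.space_symm hx 3 a,
      F.space_symm hx 0 b, F.space_symm hx 1 b, F.space_symm hx 2 b, F.space_symm hx 3 b]
    linear_combination spaceCurv ρ₁ ρ₂ H x * (h1 - h2 + F.space_symm hx a b)

lemma spaceInv_eq (F : RWFrame W G u ρ₁ ρ₂ H) (hx : x ∈ W) :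
    spaceInv G u x = spaceProj G u x * (G x)⁻¹ := by
  rw [spaceInv, spaceProj, Matrix.add_mul, Matrix.one_mul, Matrix.mul_assoc]
  congr 2
  conv_lhs => rw [dualV, Matrix.transpose_mul, F.metric.inv_symm hx]

/-- On the complement of u the spatial metric and `spaceInv` are inverse to each other, so their
product is the transposed projection. -/
lemma space_inv (F : RWFrame W G u ρ₁ ρ₂ H) (hx : x ∈ W) :
    spaceMetric G u x * spaceInv G u x = (spaceProj G u x)ᵀ := by
  have hsT : (spaceMetric G u x)ᵀ = spaceMetric G u x := by
    ext a b; exact F.space_symm hx b a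
  rw [F.spaceInv_eq hx, ← Matrix.mul_assoc, F.space_proj hx, ← F.inv_space hx, Matrix.transpose_mul,
    hsT, F.metric.inv_symm hx]

lemma smooth_spaceInv (F : RWFrame W G u ρ₁ ρ₂ H) : MSmoothOn W (spaceInv G u) :=
  F.metric.smooth_inv.add (F.smooth_dualV.mul F.smooth_dualV.transpose)

lemma mpd_spaceInv (F : RWFrame W G u ρ₁ ρ₂ H) (hx : x ∈ W) (c : Fin 4) :
    mpd c (spaceInv G u) x = - (prodConn G u H c x * spaceInv G u x)
      - spaceInv G u x * (prodConn G u H c x)ᵀ + (2 * H x * u x c ()) • spaceInv G u x := by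
  have hC : prodDiff G u H c x * (G x)⁻¹ + (prodDiff G u H c x * (G x)⁻¹)ᵀ
      = - ((2 * H x * u x c ()) • spaceInv G u x) := by
    have hE : ∀ a b, (prodDiff G u H c x * (G x)⁻¹) a b
        = - H x * (u x c () * spaceInv G u x a b + spaceProj G u x a c * dualV G u x b ())
          + H x * spaceProj G u x b c * dualV G u x a () := by
      intro a b
      have h1 := congrFun (congrFun (F.spaceInv_eq hx) a) b
      have h2 := congrFun (congrFun (F.inv_space hx) b) c
      have h3 : dualV G u x b () = ∑ e, (G x)⁻¹ b e * u x e () := by rw [dualV, Matrix.mul_apply]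
      have h4 : ∀ e, (G x)⁻¹ e b = (G x)⁻¹ b e := fun e =>
        (congrFun (congrFun (F.metric.inv_symm hx) e) b).symm
      simp only [Matrix.mul_apply, Fin.sum_univ_four, h4] at h1 h2 h3
      simp only [Matrix.mul_apply, prodDiff, Matrix.of_apply, Fin.sum_univ_four, h4, h1, ← h2]
      simp only [F.space_symm hx _ c]
      rw [h3]
      ring
    have hs : ∀ a b, spaceInv G u x a b = spaceInv G u x b a := by
      intro a b
      have h4 : (G x)⁻¹ a b = (G x)⁻¹ b a := (congrFun (congrFun (F.metric.inv_symm hx) a) b).symm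
      simp only [spaceInv, Matrix.add_apply, unit_mul_apply, Matrix.transpose_apply, h4]
      ring
    ext a b
    simp only [Matrix.add_apply, Matrix.transpose_apply, hE, Matrix.neg_apply, Matrix.smul_apply,
      smul_eq_mul, hs b a]
    ring
  have hch : chr G c x = prodConn G u H c x + prodDiff G u H c x := by simp [prodConn]
  have h1 : mpd c (spaceInv G u) x = mpd c (fun y => (G y)⁻¹) x
      + mpd c (fun y => dualV G u y * (dualV G u y)ᵀ) x :=
    mpd_add c F.metric.smooth_inv (F.smooth_dualV.mul F.smooth_dualV.transpose) hx
  have h2 : (2 * H x * u x c ()) • spaceInv G u x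
      = - (prodDiff G u H c x * (G x)⁻¹ + (G x)⁻¹ * (prodDiff G u H c x)ᵀ) := by
    rw [Matrix.transpose_mul, F.metric.inv_symm hx] at hC
    rw [hC, neg_neg]
  rw [h1, mpd_mul c F.smooth_dualV F.smooth_dualV.transpose hx, mpd_transpose, F.mpd_dual hx,
    F.metric.mpd_inv_eq hx, hch, h2]
  simp only [spaceInv, Matrix.add_mul, Matrix.mul_add, Matrix.transpose_add, Matrix.transpose_neg,
    Matrix.transpose_mul, Matrix.neg_mul, Matrix.mul_neg, Matrix.mul_assoc]
  abel

end RWFrame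

end Coord

/-! ### Cosmic time, scale factor and ambient coordinates. -/

namespace Coord

open Filter Topology Matrix

namespace RWFrame

variable {W : Set R4} {G : R4 → Matrix (Fin 4) (Fin 4) ℝ} {u : R4 → Matrix (Fin 4) Unit ℝ}
  {ρ₁ ρ₂ H : R4 → ℝ} {x : R4}

/-- Cosmic time and the scale factor. -/
lemma exists_time_scale (F : RWFrame W G u ρ₁ ρ₂ H) {x₀ : R4} {r : ℝ}
    (hW : Metric.ball x₀ r ⊆ W) {c : ℝ} (hc : 0 < c) :
    ∃ t A : R4 → ℝ, SmoothOn (Metric.ball x₀ r) t ∧ SmoothOn (Metric.ball x₀ r) A ∧ A x₀ = c ∧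
      ∀ x ∈ Metric.ball x₀ r, 0 < A x ∧ A x ^ 2 * spaceCurv ρ₁ ρ₂ H x
          = c ^ 2 * spaceCurv ρ₁ ρ₂ H x₀ ∧
        ∀ a, pd a t x = - u x a () ∧ pd a A x = - (H x * A x) * u x a () := by
  obtain ⟨t, ht, htd⟩ := exists_potential (x₀ := x₀) (r := r) (w := fun a y => - u y a ())
    (fun a => (F.smooth_u a ()).neg.mono hW) (fun x hx a b => by
      rw [pd_neg, pd_neg, F.closed_u (hW hx)])
  have hpd : ∀ x ∈ W, ∀ a b, pd a (fun y => - H y * u y b ()) x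
      = - (H x ^ 2 - ρ₁ x / 3) * u x a () * u x b () - H x * pd a (fun y => u y b ()) x := by
    intro x hx a b
    rw [pd_mul a (F.smooth_H.neg.differentiableAt hx) ((F.smooth_u b ()).differentiableAt hx),
      pd_neg, F.pd_H hx]
    ring
  -- Hu is closed because dH is a multiple of u and du = 0. The potential of −Hu is the logarithm of
  -- the scale factor, up to a constant.
  obtain ⟨α, hα, hαd⟩ := exists_potential (x₀ := x₀) (r := r) (w := fun a y => - H y * u y a ())
    (fun a => (F.smooth_H.neg.mul (F.smooth_u a ())).mono hW) (fun x hx a b => by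
      rw [hpd x (hW hx), hpd x (hW hx), F.closed_u (hW hx) a b]
      ring)
  have hA : SmoothOn (Metric.ball x₀ r) fun y => c * Real.exp (α y - α x₀) :=
    (SmoothOn.const c).mul (hα.sub (SmoothOn.const _)).exp
  have hAd : ∀ x ∈ Metric.ball x₀ r, ∀ a, pd a (fun y => c * Real.exp (α y - α x₀)) x
      = - (H x * (c * Real.exp (α x - α x₀))) * u x a () := by
    intro x hx a
    have h1 := (hα.differentiableAt hx).sub_const (α x₀)
    rw [pd_mul a (differentiableAt_const c) h1.exp, pd_const,
      pd_comp (f := fun y => α y - α x₀) a (Real.hasDerivAt_exp _) h1,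
      pd_sub a (hα.differentiableAt hx) (differentiableAt_const _), pd_const, hαd x hx]
    ring
  have hAK : ∀ x ∈ Metric.ball x₀ r, (c * Real.exp (α x - α x₀)) ^ 2 * spaceCurv ρ₁ ρ₂ H x
      = c ^ 2 * spaceCurv ρ₁ ρ₂ H x₀ := by
    intro x hx
    have hs : SmoothOn (Metric.ball x₀ r) fun y => (c * Real.exp (α y - α x₀)) ^ 2
        * spaceCurv ρ₁ ρ₂ H y := (hA.pow 2).mul (F.smooth_spaceCurv.mono hW)
    rw [eq_of_pd_eq_zero hs (fun y hy a => ?_) hx]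
    · simp
    · have h1 : (fun y => (c * Real.exp (α y - α x₀)) ^ 2 * spaceCurv ρ₁ ρ₂ H y)
          = fun y => (c * Real.exp (α y - α x₀)) * ((c * Real.exp (α y - α x₀))
            * spaceCurv ρ₁ ρ₂ H y) := by funext y; ring
      have hK := F.smooth_spaceCurv.mono hW
      rw [h1, pd_mul a (hA.differentiableAt hy) ((hA.mul hK).differentiableAt hy),
        pd_mul a (hA.differentiableAt hy) (hK.differentiableAt hy), hAd y hy,
        F.pd_spaceCurv (hW hy)]
      ring
  exact ⟨t, _, ht, hA, by simp, fun x hx => ⟨by positivity, hAK x hx, fun a =>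
    ⟨htd x hx a, hAd x hx a⟩⟩⟩

/-- Cosmic time, the scale factor, and the restrictions to the space sections of the Cartesian
coordinates of the ambient space of the model of constant curvature. -/
lemma exists_adapted (F : RWFrame W G u ρ₁ ρ₂ H) {x₀ : R4} (hx₀ : x₀ ∈ W) {c k : ℝ} (hc : 0 < c)
    (hk : c ^ 2 * spaceCurv ρ₁ ρ₂ H x₀ = k) :
    ∃ r > 0, Metric.ball x₀ r ⊆ W ∧ ∃ (t A : R4 → ℝ) (X : Fin 3 → R4 → ℝ),
      SmoothOn (Metric.ball x₀ r) t ∧ SmoothOn (Metric.ball x₀ r) A ∧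
      (∀ i, SmoothOn (Metric.ball x₀ r) (X i)) ∧ (∀ i, X i x₀ = 0) ∧
      ∀ x ∈ Metric.ball x₀ r, 0 < A x ∧
        (∀ a, pd a t x = - u x a () ∧ pd a A x = - (H x * A x) * u x a ()) ∧
        (∀ i, ∑ a, dualV G u x a () * pd a (X i) x = 0) ∧
        ∀ i j, A x ^ 2 * (∑ a, ∑ b, pd a (X i) x * spaceInv G u x a b * pd b (X j) x)
          = (1 : Matrix (Fin 3) (Fin 3) ℝ) i j - k * (X i x * X j x) := by
  obtain ⟨r, hr, hW, hs⟩ := exists_parallel F.metric.isOpen F.smooth_flatSystem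
    (fun x hx a b => F.flat_flatSystem hx a b) hx₀
  obtain ⟨t, A, ht, hA, hA0, htA⟩ := F.exists_time_scale hW hc
  obtain ⟨E, hE, huE⟩ := F.frame x₀ hx₀
  -- Solutions with X = 0 and ξ = c⁻¹ g E_i at x₀: the model is the Cartesian coordinates vanishing
  -- at the base point. Since A x₀ = c, the factor c⁻¹ makes their differentials orthonormal for
  -- h/A² at x₀.
  choose s hs0 hsm hsd using fun i : Fin 3 =>
    hs (Sum.elim (fun a => c⁻¹ * (G x₀ * E) a i) fun _ => 0)
  set ξ : R4 → Matrix (Fin 4) (Fin 3) ℝ := fun y => Matrix.of fun a i => s i y (Sum.inl a) with hξ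
  set X : R4 → Matrix Unit (Fin 3) ℝ := fun y => Matrix.of fun _ i => s i y (Sum.inr ()) with hX
  have sξ : MSmoothOn (Metric.ball x₀ r) ξ := fun a i => hsm i (Sum.inl a)
  have sX : MSmoothOn (Metric.ball x₀ r) X := fun a i => hsm i (Sum.inr ())
  set hcol : Fin 4 → R4 → Matrix (Fin 4) Unit ℝ := fun a y =>
    Matrix.of fun i _ => spaceMetric G u y i a with hhcol
  set prow : Fin 4 → R4 → Matrix Unit (Fin 4) ℝ := fun a y =>
    Matrix.of fun _ j => spaceProj G u y j a with hprow
  have dξ : ∀ x ∈ Metric.ball x₀ r, ∀ a, mpd a ξ x = (prodConn G u H a x)ᵀ * ξ x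
      - spaceCurv ρ₁ ρ₂ H x • (hcol a x * X x) := by
    intro x hx a
    ext b i
    have : mpd a ξ x b i = pd a (fun y => s i y (Sum.inl b)) x := rfl
    rw [this, hsd i x hx]
    simp only [Fintype.sum_sum_type, flatSystem, Matrix.fromBlocks_apply₁₁,
      Matrix.fromBlocks_apply₁₂, Matrix.of_apply, Matrix.sub_apply, Matrix.mul_apply,
      Matrix.smul_apply, smul_eq_mul, Finset.univ_unique, Finset.sum_singleton, hξ, hX, hhcol]
    change _ + -(_) * s i x (Sum.inr ()) = _ - _ * (_ * s i x (Sum.inr ()))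
    ring
  have dX : ∀ x ∈ Metric.ball x₀ r, ∀ a, mpd a X x = prow a x * ξ x := by
    intro x hx a
    ext b i
    have : mpd a X x b i = pd a (fun y => s i y (Sum.inr ())) x := rfl
    rw [this, hsd i x hx]
    simp only [Fintype.sum_sum_type, flatSystem, Matrix.fromBlocks_apply₂₁,
      Matrix.fromBlocks_apply₂₂, Matrix.of_apply, Matrix.mul_apply, Finset.univ_unique,
      Finset.sum_singleton, hξ, hprow, Matrix.zero_apply, zero_mul, add_zero]
  have hinvT : ∀ x ∈ W, (spaceInv G u x)ᵀ = spaceInv G u x := by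
    intro x hx
    rw [spaceInv, Matrix.transpose_add, F.metric.inv_symm hx, Matrix.transpose_mul,
      Matrix.transpose_transpose]
  have hcolinv : ∀ x ∈ W, ∀ a, (hcol a x)ᵀ * spaceInv G u x = prow a x := by
    intro x hx a
    ext i j
    have := congrFun (congrFun (F.space_inv hx) a) j
    rw [Matrix.mul_apply] at this
    simp only [Matrix.mul_apply, Matrix.transpose_apply, hhcol, hprow, Matrix.of_apply] at this ⊢
    rw [← this]
    exact Finset.sum_congr rfl fun e _ => by rw [F.space_symm hx a e]
  have invhcol : ∀ x ∈ W, ∀ a, spaceInv G u x * hcol a x = (prow a x)ᵀ := by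
    intro x hx a
    rw [← hcolinv x hx, Matrix.transpose_mul, Matrix.transpose_transpose, hinvT x hx]
  have qhcol : ∀ x ∈ W, ∀ a, (dualV G u x)ᵀ * hcol a x = 0 := by
    intro x hx a
    ext i j
    have := congrFun (congrFun (F.space_dual hx) a) ()
    simp only [Matrix.mul_apply, Matrix.transpose_apply, hhcol, Matrix.of_apply,
      Matrix.zero_apply] at this ⊢
    rw [← this]
    exact Finset.sum_congr rfl fun e _ => by rw [F.space_symm hx a e]; exact mul_comm _ _
  have sq : MSmoothOn (Metric.ball x₀ r) (dualV G u) := F.smooth_dualV.mono hW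
  -- The pairing of ξ with the dual vector has zero derivative, as that vector is parallel and h
  -- kills it. Hence the projection in ∂X = Pξ can be dropped and dX = ξ.
  have qξ : ∀ x ∈ Metric.ball x₀ r, (dualV G u x)ᵀ * ξ x = 0 := by
    have h0 : (dualV G u x₀)ᵀ * ξ x₀ = 0 := by
      have h1 : ξ x₀ = c⁻¹ • (G x₀ * E) := by
        ext a i
        simp [hξ, hs0]
      rw [h1, Matrix.mul_smul, ← Matrix.mul_assoc, ← F.metric.symm x₀ hx₀, ← Matrix.transpose_mul,
        F.metric_dual hx₀, huE, smul_zero]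
    intro x hx
    ext i j
    have hsm : MSmoothOn (Metric.ball x₀ r) fun y => (dualV G u y)ᵀ * ξ y := sq.transpose.mul sξ
    rw [← h0]
    refine eq_of_pd_eq_zero (hsm i j) (fun y hy a => ?_) hx
    have : mpd a (fun y => (dualV G u y)ᵀ * ξ y) y = 0 := by
      rw [mpd_mul a sq.transpose sξ hy, mpd_transpose, F.mpd_dual (hW hy), dξ y hy]
      simp only [Matrix.mul_sub, Matrix.mul_smul, ← Matrix.mul_assoc, qhcol y (hW hy)]
      simp [Matrix.transpose_mul]
    exact congrFun (congrFun this i) j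
  have dX' : ∀ x ∈ Metric.ball x₀ r, ∀ a i, pd a (fun y => s i y (Sum.inr ())) x = ξ x a i := by
    intro x hx a i
    have h1 : pd a (fun y => s i y (Sum.inr ())) x = (prow a x * ξ x) () i :=
      congrFun (congrFun (dX x hx a) ()) i
    have h2 := congrFun (congrFun (qξ x hx) ()) i
    rw [h1]
    rw [Matrix.mul_apply] at h2 ⊢
    simp only [hprow, Matrix.of_apply, spaceProj, Matrix.add_apply,
      unit_mul_apply, Matrix.transpose_apply, Matrix.zero_apply] at h2 ⊢
    have h3 : ∀ e, ((1 : Matrix (Fin 4) (Fin 4) ℝ) e a + dualV G u x e () * u x a ()) * ξ x e i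
        = (1 : Matrix (Fin 4) (Fin 4) ℝ) e a * ξ x e i
          + u x a () * (dualV G u x e () * ξ x e i) := fun e => by ring
    simp only [h3, Finset.sum_add_distrib, ← Finset.mul_sum, h2]
    simp only [Matrix.one_apply, ite_mul, one_mul, zero_mul, mul_zero, add_zero, Finset.sum_ite_eq', Finset.mem_univ, if_true]
  -- A first integral. A²h⁻¹ is parallel for the product connection, and the terms from −KhX cancel
  -- the derivative of k XᵀX because A²K = k.
  have Q : ∀ x ∈ Metric.ball x₀ r, A x ^ 2 • ((ξ x)ᵀ * (spaceInv G u x * ξ x))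
      + k • ((X x)ᵀ * X x) = 1 := by
    have h0 : A x₀ ^ 2 • ((ξ x₀)ᵀ * (spaceInv G u x₀ * ξ x₀)) + k • ((X x₀)ᵀ * X x₀) = 1 := by
      have h1 : ξ x₀ = c⁻¹ • (G x₀ * E) := by
        ext a i
        simp [hξ, hs0]
      have h2 : X x₀ = 0 := by
        ext a i
        simp [hX, hs0]
      have h3 : spaceInv G u x₀ * (G x₀ * E) = E := by
        rw [F.spaceInv_eq hx₀, Matrix.mul_assoc, ← Matrix.mul_assoc (G x₀)⁻¹,
          Matrix.nonsing_inv_mul _ (F.metric.det x₀ hx₀), Matrix.one_mul, spaceProj, Matrix.add_mul,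
          Matrix.mul_assoc, huE]
        simp
      rw [h1, h2, hA0, Matrix.mul_smul, h3, Matrix.transpose_smul, Matrix.smul_mul, Matrix.mul_smul,
        Matrix.transpose_mul, F.metric.symm x₀ hx₀, hE, smul_smul, smul_smul]
      have : c ^ 2 * c⁻¹ * c⁻¹ = 1 := by field_simp
      rw [this]
      simp
    intro x hx
    have sZ : MSmoothOn (Metric.ball x₀ r) fun y => (ξ y)ᵀ * (spaceInv G u y * ξ y) :=
      sξ.transpose.mul ((F.smooth_spaceInv.mono hW).mul sξ)
    have sXX : MSmoothOn (Metric.ball x₀ r) fun y => (X y)ᵀ * X y := sX.transpose.mul sX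
    have s1 : MSmoothOn (Metric.ball x₀ r) fun y => A y ^ 2 • ((ξ y)ᵀ * (spaceInv G u y * ξ y)) :=
      MSmoothOn.smul (hA.pow 2) sZ
    have s2 : MSmoothOn (Metric.ball x₀ r) fun y => k • ((X y)ᵀ * X y) :=
      MSmoothOn.smul (SmoothOn.const k) sXX
    ext i j
    rw [← h0]
    refine eq_of_pd_eq_zero ((s1.add s2) i j) (fun y hy a => ?_) hx
    have hA2 : pd a (fun z => A z ^ 2) y = - (2 * H y * u y a ()) * A y ^ 2 := by
      have : (fun z => A z ^ 2) = fun z => A z * A z := by funext z; ring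
      rw [this, pd_mul a (hA.differentiableAt hy) (hA.differentiableAt hy),
        ((htA y hy).2.2 a).2]
      ring
    have : mpd a (fun y => A y ^ 2 • ((ξ y)ᵀ * (spaceInv G u y * ξ y)) + k • ((X y)ᵀ * X y)) y
        = 0 := by
      have hk' : A y ^ 2 * spaceCurv ρ₁ ρ₂ H y = k := by rw [(htA y hy).2.1, hk]
      rw [mpd_add a s1 s2 hy, mpd_smul a (hA.pow 2) sZ hy, hA2, mpd_smul a (SmoothOn.const k) sXX hy,
        pd_const, mpd_mul a sξ.transpose ((F.smooth_spaceInv.mono hW).mul sξ) hy,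
        mpd_mul a (F.smooth_spaceInv.mono hW) sξ hy, mpd_mul a sX.transpose sX hy, mpd_transpose,
        mpd_transpose, F.mpd_spaceInv (hW hy), dξ y hy, dX y hy]
      have e1 : (hcol a y)ᵀ * (spaceInv G u y * ξ y) = prow a y * ξ y := by
        rw [← Matrix.mul_assoc, hcolinv y (hW hy)]
      have e2 : spaceInv G u y * (hcol a y * X y) = (prow a y)ᵀ * X y := by
        rw [← Matrix.mul_assoc, invhcol y (hW hy)]
      simp only [Matrix.transpose_sub, Matrix.transpose_mul, Matrix.transpose_transpose,
        Matrix.transpose_smul, Matrix.sub_mul, Matrix.add_mul, Matrix.mul_sub, Matrix.mul_add,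
        Matrix.mul_smul, Matrix.smul_mul, Matrix.mul_assoc, e1, e2, Matrix.neg_mul, Matrix.mul_neg,
        ← hk']
      module
    exact congrFun (congrFun this i) j
  refine ⟨r, hr, hW, t, A, fun i y => s i y (Sum.inr ()), ht, hA, fun i => hsm i _, fun i => by
    simp [hs0], fun x hx => ⟨(htA x hx).1, (htA x hx).2.2, fun i => ?_, fun i j => ?_⟩⟩
  · have h2 := congrFun (congrFun (qξ x hx) ()) i
    rw [Matrix.mul_apply] at h2
    simp only [dX' x hx]
    exact h2
  · have h1 := congrFun (congrFun (Q x hx) i) j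
    simp only [dX' x hx]
    rw [← h1]
    simp only [Matrix.add_apply, Matrix.smul_apply, smul_eq_mul, unit_mul_apply,
      Matrix.transpose_apply, Matrix.mul_apply, Finset.mul_sum]
    simp only [hX, Matrix.of_apply, mul_assoc, Finset.sum_const, Finset.card_univ,
      Fintype.card_unit, one_smul, add_sub_cancel_right]

end RWFrame

end Coord

/-! ### Stereographic projection to isotropic coordinates. -/

namespace Coord

open Filter Topology Matrix

/-- The conformal factor of the stereographic projection: if `w² = 1 - k ρ` then rescaling by
`F = (1 + w) / 2` turns the metric of the model space into its isotropic form. -/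
lemma isotropic_algebra {n : Type*} [Fintype n] [DecidableEq n] {Z : Matrix n n ℝ} {k ρ w F : ℝ}
    (hZ : Z * Z = ρ • Z) (hw : 0 < w) (hwk : w ^ 2 = 1 - k * ρ) (hF : F = (1 + w) / 2) :
    (F⁻¹ • (1 : Matrix n n ℝ) + (k / (2 * w * F ^ 2)) • Z) * (1 - k • Z)
      * (F⁻¹ • (1 : Matrix n n ℝ) + (k / (2 * w * F ^ 2)) • Z) = (F ^ 2)⁻¹ • 1 := by
  have hF0 : F ≠ 0 := by rw [hF]; positivity
  have hw0 := hw.ne'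
  -- Z² = ρZ reduces everything to the span of 1 and Z; the chosen coefficients make the Z-term
  -- vanish (`h2`).
  have h1 : ∀ a b : ℝ, (a • (1 : Matrix n n ℝ) + b • Z) * (1 - k • Z) * (a • (1 : Matrix n n ℝ) + b • Z)
      = (a ^ 2) • 1 + (2 * a * b + b ^ 2 * ρ - k * (a ^ 2 + 2 * a * b * ρ + b ^ 2 * ρ ^ 2)) • Z := by
    intro a b
    simp only [Matrix.mul_add, Matrix.add_mul, Matrix.mul_sub, Matrix.sub_mul, Matrix.mul_smul,
      Matrix.smul_mul, Matrix.mul_one, Matrix.one_mul, hZ, smul_add, smul_sub, smul_smul]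
    module
  have h2 : 2 * F⁻¹ * (k / (2 * w * F ^ 2)) + (k / (2 * w * F ^ 2)) ^ 2 * ρ
      - k * (F⁻¹ ^ 2 + 2 * F⁻¹ * (k / (2 * w * F ^ 2)) * ρ + (k / (2 * w * F ^ 2)) ^ 2 * ρ ^ 2)
      = 0 := by
    have h3 : 2 * F⁻¹ * (k / (2 * w * F ^ 2)) + (k / (2 * w * F ^ 2)) ^ 2 * ρ
      - k * (F⁻¹ ^ 2 + 2 * F⁻¹ * (k / (2 * w * F ^ 2)) * ρ + (k / (2 * w * F ^ 2)) ^ 2 * ρ ^ 2)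
      = (4 * w * F * (1 - k * ρ) + (k * ρ) * (1 - k * ρ) - 4 * w ^ 2 * F ^ 2)
        * (k / (4 * w ^ 2 * F ^ 4)) := by
      field_simp
      ring
    rw [h3, ← hwk, show k * ρ = 1 - w ^ 2 by linarith, hF]
    ring
  rw [h1, h2, zero_smul, add_zero, inv_pow]

/-- If `J g⁻¹ Jᵀ` is inverse to `D` then `g = Jᵀ D J`. -/
lemma eq_transpose_mul_mul {n : Type*} [Fintype n] [DecidableEq n] {g J D Di : Matrix n n ℝ}
    (hg : IsUnit g.det) (hD : Di * D = 1) (h : J * g⁻¹ * Jᵀ = Di) :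
    IsUnit J.det ∧ g = Jᵀ * D * J := by
  have h1 : J * (g⁻¹ * Jᵀ * D) = 1 := by
    rw [← Matrix.mul_assoc, ← Matrix.mul_assoc, h, hD]
  have h2 : g⁻¹ * Jᵀ * D * J = 1 := mul_eq_one_comm.1 h1
  refine ⟨(Matrix.isUnit_iff_isUnit_det _).1 (IsUnit.of_mul_eq_one _ h1), ?_⟩
  have h3 : g * (g⁻¹ * Jᵀ * D * J) = g := by rw [h2, Matrix.mul_one]
  rw [← h3]
  simp only [← Matrix.mul_assoc]
  rw [Matrix.mul_nonsing_inv _ hg, Matrix.one_mul]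

namespace RWFrame

variable {W : Set R4} {G : R4 → Matrix (Fin 4) (Fin 4) ℝ} {u : R4 → Matrix (Fin 4) Unit ℝ}
  {ρ₁ ρ₂ H : R4 → ℝ} {x : R4}

/-- Functions bringing the metric to its Robertson–Walker form. -/
lemma exists_isotropic (F : RWFrame W G u ρ₁ ρ₂ H) {x₀ : R4} (hx₀ : x₀ ∈ W) {c k : ℝ} (hc : 0 < c)
    (hk : c ^ 2 * spaceCurv ρ₁ ρ₂ H x₀ = k) :
    ∃ V ⊆ W, x₀ ∈ V ∧ ∃ (Ψ : R4 → R4) (A : R4 → ℝ), IsCoordChange V Set.univ Ψ ∧ SmoothOn V A ∧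
      ∀ x ∈ V, 0 < A x ∧ (∃ l, ∀ a, pd a A x = l * pd a (fun y => Ψ y 0) x) ∧
        0 < 1 + k / 4 * (Ψ x 1 ^ 2 + Ψ x 2 ^ 2 + Ψ x 3 ^ 2) ∧
        G x = (jac Ψ x)ᵀ * (let s : ℝ := A x ^ 2 / (1 + k / 4 * (Ψ x 1 ^ 2 + Ψ x 2 ^ 2 + Ψ x 3 ^ 2)) ^ 2
            Matrix.diagonal ![-1, s, s, s]) * jac Ψ x := by
  obtain ⟨r, hr, hW, t, A, X, ht, hA, hX, hX0, hall⟩ := F.exists_adapted hx₀ hc hk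
  -- On the quadric w² + k|X|² = 1 the remaining ambient coordinate is w = √(1 − k|X|²), positive on
  -- V. Stereographic projection is x_i = X_i/f with f = (1 + w)/2, and then 1 + (k/4)|x|² = 1/f.
  set w2 : R4 → ℝ := fun y => 1 - k * (X 0 y * X 0 y + X 1 y * X 1 y + X 2 y * X 2 y) with hw2
  have sw2 : SmoothOn (Metric.ball x₀ r) w2 := (SmoothOn.const 1).sub ((SmoothOn.const k).mul
    ((((hX 0).mul (hX 0)).add ((hX 1).mul (hX 1))).add ((hX 2).mul (hX 2))))
  set V : Set R4 := Metric.ball x₀ r ∩ w2 ⁻¹' Set.Ioi 0 with hV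
  have hVo : IsOpen V := sw2.continuousOn.isOpen_inter_preimage Metric.isOpen_ball isOpen_Ioi
  have hVb : V ⊆ Metric.ball x₀ r := Set.inter_subset_left
  have hVp : ∀ y ∈ V, 0 < w2 y := fun y hy => hy.2
  set w : R4 → ℝ := fun y => Real.sqrt (w2 y) with hw
  have hwp : ∀ y ∈ V, 0 < w y := fun y hy => Real.sqrt_pos.2 (hVp y hy)
  have hww : ∀ y ∈ V, w y * w y = w2 y := fun y hy => Real.mul_self_sqrt (hVp y hy).le
  have sw : SmoothOn V w := (sw2.mono hVb).sqrt fun y hy => (hVp y hy).ne'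
  set f : R4 → ℝ := fun y => (1 + w y) * (1 / 2) with hf
  have sf : SmoothOn V f := ((SmoothOn.const 1).add sw).mul (SmoothOn.const (1 / 2))
  have hfp : ∀ y ∈ V, 0 < f y := fun y hy => by have := hwp y hy; simp only [hf]; positivity
  have sX : ∀ i, SmoothOn V (X i) := fun i => (hX i).mono hVb
  have sx : ∀ i, SmoothOn V fun y => X i y / f y := fun i => (sX i).div sf fun y hy => (hfp y hy).ne'
  set Ψ : R4 → R4 := fun y => WithLp.toLp 2 (Fin.cons (t y) fun i => X i y / f y) with hΨ
  have hΨ0 : ∀ y, Ψ y 0 = t y := fun y => rfl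
  have hΨs : ∀ y (i : Fin 3), Ψ y i.succ = X i y / f y := fun y i => rfl
  have hΨ1 : ∀ y, Ψ y 1 = X 0 y / f y := fun y => rfl
  have hΨ2 : ∀ y, Ψ y 2 = X 1 y / f y := fun y => rfl
  have hΨ3 : ∀ y, Ψ y 3 = X 2 y / f y := fun y => rfl
  have hfac : ∀ y ∈ V, 1 + k / 4 * (Ψ y 1 ^ 2 + Ψ y 2 ^ 2 + Ψ y 3 ^ 2) = (f y)⁻¹ := by
    intro y hy
    have h1 := hww y hy
    have h2 := (hfp y hy).ne'
    have h3 : f y ^ 2 + k / 4 * (X 0 y ^ 2 + X 1 y ^ 2 + X 2 y ^ 2) = f y := by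
      simp only [hf]
      simp only [hw2] at h1
      linear_combination h1 / 4
    rw [hΨ1, hΨ2, hΨ3]
    field_simp
    linear_combination 4 * h3
  -- The inverse metric is what inner products of differentials give directly; the form of g and
  -- invertibility of the Jacobian follow from it by `eq_transpose_mul_mul`.
  have key : ∀ x ∈ V, jac Ψ x * (G x)⁻¹ * (jac Ψ x)ᵀ = Matrix.diagonal
      ![-1, (A x ^ 2 * f x ^ 2)⁻¹, (A x ^ 2 * f x ^ 2)⁻¹, (A x ^ 2 * f x ^ 2)⁻¹] := by
    intro x hx
    obtain ⟨hAp, htA, hqX, hQ⟩ := hall x (hVb hx)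
    have hxW := hW (hVb hx)
    have hdw : ∀ a, pd a w x = - (k / w x) * ∑ j, X j x * pd a (X j) x := by
      intro a
      have h1 : pd a (fun y => w y * w y) x = pd a w2 x := pd_congr_on hVo hww hx a
      have d := fun i => (sX i).differentiableAt hx
      have s2 := fun i => (sX i).mul (sX i)
      have s3 := (s2 0).add (s2 1)
      have s4 := s3.add (s2 2)
      rw [pd_mul a (sw.differentiableAt hx) (sw.differentiableAt hx), hw2,
        pd_sub a (differentiableAt_const _)
          (((SmoothOn.const k).mul s4).differentiableAt hx), pd_const,
        pd_mul a (differentiableAt_const _) (s4.differentiableAt hx), pd_const,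
        pd_add a (s3.differentiableAt hx) ((s2 2).differentiableAt hx),
        pd_add a ((s2 0).differentiableAt hx) ((s2 1).differentiableAt hx), pd_mul a (d 0) (d 0),
        pd_mul a (d 1) (d 1), pd_mul a (d 2) (d 2)] at h1
      have h2 := (hwp x hx).ne'
      rw [Fin.sum_univ_three]
      field_simp
      linear_combination h1 / 2
    set Y : Matrix (Fin 3) (Fin 4) ℝ := Matrix.of fun i a => pd a (X i) x with hY
    -- The matrix ∂x_i/∂X_j, computed from dw = −(k/w) Σ X_j dX_j.
    set N : Matrix (Fin 3) (Fin 3) ℝ := (f x)⁻¹ • 1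
      + (k / (2 * w x * f x ^ 2)) • (Matrix.of fun i j => X i x * X j x) with hN
    have hJs : ∀ (i : Fin 3) a, jac Ψ x i.succ a = (N * Y) i a := by
      intro i a
      have h0 : jac Ψ x i.succ a = pd a (fun y => X i y / f y) x := rfl
      have h1 : pd a f x = 1 / 2 * pd a w x := by
        rw [hf, pd_mul a ((sw.differentiableAt hx).const_add 1) (differentiableAt_const _),
          pd_add a (differentiableAt_const _) (sw.differentiableAt hx), pd_const, pd_const]
        ring
      have h2 : (N * Y) i a = (f x)⁻¹ * pd a (X i) x
          + k / (2 * w x * f x ^ 2) * X i x * ∑ j, X j x * pd a (X j) x := by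
        rw [hN, Matrix.add_mul, Matrix.smul_mul, Matrix.one_mul, Matrix.smul_mul]
        simp only [Matrix.add_apply, Matrix.smul_apply, smul_eq_mul, Matrix.mul_apply, Matrix.of_apply, hY, Finset.mul_sum]
        congr 1
        exact Finset.sum_congr rfl fun j _ => by ring
      rw [h0, pd_div a ((sX i).differentiableAt hx) (sf.differentiableAt hx) (hfp x hx).ne', h1,
        hdw, h2]
      have h3 := (hwp x hx).ne'
      have h4 := (hfp x hx).ne'
      field_simp
      ring
    have hYq : Y * dualV G u x = 0 := by
      ext i j
      rw [Matrix.mul_apply, Matrix.zero_apply, ← hqX i]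
      exact Finset.sum_congr rfl fun a _ => mul_comm _ _
    have hYY : A x ^ 2 • (Y * spaceInv G u x * Yᵀ)
        = 1 - k • (Matrix.of fun i j => X i x * X j x) := by
      ext i j
      have := hQ i j
      rw [Finset.sum_comm] at this
      simpa only [Matrix.smul_apply, smul_eq_mul, Matrix.sub_apply, Matrix.of_apply,
        Matrix.mul_apply, Finset.sum_mul, Matrix.transpose_apply, hY] using this
    have hNT : Nᵀ = N := by
      ext i j
      simp only [hN, Matrix.transpose_apply, Matrix.add_apply, Matrix.smul_apply, Matrix.of_apply,
        smul_eq_mul, Matrix.one_apply, eq_comm (a := i)]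
      ring
    have hNN : A x ^ 2 • (N * Y * spaceInv G u x * (N * Y)ᵀ) = (f x ^ 2)⁻¹ • 1 := by
      have h1 : A x ^ 2 • (N * Y * spaceInv G u x * (N * Y)ᵀ)
          = N * (A x ^ 2 • (Y * spaceInv G u x * Yᵀ)) * N := by
        rw [Matrix.transpose_mul, hNT]
        simp only [Matrix.mul_smul, Matrix.smul_mul, Matrix.mul_assoc]
      rw [h1, hYY]
      refine isotropic_algebra (ρ := X 0 x * X 0 x + X 1 x * X 1 x + X 2 x * X 2 x) ?_ (hwp x hx)
        ?_ ?_
      · ext i j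
        simp only [Matrix.mul_apply, Matrix.of_apply, Fin.sum_univ_three, Matrix.smul_apply,
          smul_eq_mul]
        ring
      · rw [sq, hww x hx]
      · simp only [hf]; ring
    have hG : (G x)⁻¹ = spaceInv G u x - dualV G u x * (dualV G u x)ᵀ := by rw [spaceInv]; abel
    have hNG : N * Y * (G x)⁻¹ * (N * Y)ᵀ = (A x ^ 2 * f x ^ 2)⁻¹ • 1 := by
      have : N * Y * dualV G u x = 0 := by rw [Matrix.mul_assoc, hYq, Matrix.mul_zero]
      rw [hG, Matrix.mul_sub, Matrix.sub_mul, ← Matrix.mul_assoc (N * Y), this, Matrix.zero_mul,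
        Matrix.zero_mul, sub_zero, mul_inv, mul_smul, ← hNN, smul_smul, inv_mul_cancel₀, one_smul]
      positivity
    have hJ0 : ∀ a, jac Ψ x 0 a = - u x a () := fun a => (htA a).1
    have hJG0 : ∀ b, (jac Ψ x * (G x)⁻¹) 0 b = - dualV G u x b () := by
      intro b
      rw [Matrix.mul_apply, dualV, Matrix.mul_apply, ← Finset.sum_neg_distrib]
      refine Finset.sum_congr rfl fun a _ => ?_
      rw [hJ0, (congrFun (congrFun (F.metric.inv_symm hxW) b) a).symm, Matrix.transpose_apply]
      ring
    have h00 : ∀ i : Fin 3, ∑ a, dualV G u x a () * jac Ψ x i.succ a = 0 := by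
      intro i
      have h1 : N * Y * dualV G u x = 0 := by rw [Matrix.mul_assoc, hYq, Matrix.mul_zero]
      have := congrFun (congrFun h1 i) ()
      rw [Matrix.mul_apply] at this
      rw [Matrix.zero_apply] at this
      rw [← this]
      exact Finset.sum_congr rfl fun a _ => by rw [hJs, mul_comm]
    have hsymm : (jac Ψ x * (G x)⁻¹ * (jac Ψ x)ᵀ)ᵀ = jac Ψ x * (G x)⁻¹ * (jac Ψ x)ᵀ := by
      simp only [Matrix.transpose_mul, Matrix.transpose_transpose, F.metric.inv_symm hxW,
        Matrix.mul_assoc]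
    have h0 : ∀ i : Fin 3, (jac Ψ x * (G x)⁻¹ * (jac Ψ x)ᵀ) 0 i.succ = 0 := by
      intro i
      rw [Matrix.mul_apply]
      simp only [hJG0, Matrix.transpose_apply, neg_mul, Finset.sum_neg_distrib, h00, neg_zero]
    have hss : ∀ i j : Fin 3, (jac Ψ x * (G x)⁻¹ * (jac Ψ x)ᵀ) i.succ j.succ
        = (A x ^ 2 * f x ^ 2)⁻¹ * (1 : Matrix (Fin 3) (Fin 3) ℝ) i j := by
      intro i j
      have := congrFun (congrFun hNG i) j
      rw [Matrix.smul_apply, smul_eq_mul] at this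
      rw [← this]
      simp only [Matrix.mul_apply, Matrix.transpose_apply, hJs]
    ext i j
    refine Fin.cases ?_ (fun i => ?_) i <;> refine Fin.cases ?_ (fun j => ?_) j
    · rw [Matrix.mul_apply]
      have h1 := congrFun (congrFun (F.dual_u hxW) ()) ()
      rw [Matrix.mul_apply] at h1
      simp only [hJG0, Matrix.transpose_apply, hJ0, neg_mul_neg]
      simpa using h1
    · rw [h0, Matrix.diagonal_apply_ne _ (Fin.succ_ne_zero j).symm]
    · have := congrFun (congrFun hsymm i.succ) 0
      rw [← this, Matrix.transpose_apply, h0,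
        Matrix.diagonal_apply_ne _ (Fin.succ_ne_zero i)]
    · rw [hss]
      fin_cases i <;> fin_cases j <;> simp
  have hD : ∀ x ∈ V, IsUnit (jac Ψ x).det ∧ G x = (jac Ψ x)ᵀ * (let s : ℝ := A x ^ 2
      / (1 + k / 4 * (Ψ x 1 ^ 2 + Ψ x 2 ^ 2 + Ψ x 3 ^ 2)) ^ 2
            Matrix.diagonal ![-1, s, s, s]) * jac Ψ x := by
    intro x hx
    have hAp := (hall x (hVb hx)).1
    have hfx := hfp x hx
    refine eq_transpose_mul_mul (F.metric.det x (hW (hVb hx))) ?_ (key x hx)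
    simp only [hfac x hx]
    rw [Matrix.diagonal_mul_diagonal, ← Matrix.diagonal_one]
    congr 1
    funext i
    have : (A x ^ 2 * f x ^ 2)⁻¹ * (A x ^ 2 / (f x)⁻¹ ^ 2) = 1 := by field_simp
    fin_cases i
    · simp
    all_goals exact this
  refine ⟨V, hVb.trans hW, ⟨Metric.mem_ball_self hr, ?_⟩, Ψ, A, ⟨hVo, fun _ _ => Set.mem_univ _,
    ?_, fun x hx => (hD x hx).1⟩, hA.mono hVb, fun x hx => ⟨(hall x (hVb hx)).1, ⟨H x * A x,
    fun a => ?_⟩, ?_, (hD x hx).2⟩⟩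
  · simp [hw2, hX0]
  · intro i
    refine Fin.cases (ht.mono hVb) (fun i => sx i) i
  · have := (hall x (hVb hx)).2.1 a
    rw [this.2]
    simp only [hΨ0]
    have h2 := this.1
    rw [show (fun y => t y) = t from rfl, h2]
    ring
  · rw [hfac x hx]
    exact inv_pos.2 (hfp x hx)

end RWFrame

end Coord

/-! ### Robertson–Walker charts from the inverse function theorem. -/

namespace Coord

open Filter Topology Matrix

/-- The Robertson–Walker metric of curvature index `k` and scale factor `A`. -/
noncomputable def rwMetric (k : ℝ) (A : ℝ → ℝ) (x : R4) : Matrix (Fin 4) (Fin 4) ℝ :=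
  let s : ℝ := A (x 0) ^ 2 / (1 + k / 4 * (x 1 ^ 2 + x 2 ^ 2 + x 3 ^ 2)) ^ 2
  Matrix.diagonal ![-1, s, s, s]

lemma jac_apply {τ : R4 → R4} {x : R4} (h : DifferentiableAt ℝ τ x) (a b : Fin 4) :
    jac τ x a b = fderiv ℝ τ x (EuclideanSpace.single b 1) a := by
  have h2 : HasFDerivAt (fun y => τ y a) ((EuclideanSpace.proj a : R4 →L[ℝ] ℝ).comp
      (fderiv ℝ τ x)) x := (EuclideanSpace.proj a : R4 →L[ℝ] ℝ).hasFDerivAt.comp x h.hasFDerivAt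
  simp only [jac, Matrix.of_apply, pd, h2.fderiv]
  rfl

lemma det_fderiv {τ : R4 → R4} {x : R4} (h : DifferentiableAt ℝ τ x) :
    (fderiv ℝ τ x).det = (jac τ x).det := by
  have h1 : jac τ x = LinearMap.toMatrix (EuclideanSpace.basisFun (Fin 4) ℝ).toBasis
      (EuclideanSpace.basisFun (Fin 4) ℝ).toBasis (fderiv ℝ τ x : R4 →ₗ[ℝ] R4) := by
    ext a b
    rw [jac_apply h, LinearMap.toMatrix_apply]
    simp
  rw [h1, LinearMap.det_toMatrix]

/-- A function on a ball whose differential is proportional to that of the first coordinate depends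
only on the first coordinate. -/
lemma eq_of_fderiv_proportional {y₀ : R4} {r : ℝ} {α : R4 → ℝ}
    (h : ∀ y ∈ Metric.ball y₀ r, ∃ l : ℝ, HasFDerivAt α (l • (EuclideanSpace.proj 0 : R4 →L[ℝ] ℝ)) y)
    {y : R4} (hy : y ∈ Metric.ball y₀ r) :
    y₀ + (y 0 - y₀ 0) • EuclideanSpace.single 0 1 ∈ Metric.ball y₀ r ∧
      α (y₀ + (y 0 - y₀ 0) • EuclideanSpace.single 0 1) = α y := by
  set z : R4 := y₀ + (y 0 - y₀ 0) • EuclideanSpace.single 0 1 with hz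
  have hzb : z ∈ Metric.ball y₀ r := by
    rw [mem_ball_iff_norm] at hy ⊢
    refine lt_of_le_of_lt ?_ hy
    rw [hz, add_sub_cancel_left, norm_smul, PiLp.norm_single, norm_one, mul_one]
    exact PiLp.norm_apply_le (y - y₀) 0
  refine ⟨hzb, ?_⟩
  have hz0 : z 0 = y 0 := by simp [hz]
  have hseg : ∀ s ∈ Set.Icc (0 : ℝ) 1, AffineMap.lineMap y z s ∈ Metric.ball y₀ r := fun s hs =>
    (convex_ball y₀ r).lineMap_mem hy hzb hs
  have hd : ∀ s ∈ Set.Icc (0 : ℝ) 1, HasDerivWithinAt (fun s => α (AffineMap.lineMap y z s)) 0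
      (Set.Icc 0 1) s := by
    intro s hs
    obtain ⟨l, hl⟩ := h _ (hseg s hs)
    have h1 := hl.comp_hasDerivAt s (AffineMap.hasDerivAt_lineMap (a := y) (b := z) (x := s))
    have h2 : (l • (EuclideanSpace.proj 0 : R4 →L[ℝ] ℝ)) (z - y) = 0 := by
      rw [_root_.smul_apply, proj_eucl_apply, PiLp.sub_apply, hz0, sub_self, smul_zero]
    rw [h2] at h1
    exact h1.hasDerivWithinAt
  have := (convex_Icc (0 : ℝ) 1).norm_image_sub_le_of_norm_hasDerivWithin_le (C := 0) hd
    (fun _ _ => by simp) (Set.left_mem_Icc.2 zero_le_one) (Set.right_mem_Icc.2 zero_le_one)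
  rw [zero_mul, norm_le_zero_iff, sub_eq_zero] at this
  simpa using this

/-- Local Robertson–Walker coordinates. -/
theorem RWFrame.exists_chart {W : Set R4} {G : R4 → Matrix (Fin 4) (Fin 4) ℝ}
    {u : R4 → Matrix (Fin 4) Unit ℝ} {ρ₁ ρ₂ H : R4 → ℝ} (F : RWFrame W G u ρ₁ ρ₂ H) {x₀ : R4}
    (hx₀ : x₀ ∈ W) {c k : ℝ} (hc : 0 < c) (hk : c ^ 2 * spaceCurv ρ₁ ρ₂ H x₀ = k) :
    ∃ e : OpenPartialHomeomorph R4 R4, x₀ ∈ e.source ∧ e.source ⊆ W ∧ ContDiffOn ℝ ∞ e e.source ∧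
      ContDiffOn ℝ ∞ e.symm e.target ∧ IsCoordChange e.source Set.univ e ∧ ∃ A : ℝ → ℝ,
      ContDiffOn ℝ ∞ A ((fun x : R4 => x 0) '' e.target) ∧ ∀ x ∈ e.source,
        0 < A (e x 0) ∧ 0 < 1 + k / 4 * (e x 1 ^ 2 + e x 2 ^ 2 + e x 3 ^ 2) ∧
          G x = (jac e x)ᵀ * rwMetric k A (e x) * jac e x := by
  obtain ⟨V, hVW, hxV, Ψ, A, hΨ, hA, hall⟩ := F.exists_isotropic hx₀ hc hk
  have hdΨ : ∀ x ∈ V, DifferentiableAt ℝ Ψ x := fun x hx =>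
    (hΨ.contDiffAt hx).differentiableAt (by simp)
  have hdet : ∀ x ∈ V, (fderiv ℝ Ψ x).det ≠ 0 := fun x hx => by
    rw [det_fderiv (hdΨ x hx)]
    exact (hΨ.det x hx).ne_zero
  have hder : ∀ x (hx : x ∈ V), HasFDerivAt Ψ (((fderiv ℝ Ψ x).toContinuousLinearEquivOfDetNeZero
      (hdet x hx) : R4 ≃L[ℝ] R4) : R4 →L[ℝ] R4) x := fun x hx => by
    rw [ContinuousLinearMap.coe_toContinuousLinearEquivOfDetNeZero]
    exact (hdΨ x hx).hasFDerivAt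
  set e₁ := ((hΨ.contDiffAt hxV).toOpenPartialHomeomorph Ψ (hder x₀ hxV) (by simp)).restrOpen V
    hΨ.isOpen with he₁
  have he₁Ψ : ∀ y, e₁ y = Ψ y := fun y => rfl
  have hx₁ : x₀ ∈ e₁.source :=
    ⟨(hΨ.contDiffAt hxV).mem_toOpenPartialHomeomorph_source (hder x₀ hxV) (by simp), hxV⟩
  have hs₁ : e₁.source ⊆ V := Set.inter_subset_right
  obtain ⟨r, hr, hball⟩ := Metric.isOpen_iff.1 e₁.open_target (Ψ x₀) (e₁.map_source hx₁)
  -- With a ball as target, any point is joined to the time axis through the centre by a segment of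
  -- constant time inside the target, so A depends on time alone.
  set e := (e₁.symm.restrOpen (Metric.ball (Ψ x₀) r) Metric.isOpen_ball).symm with he
  have heΨ : ∀ y, e y = Ψ y := fun y => rfl
  have heΨ' : (e : R4 → R4) = Ψ := rfl
  have hsym : ∀ y, e.symm y = e₁.symm y := fun y => rfl
  have htar : e.target = Metric.ball (Ψ x₀) r := Set.inter_eq_right.2 hball
  have hsrc : e.source ⊆ e₁.source := by
    intro y hy
    have h1 := e.map_source hy
    have h2 : e.symm (e y) = y := e.left_inv hy
    rw [← h2, hsym]
    exact e₁.map_target (hball (htar ▸ h1))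
  have hsV : e.source ⊆ V := hsrc.trans hs₁
  have hx₂ : x₀ ∈ e.source := by
    have h1 : Ψ x₀ ∈ e.target := htar ▸ Metric.mem_ball_self hr
    have h2 := e.map_target h1
    rwa [hsym, ← he₁Ψ, e₁.left_inv hx₁] at h2
  have hinv : ∀ y ∈ e.target, ContDiffAt ℝ ∞ e.symm y := by
    intro y hy
    have h1 := hsV (e.map_target hy)
    exact e.contDiffAt_symm hy (hder _ h1) (hΨ.contDiffAt h1)
  have hpd0 : ∀ y ∈ Metric.ball (Ψ x₀) r, ∃ l : ℝ, HasFDerivAt (fun z => A (e.symm z))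
      (l • (EuclideanSpace.proj 0 : R4 →L[ℝ] ℝ)) y := by
    intro y hy
    have hyt : y ∈ e.target := htar ▸ hy
    have h1 := hsV (e.map_target hyt)
    obtain ⟨l, hl⟩ := (hall _ h1).2.1
    refine ⟨l, ?_⟩
    have hΨ0 : DifferentiableAt ℝ (fun z => Ψ z 0) (e.symm y) := (hΨ.smooth 0).differentiableAt h1
    have h2 : fderiv ℝ A (e.symm y) = l • fderiv ℝ (fun z => Ψ z 0) (e.symm y) := by
      ext v
      rw [_root_.smul_apply, fderiv_eq_sum_pd, fderiv_eq_sum_pd, smul_eq_mul, Finset.mul_sum]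
      exact Finset.sum_congr rfl fun a _ => by rw [hl]; ring
    have hde := ((hinv y hyt).differentiableAt (by simp)).hasFDerivAt
    have h3 := (hA.differentiableAt h1).hasFDerivAt.comp y hde
    have h4 : HasFDerivAt (fun z => Ψ (e.symm z) 0) _ y := hΨ0.hasFDerivAt.comp y hde
    have h5 : HasFDerivAt (fun z => Ψ (e.symm z) 0) (EuclideanSpace.proj 0 : R4 →L[ℝ] ℝ) y := by
      refine (EuclideanSpace.proj 0 : R4 →L[ℝ] ℝ).hasFDerivAt.congr_of_eventuallyEq ?_
      filter_upwards [e.open_target.mem_nhds hyt] with z hz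
      rw [← heΨ, e.right_inv hz]
      rfl
    rw [h2, ContinuousLinearMap.smul_comp, h4.unique h5] at h3
    exact h3
  -- The time axis through the centre of the ball; the scale factor as a function of one variable is
  -- read off along it.
  set σ : ℝ → R4 := fun τ => Ψ x₀ + (τ - Ψ x₀ 0) • EuclideanSpace.single 0 1 with hσ
  have hσs : ContDiff ℝ ∞ σ :=
    contDiff_const.add ((contDiff_id.sub contDiff_const).smul contDiff_const)
  have hAe : ∀ x ∈ e.source, A (e.symm (σ (e x 0))) = A x := by
    intro x hx
    have h1 : e x ∈ Metric.ball (Ψ x₀) r := htar ▸ e.map_source hx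
    have := (eq_of_fderiv_proportional hpd0 h1).2
    rw [e.left_inv hx] at this
    exact this
  refine ⟨e, hx₂, hsV.trans hVW, fun x hx => (hΨ.contDiffAt (hsV hx)).contDiffWithinAt,
    fun y hy => (hinv y hy).contDiffWithinAt, ⟨e.open_source, fun _ _ => Set.mem_univ _,
    fun i x hx => hΨ.smooth i x (hsV hx), fun x hx => hΨ.det x (hsV hx)⟩, fun τ => A (e.symm (σ τ)),
    ?_, fun x hx => ?_⟩
  · rintro _ ⟨y, hy, rfl⟩
    have h1 : σ (y 0) ∈ e.target := by
      rw [htar] at hy ⊢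
      exact (eq_of_fderiv_proportional hpd0 hy).1
    have h2 := (hinv _ h1).comp (y 0) hσs.contDiffAt
    exact ((hA _ (hsV (e.map_target h1))).comp (y 0) h2).contDiffWithinAt
  · obtain ⟨h1, -, h2, h3⟩ := hall x (hsV hx)
    refine ⟨?_, h2, ?_⟩
    · change 0 < A (e.symm (σ (e x 0)))
      rwa [hAe x hx]
    · simp only [rwMetric, hAe x hx]
      exact h3

end Coord

/-! ### Charts of the manifold and components of the metric. -/

namespace Coord

open Filter Topology Matrix

section Manifold

variable {M : Type*} [TopologicalSpace M] [ChartedSpace R4 M] [IsManifold (𝓡 4) ∞ M]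
  {φ ψ : OpenPartialHomeomorph M R4} {x : R4}

lemma contDiffAt_transition (hφ : φ ∈ IsManifold.maximalAtlas (𝓡 4) ∞ M)
    (hψ : ψ ∈ IsManifold.maximalAtlas (𝓡 4) ∞ M) (hx : x ∈ (φ.symm.trans ψ).source) :
    ContDiffAt ℝ ∞ (φ.symm.trans ψ) x := by
  have h : ContMDiffAt (𝓡 4) (𝓡 4) ∞ (ψ ∘ φ.symm) x :=
    (contMDiffAt_of_mem_maximalAtlas hψ hx.2).comp x (contMDiffAt_symm_of_mem_maximalAtlas hφ hx.1)
  exact contMDiffAt_iff_contDiffAt.1 h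

/-- The transition map between two charts. -/
lemma isCoordChange_transition (hφ : φ ∈ IsManifold.maximalAtlas (𝓡 4) ∞ M)
    (hψ : ψ ∈ IsManifold.maximalAtlas (𝓡 4) ∞ M) :
    IsCoordChange (φ.symm.trans ψ).source ψ.target (φ.symm.trans ψ) where
  isOpen := (φ.symm.trans ψ).open_source
  mapsTo y hy := ψ.map_source hy.2
  smooth i y hy := (contDiffAt_piLp 2).1 (contDiffAt_transition hφ hψ hy) i
  det y hy := by
    have h1 := (contDiffAt_transition hφ hψ hy).differentiableAt (by simp)
    -- The opposite transition map is a local inverse, so the Jacobian is invertible.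
    have hy2 : (φ.symm.trans ψ) y ∈ (ψ.symm.trans φ).source :=
      ⟨ψ.map_source hy.2, by
        change ψ.symm (ψ (φ.symm y)) ∈ φ.source
        have hyψ : φ.symm y ∈ ψ.source := hy.2
        rw [ψ.left_inv hyψ]
        exact φ.map_target hy.1⟩
    have h2 := (contDiffAt_transition hψ hφ hy2).differentiableAt (by simp)
    have h3 := h2.hasFDerivAt.comp y h1.hasFDerivAt
    have h4 : HasFDerivAt ((ψ.symm.trans φ) ∘ (φ.symm.trans ψ)) (ContinuousLinearMap.id ℝ R4) y := by
      refine (hasFDerivAt_id y).congr_of_eventuallyEq ?_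
      filter_upwards [(φ.symm.trans ψ).open_source.mem_nhds hy] with z hz
      change φ (ψ.symm (ψ (φ.symm z))) = z
      have hzψ : φ.symm z ∈ ψ.source := hz.2
      rw [ψ.left_inv hzψ, φ.right_inv hz.1]
    have h5 := congrArg ContinuousLinearMap.det (h3.unique h4)
    rw [← det_fderiv h1]
    refine isUnit_iff_ne_zero.2 fun h0 => ?_
    have h6 : (ContinuousLinearMap.comp (fderiv ℝ (ψ.symm.trans φ) ((φ.symm.trans ψ) y))
        (fderiv ℝ (φ.symm.trans ψ) y)).det = 0 := by
      refine (LinearMap.det_comp (fderiv ℝ (ψ.symm.trans φ) ((φ.symm.trans ψ) y) : R4 →ₗ[ℝ] R4)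
        (fderiv ℝ (φ.symm.trans ψ) y : R4 →ₗ[ℝ] R4)).trans ?_
      exact mul_eq_zero_of_right _ h0
    rw [h6] at h5
    simp [ContinuousLinearMap.det] at h5

/-- The chain rule for φ⁻¹ = ψ⁻¹ ∘ (ψ ∘ φ⁻¹) near x. -/
lemma coordVector_eq (hφ : φ ∈ IsManifold.maximalAtlas (𝓡 4) ∞ M)
    (hψ : ψ ∈ IsManifold.maximalAtlas (𝓡 4) ∞ M) (hx : x ∈ (φ.symm.trans ψ).source) (i : Fin 4) :
    (coordVector φ x i : R4) = ∑ a, jac (φ.symm.trans ψ) x a i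
      • (coordVector ψ ((φ.symm.trans ψ) x) a : R4) := by
  have hτ := (contDiffAt_transition hφ hψ hx).differentiableAt (by simp)
  have h1 : MDifferentiableAt (𝓡 4) (𝓡 4) (φ.symm.trans ψ) x :=
    mdifferentiableAt_iff_differentiableAt.2 hτ
  have h2 : MDifferentiableAt (𝓡 4) (𝓡 4) ψ.symm ((φ.symm.trans ψ) x) :=
    (contMDiffAt_symm_of_mem_maximalAtlas hψ (ψ.map_source hx.2)).mdifferentiableAt (by simp)
  have h3 := h2.hasMFDerivAt.comp x h1.hasMFDerivAt
  have h4 : φ.symm =ᶠ[𝓝 x] ψ.symm ∘ (φ.symm.trans ψ) := by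
    filter_upwards [(φ.symm.trans ψ).open_source.mem_nhds hx] with z hz
    exact (ψ.left_inv hz.2).symm
  have h5 := (h3.congr_of_eventuallyEq h4).mfderiv
  have h7 : (fderiv ℝ (φ.symm.trans ψ) x (EuclideanSpace.single i 1) : R4)
      = ∑ a, jac (φ.symm.trans ψ) x a i • (EuclideanSpace.single a (1 : ℝ) : R4) := by
    ext b
    rw [← jac_apply hτ]
    simp [Pi.single_apply]
  have h8 : (coordVector φ x i : R4) = mfderiv (𝓡 4) (𝓡 4) ψ.symm ((φ.symm.trans ψ) x)
      (fderiv ℝ (φ.symm.trans ψ) x (EuclideanSpace.single i 1) : R4) := by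
    rw [coordVector]
    rw [h5, mfderiv_eq_fderiv]
    rfl
  rw [h8, h7]
  exact (map_sum (mfderiv (𝓡 4) (𝓡 4) ψ.symm ((φ.symm.trans ψ) x)) _ _).trans
    (Finset.sum_congr rfl fun a _ => map_smul _ _ _)

/-- Every tangent space unfolds to ℝ⁴, so equal base points can be exchanged without transporting
vectors. -/
lemma inner_congr (g : LorentzMetric M) {p q : M} (h : p = q) (v w : R4) :
    g.inner p v w = g.inner q v w := by
  subst h; rfl

/-- The transformation law of the components of the metric. -/
lemma components_eq (g : LorentzMetric M) (hφ : φ ∈ IsManifold.maximalAtlas (𝓡 4) ∞ M)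
    (hψ : ψ ∈ IsManifold.maximalAtlas (𝓡 4) ∞ M) (hx : x ∈ (φ.symm.trans ψ).source) :
    g.components φ x = (jac (φ.symm.trans ψ) x)ᵀ * g.components ψ ((φ.symm.trans ψ) x)
      * jac (φ.symm.trans ψ) x := by
  have hp : φ.symm x = ψ.symm ((φ.symm.trans ψ) x) := (ψ.left_inv hx.2).symm
  ext i j
  have h1 : g.components φ x i j = g.inner (ψ.symm ((φ.symm.trans ψ) x))
      (∑ a, jac (φ.symm.trans ψ) x a i • (coordVector ψ ((φ.symm.trans ψ) x) a : R4) : R4)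
      (∑ a, jac (φ.symm.trans ψ) x a j • (coordVector ψ ((φ.symm.trans ψ) x) a : R4) : R4) := by
    refine (inner_congr g hp _ _).trans ?_
    exact congrArg₂ (fun v w : R4 => g.inner (ψ.symm ((φ.symm.trans ψ) x)) v w)
      (coordVector_eq hφ hψ hx i) (coordVector_eq hφ hψ hx j)
  have h2 : ∀ (p : M) (c d : Fin 4 → ℝ) (v : Fin 4 → TangentSpace (𝓡 4) p),
      g.inner p (∑ a, c a • v a) (∑ b, d b • v b) = ∑ b, (∑ a, c a * g.inner p (v a) (v b)) * d b := by
    intro p c d v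
    simp only [map_sum, map_smul, LinearMap.sum_apply, LinearMap.smul_apply, smul_eq_mul,
      Finset.sum_mul, Finset.mul_sum]
    exact Finset.sum_congr rfl fun b _ => Finset.sum_congr rfl fun a _ => by ring
  rw [h1]
  refine (h2 _ _ _ _).trans ?_
  simp only [Matrix.mul_apply, Matrix.transpose_apply]
  rfl

/-- The components of a Lorentz metric in a chart form a metric on the target. -/
lemma isMetricOn_components (g : LorentzMetric M) (hφ : φ ∈ IsManifold.maximalAtlas (𝓡 4) ∞ M)
    (hS : ∀ x ∈ φ.target, SegreAt (g.components φ) x) :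
    IsMetricOn φ.target (g.components φ) where
  isOpen := φ.open_target
  smooth i j y hy := (g.smooth φ hφ i j).contDiffAt (φ.open_target.mem_nhds hy)
  symm y _ := by
    ext i j
    exact g.symm _ _ _
  det y hy := (hS y hy).det

/-- The composition of a chart with a local diffeomorphism of its target. -/
lemma trans_mem_maximalAtlas (hφ : φ ∈ IsManifold.maximalAtlas (𝓡 4) ∞ M)
    {e : OpenPartialHomeomorph R4 R4} (he : ContDiffOn ℝ ∞ e e.source)
    (he' : ContDiffOn ℝ ∞ e.symm e.target) :
    φ.trans e ∈ IsManifold.maximalAtlas (𝓡 4) ∞ M := by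
  refine OpenPartialHomeomorph.mem_maximalAtlas_of_contMDiffOn _ ?_ ?_
  · exact (contMDiffOn_iff_contDiffOn.2 he).comp
      ((contMDiffOn_of_mem_maximalAtlas hφ).mono fun y hy => hy.1) fun y hy => hy.2
  · exact (contMDiffOn_symm_of_mem_maximalAtlas hφ).comp
      ((contMDiffOn_iff_contDiffOn.2 he').mono fun y hy => hy.1) fun y hy => hy.2

end Manifold

end Coord

/-! ### A single curvature index on a connected manifold. -/

namespace Coord

open Filter Topology Matrix

/-- The curvature of the space sections, in terms of the Ricci tensor. -/
noncomputable def ricCurv (G : R4 → Matrix (Fin 4) (Fin 4) ℝ) (x : R4) : ℝ :=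
  (eigThree (ricUp G x) - eigOne (ricUp G x) / 3
    + 2 * (∑ a, ∑ b, pd a (fun y => eigThree (ricUp G y)) x * (G x)⁻¹ a b
        * pd b (fun y => eigThree (ricUp G y)) x)
      / (eigThree (ricUp G x) - eigOne (ricUp G x)) ^ 2) / 2

/-- dρ₂ = Hσu with u unit timelike gives g⁻¹(dρ₂, dρ₂) = −H²σ². Thus H², and with it K, is a scalar
of the metric, independent of the local frame; this allows K to be compared between charts. -/
lemma RWFrame.ricCurv_eq {W : Set R4} {G : R4 → Matrix (Fin 4) (Fin 4) ℝ}
    {u : R4 → Matrix (Fin 4) Unit ℝ} {H : R4 → ℝ}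
    (F : RWFrame W G u (fun x => eigOne (ricUp G x)) (fun x => eigThree (ricUp G x)) H) {x : R4}
    (hx : x ∈ W) : ricCurv G x
      = spaceCurv (fun x => eigOne (ricUp G x)) (fun x => eigThree (ricUp G x)) H x := by
  have hσ : eigThree (ricUp G x) - eigOne (ricUp G x) ≠ 0 := sub_ne_zero.2 (F.ne x hx).symm
  have h1 : ∑ a, ∑ b, pd a (fun y => eigThree (ricUp G y)) x * (G x)⁻¹ a b
        * pd b (fun y => eigThree (ricUp G y)) x
      = - (H x * (eigThree (ricUp G x) - eigOne (ricUp G x))) ^ 2 := by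
    have h2 := congrFun (congrFun (F.norm x hx) ()) ()
    simp only [Matrix.mul_apply, Matrix.transpose_apply, Matrix.neg_apply, Matrix.one_apply_eq,
      Finset.mul_sum] at h2
    have h3 : ∀ a b, pd a (fun y => eigThree (ricUp G y)) x * (G x)⁻¹ a b
        * pd b (fun y => eigThree (ricUp G y)) x
        = (H x * (eigThree (ricUp G x) - eigOne (ricUp G x))) ^ 2
          * (u x a () * ((G x)⁻¹ a b * u x b ())) := fun a b => by
      rw [F.pd_two x hx, F.pd_two x hx]; ring
    simp only [h3, ← Finset.mul_sum] at h2 ⊢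
    rw [h2]; ring
  rw [ricCurv, h1, spaceCurv]
  field_simp
  ring

/-- The sign of the curvature of the space sections is locally constant. -/
lemma RWFrame.sign_ricCurv {W : Set R4} {G : R4 → Matrix (Fin 4) (Fin 4) ℝ}
    {u : R4 → Matrix (Fin 4) Unit ℝ} {H : R4 → ℝ}
    (F : RWFrame W G u (fun x => eigOne (ricUp G x)) (fun x => eigThree (ricUp G x)) H) {x₀ : R4}
    (hx₀ : x₀ ∈ W) : ∀ᶠ y in 𝓝 x₀, Real.sign (ricCurv G y) = Real.sign (ricCurv G x₀) := by
  obtain ⟨r, hr, hW⟩ := Metric.isOpen_iff.1 F.metric.isOpen x₀ hx₀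
  -- Near x₀ the product A²K is constant with A > 0, so K keeps its sign, zero included.
  obtain ⟨t, A, -, -, -, h⟩ := F.exists_time_scale hW one_pos
  filter_upwards [Metric.ball_mem_nhds x₀ hr] with y hy
  obtain ⟨hA, hK, -⟩ := h y hy
  rw [one_pow, one_mul, ← F.ricCurv_eq hx₀, ← F.ricCurv_eq (hW hy)] at hK
  rw [← hK]
  have hA2 : 0 < A y ^ 2 := by positivity
  rcases lt_trichotomy (ricCurv G y) 0 with h0 | h0 | h0
  · rw [Real.sign_of_neg h0, Real.sign_of_neg (mul_neg_of_pos_of_neg hA2 h0)]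
  · rw [h0, mul_zero]
  · rw [Real.sign_of_pos h0, Real.sign_of_pos (mul_pos hA2 h0)]

namespace IsCoordChange

variable {V U : Set R4} {τ : R4 → R4} {x : R4} {G G' : R4 → Matrix (Fin 4) (Fin 4) ℝ}

lemma ricUp_eq (h : IsCoordChange V U τ) (hG : IsMetricOn U G)
    (hG' : ∀ y ∈ V, G' y = (jac τ y)ᵀ * G (τ y) * jac τ y) (hx : x ∈ V) :
    ricUp G' x = (jac τ x)⁻¹ * ricUp G (τ x) * jac τ x := h.inv_mul_ric_eq hG hG' hx

lemma ricCurv_eq (h : IsCoordChange V U τ) (hG : IsMetricOn U G)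
    (hG' : ∀ y ∈ V, G' y = (jac τ y)ᵀ * G (τ y) * jac τ y) (hx : x ∈ V)
    (hd : DifferentiableAt ℝ (fun y => eigThree (ricUp G y)) (τ x)) :
    ricCurv G' x = ricCurv G (τ x) := by
  have h1 : ∀ y ∈ V, eigOne (ricUp G' y) = eigOne (ricUp G (τ y)) := fun y hy => by
    rw [h.ricUp_eq hG hG' hy, eigOne_conj (h.det y hy)]
  have h3 : ∀ y ∈ V, eigThree (ricUp G' y) = eigThree (ricUp G (τ y)) := fun y hy => by
    rw [h.ricUp_eq hG hG' hy, eigThree_conj (h.det y hy)]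
  have hp : ∀ c, pd c (fun y => eigThree (ricUp G' y)) x
      = ∑ d, jac τ x d c * pd d (fun y => eigThree (ricUp G y)) (τ x) := fun c => by
    rw [pd_congr_on h.isOpen h3 hx, h.pd_comp hx hd]
  set D : Matrix (Fin 4) Unit ℝ := Matrix.of fun a _ => pd a (fun y => eigThree (ricUp G y)) (τ x)
    with hD
  set D' : Matrix (Fin 4) Unit ℝ := Matrix.of fun a _ => pd a (fun y => eigThree (ricUp G' y)) x
    with hD'
  have hDD : D' = (jac τ x)ᵀ * D := by
    ext a i
    simp only [hD', hD, Matrix.of_apply, hp, Matrix.mul_apply, Matrix.transpose_apply]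
  have hs : ∀ (B : Matrix (Fin 4) Unit ℝ) (g : Matrix (Fin 4) (Fin 4) ℝ),
      ∑ a, ∑ b, B a () * g a b * B b () = (Bᵀ * g * B) () () := by
    intro B g
    simp only [Matrix.mul_apply, Matrix.transpose_apply, Finset.sum_mul]
    exact Finset.sum_comm
  have hdT : IsUnit ((jac τ x)ᵀ).det := by rw [Matrix.det_transpose]; exact h.det x hx
  have hq : D'ᵀ * (G' x)⁻¹ * D' = Dᵀ * (G (τ x))⁻¹ * D := by
    rw [hDD, hG' x hx, Matrix.mul_inv_rev, Matrix.mul_inv_rev, Matrix.transpose_mul,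
      Matrix.transpose_transpose]
    simp only [Matrix.mul_assoc]
    rw [← Matrix.mul_assoc ((jac τ x)ᵀ)⁻¹ (jac τ x)ᵀ, Matrix.nonsing_inv_mul _ hdT, Matrix.one_mul,
      ← Matrix.mul_assoc (jac τ x) (jac τ x)⁻¹, Matrix.mul_nonsing_inv _ (h.det x hx),
      Matrix.one_mul]
  have e1 := hs D' (G' x)⁻¹
  have e2 := hs D (G (τ x))⁻¹
  simp only [hD', hD, Matrix.of_apply] at e1 e2
  rw [ricCurv, ricCurv, h1 x hx, h3 x hx, e1, e2, ← hD, ← hD', hq]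

end IsCoordChange

section Manifold

variable {M : Type*} [TopologicalSpace M] [ChartedSpace R4 M] [IsManifold (𝓡 4) ∞ M]

/-- An invariant scalar which is locally constant in every chart is constant. -/
lemma exists_const_of_invariant [ConnectedSpace M] {s : OpenPartialHomeomorph M R4 → R4 → ℝ}
    (hinv : ∀ φ ∈ IsManifold.maximalAtlas (𝓡 4) ∞ M, ∀ ψ ∈ IsManifold.maximalAtlas (𝓡 4) ∞ M,
      ∀ x ∈ (φ.symm.trans ψ).source, s φ x = s ψ ((φ.symm.trans ψ) x))
    (hloc : ∀ φ ∈ IsManifold.maximalAtlas (𝓡 4) ∞ M, ∀ x ∈ φ.target,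
      ∀ᶠ y in 𝓝 x, s φ y = s φ x) :
    ∃ c, ∀ φ ∈ IsManifold.maximalAtlas (𝓡 4) ∞ M, ∀ x ∈ φ.target, s φ x = c := by
  have hch : ∀ p : M, chartAt R4 p ∈ IsManifold.maximalAtlas (𝓡 4) ∞ M := fun p =>
    IsManifold.chart_mem_maximalAtlas p
  set S : M → ℝ := fun p => s (chartAt R4 p) (chartAt R4 p p) with hS
  have h1 : ∀ φ ∈ IsManifold.maximalAtlas (𝓡 4) ∞ M, ∀ x ∈ φ.target, s φ x = S (φ.symm x) :=
    fun φ hφ x hx => hinv φ hφ _ (hch _) x ⟨hx, mem_chart_source R4 _⟩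
  have h2 : IsLocallyConstant S := by
    rw [IsLocallyConstant.iff_eventually_eq]
    intro p
    have hp := mem_chart_source R4 p
    have h3 := (((chartAt R4 p).continuousAt hp).eventually
      (hloc _ (hch p) _ ((chartAt R4 p).map_source hp)))
    filter_upwards [h3, (chartAt R4 p).open_source.mem_nhds hp] with q hq hqs
    have h4 := h1 _ (hch p) _ ((chartAt R4 p).map_source hqs)
    rw [(chartAt R4 p).left_inv hqs] at h4
    rw [← h4, hq]
  obtain ⟨p₀⟩ := (inferInstance : Nonempty M)
  exact ⟨S p₀, fun φ hφ x hx => (h1 φ hφ x hx).trans (h2.apply_eq_of_preconnectedSpace _ _)⟩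

variable {g : LorentzMetric M}

lemma ricciScalar_components_eq (hS : g.HasSegreType_1_111) {φ ψ : OpenPartialHomeomorph M R4}
    (hφ : φ ∈ IsManifold.maximalAtlas (𝓡 4) ∞ M)
    (hψ : ψ ∈ IsManifold.maximalAtlas (𝓡 4) ∞ M) {x : R4} (hx : x ∈ (φ.symm.trans ψ).source) :
    ricciScalar (g.components φ) x = ricciScalar (g.components ψ) ((φ.symm.trans ψ) x) := by
  have hMφ := isMetricOn_components g hφ (hS φ hφ)
  have hMψ := isMetricOn_components g hψ (hS ψ hψ)
  have hτ := isCoordChange_transition hφ hψ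
  rw [ricciScalar_eq _ ((show SegreAt _ _ from hS φ hφ x hx.1).ric_symm (hMφ.symm x hx.1)),
    ricciScalar_eq _ ((show SegreAt _ _ from hS ψ hψ _ (hτ.mapsTo x hx)).ric_symm
      (hMψ.symm _ (hτ.mapsTo x hx))),
    hτ.inv_mul_ric_eq hMψ (fun y hy => components_eq g hφ hψ hy) hx, trace_conj (hτ.det x hx)]

lemma ricciScalar_const [ConnectedSpace M] (hS : g.HasSegreType_1_111)
    (hY : g.IsYangPureSpace) : g.HasConstantRicciScalar := by
  refine exists_const_of_invariant (s := fun φ => ricciScalar (g.components φ))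
    (fun φ hφ ψ hψ x hx => ricciScalar_components_eq hS hφ hψ hx) fun φ hφ x hx => ?_
  have hM := isMetricOn_components g hφ (hS φ hφ)
  have hsym : ∀ y ∈ φ.target, (ric (g.components φ) y)ᵀ = ric (g.components φ) y := fun y hy =>
    (show SegreAt _ _ from hS φ hφ y hy).ric_symm (hM.symm y hy)
  obtain ⟨r, hr, hb⟩ := Metric.isOpen_iff.1 φ.open_target x hx
  have hsm : SmoothOn φ.target fun y => ((g.components φ y)⁻¹ * ric (g.components φ) y).trace :=
    (hM.smooth_inv.mul hM.smooth_ric).trace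
  filter_upwards [Metric.ball_mem_nhds x hr] with y hy
  rw [ricciScalar_eq _ (hsym y (hb hy)), ricciScalar_eq _ (hsym x hx)]
  refine eq_of_pd_eq_zero (hsm.mono hb) (fun z hz a => ?_) hy
  refine hM.pd_trace_of_yang hsym (hb hz) (fun a b c => ?_) a
  rw [← covRicci_eq, ← covRicci_eq]
  exact hY φ hφ z (hb hz) a b c

lemma exists_rwFrame_components (hS : g.HasSegreType_1_111) (hY : g.IsYangPureSpace)
    {φ : OpenPartialHomeomorph M R4} (hφ : φ ∈ IsManifold.maximalAtlas (𝓡 4) ∞ M) {x : R4}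
    (hx : x ∈ φ.target) : ∃ W ⊆ φ.target, x ∈ W ∧ ∃ u H, RWFrame W (g.components φ) u
      (fun x => eigOne (ricUp (g.components φ) x)) (fun x => eigThree (ricUp (g.components φ) x))
      H :=
  exists_rwFrame (isMetricOn_components g hφ (hS φ hφ)) (hS φ hφ)
    (fun y hy a b c => by
      rw [← covRicci_eq, ← covRicci_eq]
      exact hY φ hφ y hy a b c) hx

lemma exists_sign_ricCurv [ConnectedSpace M] (hS : g.HasSegreType_1_111)
    (hY : g.IsYangPureSpace) :
    ∃ k, ∀ φ ∈ IsManifold.maximalAtlas (𝓡 4) ∞ M, ∀ x ∈ φ.target,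
      Real.sign (ricCurv (g.components φ) x) = k := by
  refine exists_const_of_invariant (s := fun φ x => Real.sign (ricCurv (g.components φ) x))
    (fun φ hφ ψ hψ x hx => ?_) fun φ hφ x hx => ?_
  · have hτ := isCoordChange_transition hφ hψ
    obtain ⟨W, -, hxW, u, H, F⟩ := exists_rwFrame_components hS hY hψ (hτ.mapsTo x hx)
    rw [hτ.ricCurv_eq (isMetricOn_components g hψ (hS ψ hψ))
      (fun y hy => components_eq g hφ hψ hy) hx (F.smooth_two.differentiableAt hxW)]
  · obtain ⟨W, -, hxW, u, H, F⟩ := exists_rwFrame_components hS hY hφ hx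
    exact F.sign_ricCurv hxW

/-- A Yang pure space of Segré type `{1,(111)}` is a Robertson–Walker space-time. -/
theorem isRobertsonWalker_of_yang [ConnectedSpace M] (hS : g.HasSegreType_1_111)
    (hY : g.IsYangPureSpace) : g.IsRobertsonWalker := by
  obtain ⟨k, hk⟩ := exists_sign_ricCurv hS hY
  obtain ⟨p₀⟩ := (inferInstance : Nonempty M)
  refine ⟨k, ?_, fun p => ?_⟩
  · rw [← hk _ (IsManifold.chart_mem_maximalAtlas p₀) _ (mem_chart_target R4 p₀)]
    rcases Real.sign_apply_eq (ricCurv (g.components (chartAt R4 p₀)) (chartAt R4 p₀ p₀)) with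
      h | h | h <;> simp [h]
  set φ := chartAt R4 p with hφdef
  have hφ : φ ∈ IsManifold.maximalAtlas (𝓡 4) ∞ M := IsManifold.chart_mem_maximalAtlas p
  have hp : p ∈ φ.source := mem_chart_source R4 p
  obtain ⟨W, hW, hxW, u, H, F⟩ := exists_rwFrame_components hS hY hφ (φ.map_source hp)
  -- The value c of the scale factor at the base point is free. With K the curvature there, c =
  -- |K|^(−1/2), or 1 when K = 0, normalises c²K to the sign of K.
  obtain ⟨c, hc, hck⟩ : ∃ c : ℝ, 0 < c ∧ c ^ 2 * ricCurv (g.components φ) (φ p) = k := by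
    rw [← hk φ hφ _ (φ.map_source hp)]
    rcases lt_trichotomy (ricCurv (g.components φ) (φ p)) 0 with h | h | h
    · refine ⟨(Real.sqrt (- ricCurv (g.components φ) (φ p)))⁻¹,
        inv_pos.2 (Real.sqrt_pos.2 (by linarith)), ?_⟩
      rw [Real.sign_of_neg h, inv_pow, Real.sq_sqrt (by linarith)]
      have := h.ne
      field_simp
    · exact ⟨1, one_pos, by rw [h]; simp⟩
    · refine ⟨(Real.sqrt (ricCurv (g.components φ) (φ p)))⁻¹, inv_pos.2 (Real.sqrt_pos.2 h), ?_⟩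
      rw [Real.sign_of_pos h, inv_pow, Real.sq_sqrt h.le, inv_mul_cancel₀ h.ne']
  rw [F.ricCurv_eq hxW] at hck
  obtain ⟨e, hxe, heW, hes, hes', hec, A, hA, hall⟩ := F.exists_chart hxW hc hck
  have hχ := trans_mem_maximalAtlas hφ hes hes'
  have heφ : e.source ⊆ φ.target := heW.trans hW
  have htar : (φ.trans e).target ⊆ e.target := fun y hy => hy.1
  refine ⟨φ.trans e, hχ, ⟨hp, hxe⟩, A, hA.mono (Set.image_mono htar), fun y hy => ?_⟩
  have hy' := htar hy
  have hx := e.map_target hy'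
  set x := e.symm y with hxdef
  have hex : e x = y := e.right_inv hy'
  obtain ⟨h1, h2, h3⟩ := hall x hx
  rw [hex] at h1 h2 h3
  refine ⟨h1, h2, ?_⟩
  have hτs : x ∈ (φ.symm.trans (φ.trans e)).source := by
    refine ⟨heφ hx, φ.map_target (heφ hx), ?_⟩
    change φ (φ.symm x) ∈ e.source
    rw [φ.right_inv (heφ hx)]
    exact hx
  have hτe : ∀ z ∈ φ.target, (φ.symm.trans (φ.trans e)) z = e z := fun z hz => by
    change e (φ (φ.symm z)) = e z
    rw [φ.right_inv hz]
  have hjac : jac (φ.symm.trans (φ.trans e)) x = jac e x := by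
    ext a b
    exact pd_congr_on φ.open_target (fun z hz => by rw [hτe z hz]) (heφ hx) b
  -- The components in φ are the pullback, by the same Jacobian, of the components in the new chart
  -- and of `rwMetric`; cancelling the Jacobian identifies the two.
  have h4 := components_eq g hφ hχ hτs
  rw [hτe x (heφ hx), hex, hjac, h3] at h4
  have hJ := hec.det x hx
  have hJT : IsUnit ((jac e x)ᵀ).det := by rw [Matrix.det_transpose]; exact hJ
  have h5 := congrArg (fun B => ((jac e x)ᵀ)⁻¹ * (B * (jac e x)⁻¹)) h4
  simp only [Matrix.mul_assoc, Matrix.mul_nonsing_inv _ hJ, Matrix.mul_one] at h5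
  rw [← Matrix.mul_assoc, ← Matrix.mul_assoc, Matrix.nonsing_inv_mul _ hJT, Matrix.one_mul,
    Matrix.one_mul] at h5
  exact h5.symm

end Manifold

end Coord

namespace Coord

open Filter Topology Matrix

/-! ### Perfect fluids with shear-free irrotational geodesic flow -/

namespace IsMetricOn

variable {U : Set R4} {G : R4 → Matrix (Fin 4) (Fin 4) ℝ} {u : R4 → Matrix (Fin 4) Unit ℝ}
  {H : R4 → ℝ} {x : R4}

/-- The divergence of the Ricci tensor. -/
lemma divergence_ric (hG : IsMetricOn U G) (hx : x ∈ U) (e : Fin 4) :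
    pd e (fun y => ((G y)⁻¹ * ric G y).trace) x
      = 2 * ∑ a, ((G x)⁻¹ * covB (chr G) a (ric G) x) a e := by
  have h1 : ∀ a, mpd a (fun y => (G y)⁻¹ * ric G y) x + chr G a x * ((G x)⁻¹ * ric G x)
      - ((G x)⁻¹ * ric G x) * chr G a x = (G x)⁻¹ * covB (chr G) a (ric G) x := by
    intro a
    rw [mpd_mul a hG.smooth_inv hG.smooth_ric hx, hG.mpd_inv_eq hx, covB]
    noncomm_ring
  rw [hG.contracted_bianchi hx e]
  simp only [h1]

/-- The Ricci identity for a one-form with `∇_a u_b = H (g_ab + u_a u_b)`. -/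
lemma ric_mul_dual (hG : IsMetricOn U G) (hu : MSmoothOn U u) (hH : SmoothOn U H)
    (hcov : ∀ y ∈ U, ∀ a b, covV (chr G) a u y b () = H y * (G y a b + u y a () * u y b ()))
    (hx : x ∈ U) {η : ℝ} (hη : ∀ a, pd a H x = η * u x a ()) (d : Fin 4) :
    ∑ b, ric G x b d * dualV G u x b () = - (3 * (η - H x ^ 2)) * u x d () := by
  set h : Fin 4 → R4 → Matrix (Fin 4) Unit ℝ := fun d y =>
    Matrix.of fun b _ => G y d b + u y d () * u y b () with hh
  have sh : ∀ d, MSmoothOn U (h d) := fun d b _ =>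
    (hG.smooth d b).add ((hu d ()).mul (hu b ()))
  have hmu : ∀ y ∈ U, ∀ d, mpd d u y = (chr G d y)ᵀ * u y + H y • h d y := by
    intro y hy d
    have : mpd d u y = (chr G d y)ᵀ * u y + covV (chr G) d u y := by rw [covV]; abel
    rw [this]
    congr 1
    ext b i
    exact hcov y hy d b
  have hpu : ∀ d b, pd d (fun y => u y b ()) x
      = ∑ e, chr G d x e b * u x e () + H x * (G x d b + u x d () * u x b ()) := by
    intro d b
    have := congrFun (congrFun (hmu x hx d) b) ()
    simp only [Matrix.add_apply, Matrix.mul_apply, Matrix.transpose_apply] at this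
    exact this
  have key : ∀ c d, mpd c (mpd d u) x = (mpd c (chr G d) x)ᵀ * u x
      + (chr G d x)ᵀ * ((chr G c x)ᵀ * u x + H x • h c x)
      + (pd c H x • h d x + H x • mpd c (h d) x) := by
    intro c d
    rw [mpd_congr_on hG.isOpen (fun y hy => hmu y hy d) hx c,
      mpd_add (U := U) c ((hG.smooth_chr d).transpose.mul hu) (MSmoothOn.smul hH (sh d)) hx,
      mpd_mul c (hG.smooth_chr d).transpose hu hx, mpd_smul c hH (sh d) hx, mpd_transpose,
      hmu x hx c]
  have hmh : ∀ c d b, mpd c (h d) x b () = ∑ e, chr G c x e d * G x e b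
      + ∑ e, G x d e * chr G c x e b + pd c (fun y => u y d ()) x * u x b ()
      + u x d () * pd c (fun y => u y b ()) x := by
    intro c d b
    have h1 : mpd c (h d) x b () = pd c (fun y => G y d b + u y d () * u y b ()) x := rfl
    have h2 := congrFun (congrFun (hG.mpd_eq hx c) d) b
    simp only [Matrix.add_apply, Matrix.mul_apply, Matrix.transpose_apply] at h2
    have h3 : mpd c G x d b = pd c (fun y => G y d b) x := rfl
    rw [h1, pd_add c ((hG.smooth d b).differentiableAt hx)
      (((hu d ()).mul (hu b ())).differentiableAt hx),
      pd_mul c ((hu d ()).differentiableAt hx) ((hu b ()).differentiableAt hx), ← h3, h2]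
    ring
  have hGs : ∀ a b, G x a b = G x b a := fun a b =>
    (congrFun (congrFun (hG.symm x hx) a) b).symm
  -- The Ricci identity: second derivatives of u commute, and ∇u = H(g + u⊗u) with dH = ηu is
  -- substituted twice.
  have hcu : ∀ c d b, ∑ a, curv (chr G) c d x a b * u x a ()
      = - (η - H x ^ 2) * (u x c () * G x d b - u x d () * G x c b) := by
    intro c d b
    have h1 := mpd_comm d hu hx c
    rw [key, key] at h1
    have h2 := congrFun (congrFun h1 b) ()
    simp only [Matrix.add_apply, Matrix.smul_apply, smul_eq_mul, hmh, hpu, hη, Matrix.mul_add,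
      Matrix.mul_smul, ← Matrix.mul_assoc, ← Matrix.transpose_mul] at h2
    simp only [Matrix.mul_apply, Matrix.transpose_apply, hh, Matrix.of_apply] at h2
    simp only [curv, Matrix.sub_apply, Matrix.add_apply, Matrix.mul_apply]
    simp only [Fin.sum_univ_four, hG.chr_symm hx _ d c] at h2 ⊢
    rw [hGs 0 b, hGs 1 b, hGs 2 b, hGs 3 b, hGs d 0, hGs d 1, hGs d 2, hGs d 3, hGs c 0, hGs c 1,
      hGs c 2, hGs c 3] at h2
    linear_combination -h2 + H x ^ 2 * u x b () * hGs d c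
  have hN := hG.curv_mul_inv_antisymm hx
  have h1 : ∀ c, (curv (chr G) c d x * dualV G u x) c ()
      = (η - H x ^ 2) * (u x c () * (1 : Matrix (Fin 4) (Fin 4) ℝ) d c - u x d ()) := by
    intro c
    have e1 : curv (chr G) c d x * dualV G u x = curv (chr G) c d x * (G x)⁻¹ * u x := by
      rw [dualV, Matrix.mul_assoc]
    have e2 : ((curv (chr G) c d x * dualV G u x))ᵀ
        = - ((u x)ᵀ * curv (chr G) c d x * (G x)⁻¹) := by
      rw [e1, Matrix.transpose_mul, hN, Matrix.mul_neg, Matrix.mul_assoc]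
    have e3 := congrFun (congrFun e2 ()) c
    rw [Matrix.transpose_apply, Matrix.neg_apply] at e3
    rw [e3, Matrix.mul_apply]
    have e4 : ∀ b, ((u x)ᵀ * curv (chr G) c d x) () b
        = - (η - H x ^ 2) * (u x c () * G x d b - u x d () * G x c b) := fun b => by
      rw [← hcu, Matrix.mul_apply]
      exact Finset.sum_congr rfl fun a _ => mul_comm _ _
    have e5 : ∀ a, ∑ b, G x a b * (G x)⁻¹ b c = (1 : Matrix (Fin 4) (Fin 4) ℝ) a c := fun a => by
      rw [← Matrix.mul_apply, Matrix.mul_nonsing_inv _ (hG.det x hx)]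
    have e6 := e5 d
    have e7 := e5 c
    rw [Matrix.one_apply_eq] at e7
    simp only [e4, Fin.sum_univ_four] at e6 e7 ⊢
    linear_combination (η - H x ^ 2) * (u x c () * e6 - u x d () * e7)
  have h2 : ∑ b, ric G x b d * dualV G u x b () = ∑ c, (curv (chr G) c d x * dualV G u x) c () := by
    simp only [ric_apply, Finset.sum_mul, Matrix.mul_apply]
    exact Finset.sum_comm
  rw [h2]
  simp only [h1, ← Finset.mul_sum, Finset.sum_sub_distrib, Matrix.one_apply, mul_ite, mul_one,
    mul_zero, Finset.sum_ite_eq, Finset.mem_univ, if_true, Finset.sum_const, Finset.card_univ,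
    Fintype.card_fin, nsmul_eq_mul]
  push_cast
  ring

/-- A perfect fluid with constant Ricci scalar and shear-free irrotational geodesic flow satisfies
Yang's equations. -/
lemma yang_of_fluid (hG : IsMetricOn U G) (hu : MSmoothOn U u)
    (hn : ∀ y ∈ U, (u y)ᵀ * ((G y)⁻¹ * u y) = -1)
    (hcov : ∀ y ∈ U, ∀ a b, covV (chr G) a u y b () = H y * (G y a b + u y a () * u y b ()))
    {ρ : R4 → ℝ} (hρ : SmoothOn U ρ) {c : ℝ}
    (hric : ∀ y ∈ U, ric G y = ρ y • G y + (4 * ρ y - c) • (u y * (u y)ᵀ))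
    (hR : ∀ y ∈ U, ((G y)⁻¹ * ric G y).trace = c) (hx : x ∈ U) (a b d : Fin 4) :
    covB (chr G) a (ric G) x b d = covB (chr G) b (ric G) x a d := by
  have hσ : SmoothOn U fun y => 4 * ρ y - c := ((SmoothOn.const 4).mul hρ).sub (SmoothOn.const c)
  have hpσ : ∀ a, pd a (fun y => 4 * ρ y - c) x = 4 * pd a ρ x := fun a => by
    rw [pd_sub a ((hρ.differentiableAt hx).const_mul 4) (differentiableAt_const _), pd_const,
      pd_mul a (differentiableAt_const _) (hρ.differentiableAt hx), pd_const]
    ring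
  have hc : ∀ a b d, covB (chr G) a (ric G) x b d = pd a ρ x * (G x b d + 4 * u x b () * u x d ())
      + (4 * ρ x - c) * H x * ((G x a b + u x a () * u x b ()) * u x d ()
        + u x b () * (G x a d + u x a () * u x d ())) := by
    intro a b d
    rw [covB_rank_one hG hu hρ hσ hx a hric]
    simp only [Matrix.add_apply, Matrix.smul_apply, smul_eq_mul, unit_mul_apply,
      Matrix.transpose_apply, hcov x hx, hpσ]
    ring
  have hGs : ∀ a b, G x a b = G x b a := fun a b =>
    (congrFun (congrFun (hG.symm x hx) a) b).symm
  -- With R constant the contracted Bianchi identity makes Ric divergence-free; this is that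
  -- statement for ρ g + (4ρ − c) u⊗u.
  have hdiv : ∀ e, pd e ρ x + 4 * (∑ a, pd a ρ x * dualV G u x a ()) * u x e ()
      + 3 * ((4 * ρ x - c) * H x) * u x e () = 0 := by
    intro e
    have h1 := hG.divergence_ric hx e
    rw [pd_congr_on hG.isOpen hR hx, pd_const] at h1
    have h2 : ∀ a, ((G x)⁻¹ * covB (chr G) a (ric G) x) a e
        = pd a ρ x * ((1 : Matrix (Fin 4) (Fin 4) ℝ) a e + 4 * dualV G u x a () * u x e ())
          + (4 * ρ x - c) * H x * ((1 + u x a () * dualV G u x a ()) * u x e ()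
            + dualV G u x a () * (G x a e + u x a () * u x e ())) := by
      intro a
      have e1 : ∀ b, ∑ f, (G x)⁻¹ a f * G x f b = (1 : Matrix (Fin 4) (Fin 4) ℝ) a b := fun b => by
        rw [← Matrix.mul_apply, Matrix.nonsing_inv_mul _ (hG.det x hx)]
      have e2 := e1 e
      have e3 := e1 a
      have e4 : dualV G u x a () = ∑ e, (G x)⁻¹ a e * u x e () := by rw [dualV, Matrix.mul_apply]
      rw [Matrix.one_apply_eq] at e3
      simp only [Matrix.mul_apply, hc, Fin.sum_univ_four] at e2 e3 e4 ⊢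
      rw [hGs a 0, hGs a 1, hGs a 2, hGs a 3, e4]
      linear_combination pd a ρ x * e2 + (4 * ρ x - c) * H x * u x e () * e3
    have h3 : ∑ a, dualV G u x a () * G x a e = u x e () := by
      have : G x * dualV G u x = u x := by
        rw [dualV, ← Matrix.mul_assoc, Matrix.mul_nonsing_inv _ (hG.det x hx), Matrix.one_mul]
      have := congrFun (congrFun this e) ()
      rw [Matrix.mul_apply] at this
      rw [← this]
      exact Finset.sum_congr rfl fun a _ => by rw [hGs a e, mul_comm]
    have h4 : ∑ a, u x a () * dualV G u x a () = -1 := by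
      have := congrFun (congrFun (hn x hx) ()) ()
      rw [Matrix.mul_apply, Matrix.neg_apply, Matrix.one_apply_eq] at this
      exact this
    have h5 : ∑ a, pd a ρ x * (1 : Matrix (Fin 4) (Fin 4) ℝ) a e = pd e ρ x := by
      simp [Matrix.one_apply]
    simp only [h2, Fin.sum_univ_four] at h1 h3 h4 h5 ⊢
    linear_combination - h1 / 2 - h5 - (4 * ρ x - c) * H x * (2 * u x e () * h4 + h3)
  have h4 : ∑ a, u x a () * dualV G u x a () = -1 := by
    have := congrFun (congrFun (hn x hx) ()) ()
    rw [Matrix.mul_apply, Matrix.neg_apply, Matrix.one_apply_eq] at this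
    exact this
  -- Contracting `hdiv` with the dual vector fixes the derivative of ρ along the flow, and then
  -- `hdiv` gives dρ = (4ρ − c)Hu, exactly what symmetry of ∇Ric requires.
  have hqρ : ∑ a, pd a ρ x * dualV G u x a () = - ((4 * ρ x - c) * H x) := by
    have d0 := hdiv 0
    have d1 := hdiv 1
    have d2 := hdiv 2
    have d3 := hdiv 3
    set s := ∑ a, pd a ρ x * dualV G u x a () with hs
    rw [Fin.sum_univ_four] at hs h4
    linear_combination (-1 / 3) * (dualV G u x 0 () * d0 + dualV G u x 1 () * d1
      + dualV G u x 2 () * d2 + dualV G u x 3 () * d3) - hs / 3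
      + (4 * s + 3 * ((4 * ρ x - c) * H x)) / 3 * h4
  have hpρ : ∀ e, pd e ρ x = (4 * ρ x - c) * H x * u x e () := fun e => by
    have := hdiv e
    rw [hqρ] at this
    linear_combination this
  rw [hc, hc, hpρ, hpρ, hGs a b]
  ring

end IsMetricOn

end Coord

/-! ### Isotropic line elements with constant Ricci scalar. -/

namespace Coord

open Filter Topology Matrix

/-- The one-form `du` of the Robertson–Walker coordinates. -/
def timeForm : Matrix (Fin 4) Unit ℝ := Matrix.of fun a _ => if a = 0 then 1 else 0

/-- The hypersurfaces of constant time of a metric `-du² + s (dx² + dy² + dz²)` are umbilic, if the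
logarithmic derivative of `s` with respect to time is a function of time. -/
lemma covV_timeForm {U : Set R4} {G : R4 → Matrix (Fin 4) (Fin 4) ℝ} (hG : IsMetricOn U G)
    {s H : R4 → ℝ} (hs : ∀ x ∈ U, G x = Matrix.diagonal ![-1, s x, s x, s x])
    (hsd : ∀ x ∈ U, pd 0 s x = -2 * H x * s x) {x : R4} (hx : x ∈ U) (a b : Fin 4) :
    covV (chr G) a (fun _ => timeForm) x b ()
      = H x * (G x a b + timeForm a () * timeForm b ()) := by
  -- Since u has constant components, g₀₀ = −1 and g₀ᵢ = 0, one has ∇_a u_b = −Γ⁰_ab = −½ ∂₀ g_ab.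
  have h1 : covV (chr G) a (fun _ => timeForm) x b () = - chr G a x 0 b := by
    simp [covV, timeForm, Matrix.mul_apply]
  have h2 := congrFun (congrFun (hG.mul_chr hx a) 0) b
  have h3 : (G x * chr G a x) 0 b = - chr G a x 0 b := by
    rw [hs x hx, Matrix.diagonal_mul]
    simp
  have h4 : ∀ c d, mpd c G x 0 d = 0 := by
    intro c d
    have : mpd c G x 0 d = pd c (fun _ => Matrix.diagonal ![(-1 : ℝ), 0, 0, 0] 0 d) x := by
      refine pd_congr_on hG.isOpen (fun y hy => ?_) hx c
      rw [hs y hy]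
      by_cases hd : 0 = d
      · subst hd; simp
      · rw [Matrix.diagonal_apply_ne _ hd, Matrix.diagonal_apply_ne _ hd]
    rw [this, pd_const]
  have h5 : mpd 0 G x a b = -2 * H x * (G x a b + timeForm a () * timeForm b ()) := by
    by_cases hab : a = b
    · subst hab
      by_cases ha : a = 0
      · subst ha
        rw [h4, hs x hx]
        simp [timeForm]
      · have : mpd 0 G x a a = pd 0 s x := by
          refine pd_congr_on hG.isOpen (fun y hy => ?_) hx 0
          rw [hs y hy]
          fin_cases a <;> simp at ha ⊢
        rw [this, hsd x hx, hs x hx]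
        fin_cases a <;> simp [timeForm] at ha ⊢
    · have : mpd 0 G x a b = pd 0 (fun _ => (0 : ℝ)) x := by
        refine pd_congr_on hG.isOpen (fun y hy => ?_) hx 0
        rw [hs y hy, Matrix.diagonal_apply_ne _ hab]
      rw [this, pd_const, hs x hx, Matrix.diagonal_apply_ne _ hab]
      have : timeForm a () * timeForm b () = 0 := by
        simp only [timeForm, Matrix.of_apply]
        by_cases ha : a = 0 <;> by_cases hb : b = 0 <;> simp_all
      rw [this]; ring
  rw [h1, ← h3, h2]
  simp only [chrLow, Matrix.of_apply, h4, h5]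
  ring

/-- A metric of Segré type `{1,(111)}` and constant Ricci scalar of the form
`-du² + s (dx² + dy² + dz²)`, with the logarithmic derivative of `s` with respect to time a function
of time, satisfies Yang's equations. -/
theorem yang_of_isotropic {U : Set R4} {G : R4 → Matrix (Fin 4) (Fin 4) ℝ} (hG : IsMetricOn U G)
    (hS : ∀ x ∈ U, SegreAt G x) {s H : R4 → ℝ}
    (hs : ∀ x ∈ U, G x = Matrix.diagonal ![-1, s x, s x, s x]) (hs0 : ∀ x ∈ U, 0 < s x)
    (hsd : ∀ x ∈ U, pd 0 s x = -2 * H x * s x) (hH : SmoothOn U H)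
    (hHd : ∀ x ∈ U, ∀ a, a ≠ 0 → pd a H x = 0) {c : ℝ}
    (hR : ∀ x ∈ U, ((G x)⁻¹ * ric G x).trace = c) {x : R4} (hx : x ∈ U) (a b d : Fin 4) :
    covB (chr G) a (ric G) x b d = covB (chr G) b (ric G) x a d := by
  have hu : MSmoothOn U fun _ => timeForm := MSmoothOn.const _
  have hinv : ∀ y ∈ U, (G y)⁻¹ = Matrix.diagonal ![-1, (s y)⁻¹, (s y)⁻¹, (s y)⁻¹] := by
    intro y hy
    refine Matrix.inv_eq_right_inv ?_
    rw [hs y hy, Matrix.diagonal_mul_diagonal, ← Matrix.diagonal_one]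
    congr 1
    have := (hs0 y hy).ne'
    funext i
    fin_cases i <;> simp [this]
  have hdual : ∀ y ∈ U, (G y)⁻¹ * timeForm = - timeForm := by
    intro y hy
    rw [hinv y hy]
    ext i j
    rw [Matrix.diagonal_mul]
    fin_cases i <;> simp [timeForm]
  have htt : timeFormᵀ * timeForm = 1 := by
    ext i j
    simp [Matrix.mul_apply, timeForm]
  have hn : ∀ y ∈ U, timeFormᵀ * ((G y)⁻¹ * timeForm) = -1 := by
    intro y hy
    rw [hdual y hy, Matrix.mul_neg, htt]
  have hcov := fun y (hy : y ∈ U) => covV_timeForm hG hs hsd hy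
  -- H depends on time only, so the Ricci identity shows that du is an eigenform of the Ricci
  -- tensor.
  have hric0 : ∀ y ∈ U, ∃ l : ℝ, ∀ d, ric G y 0 d = l * timeForm d () := by
    intro y hy
    refine ⟨3 * (pd 0 H y - H y ^ 2), fun d => ?_⟩
    have h1 := hG.ric_mul_dual hu hH hcov hy (η := pd 0 H y) (fun a => ?_) d
    · have h2 : ∀ b, dualV G (fun _ => timeForm) y b () = - timeForm b () := fun b => by
        rw [dualV, hdual y hy, Matrix.neg_apply]
      simp only [h2] at h1
      simp only [timeForm, Matrix.of_apply, mul_neg, mul_ite, mul_one, mul_zero,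
        Finset.sum_neg_distrib, Finset.sum_ite_eq', Finset.mem_univ, if_true] at h1 ⊢
      split_ifs at h1 ⊢ <;> linarith
    · by_cases ha : a = 0
      · subst ha; simp [timeForm]
      · rw [hHd y hy a ha]; simp [timeForm, ha]
  -- The Segré eigenform is unit timelike, so its time component is nonzero, and R₀d = 0 for d ≠ 0
  -- kills its other components: it is a multiple of du. Isotropy of the remaining Ricci components
  -- comes from the Segré type, not from computation.
  have hform : ∀ y ∈ U, ∃ ρ σ : ℝ, ric G y = ρ • G y + σ • (timeForm * timeFormᵀ) := by
    intro y hy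
    obtain ⟨hne, -, P, u, -, -, hun, hr⟩ := (hS y hy).exists_frame (hG.symm y hy)
    obtain ⟨l, hl⟩ := hric0 y hy
    set ρ₁ := eigOne (ricUp G y)
    set ρ₂ := eigThree (ricUp G y)
    have hσ : ρ₂ - ρ₁ ≠ 0 := sub_ne_zero.2 hne.symm
    have hun' := congrFun (congrFun hun ()) ()
    rw [hinv y hy] at hun'
    simp only [Matrix.mul_apply, Matrix.transpose_apply, Matrix.diagonal_apply, ite_mul, zero_mul,
      Finset.sum_ite_eq, Finset.mem_univ, if_true, Fin.sum_univ_four, Matrix.neg_apply,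
      Matrix.one_apply_eq] at hun'
    simp at hun'
    have hsi : 0 < (s y)⁻¹ := inv_pos.2 (hs0 y hy)
    have hu0 : u 0 () ≠ 0 := by
      intro h0
      rw [h0] at hun'
      nlinarith [mul_nonneg hsi.le (mul_self_nonneg (u 1 ())),
        mul_nonneg hsi.le (mul_self_nonneg (u 2 ())), mul_nonneg hsi.le (mul_self_nonneg (u 3 ()))]
    have hui : ∀ d, d ≠ 0 → u d () = 0 := by
      intro d hd
      have h1 := hl d
      rw [hr, hs y hy] at h1
      simp only [Matrix.add_apply, Matrix.smul_apply, Matrix.diagonal_apply_ne _ hd.symm,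
        unit_mul_apply, Matrix.transpose_apply, smul_eq_mul, mul_zero, zero_add, timeForm,
        Matrix.of_apply, if_neg hd] at h1
      rcases mul_eq_zero.1 h1 with h | h
      · exact absurd h hσ
      · exact (mul_eq_zero.1 h).resolve_left hu0
    refine ⟨ρ₂, (ρ₂ - ρ₁) * u 0 () ^ 2, ?_⟩
    have huu : u = u 0 () • timeForm := by
      ext d j
      by_cases hd : d = 0
      · subst hd; simp [timeForm]
      · rw [show j = () from rfl, hui d hd]; simp [timeForm, hd]
    rw [hr, huu]
    simp only [Matrix.transpose_smul, Matrix.smul_mul, Matrix.mul_smul, smul_smul]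
    congr 2
    simp only [Matrix.smul_apply, timeForm, Matrix.of_apply, if_true, smul_eq_mul]
    ring
  -- `hform` gives ρ pointwise; eliminating σ from R₀₀ = −ρ + σ and 4ρ − σ = c gives a smooth
  -- formula.
  set ρ : R4 → ℝ := fun y => (c + ric G y 0 0) / 3 with hρ
  have sρ : SmoothOn U ρ := ((SmoothOn.const c).add (hG.smooth_ric 0 0)).div (SmoothOn.const 3)
    fun _ _ => by norm_num
  refine hG.yang_of_fluid hu hn hcov sρ (c := c) (fun y hy => ?_) hR hx a b d
  obtain ⟨r, σ, h⟩ := hform y hy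
  have h00 : ric G y 0 0 = - r + σ := by
    rw [h, hs y hy]
    simp [timeForm, unit_mul_apply]
  have htr : 4 * r - σ = c := by
    rw [← hR y hy, h, Matrix.mul_add, Matrix.mul_smul, Matrix.mul_smul,
      Matrix.nonsing_inv_mul _ (hG.det y hy), ← Matrix.mul_assoc, hdual y hy, Matrix.trace_add,
      Matrix.trace_smul, Matrix.trace_smul, Matrix.neg_mul, Matrix.trace_neg,
      Matrix.trace_mul_comm, htt]
    simp [Matrix.trace]
    ring
  have hr : ρ y = r := by simp only [hρ]; linarith
  rw [h, hr]
  congr 2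
  linarith

end Coord

/-! ### From Robertson–Walker with constant Ricci scalar to Yang's equations. -/

namespace Coord

open Filter Topology Matrix

/-- The scale factor is smooth on the set of times of a chart; openness of this set is what allows
differentiating it there. -/
lemma isOpen_image_time {U : Set R4} (hU : IsOpen U) : IsOpen ((fun x : R4 => x 0) '' U) := by
  have hs : Function.Surjective (EuclideanSpace.proj 0 : R4 →L[ℝ] ℝ) := fun t =>
    ⟨EuclideanSpace.single 0 t, by simp⟩
  exact (EuclideanSpace.proj 0 : R4 →L[ℝ] ℝ).isOpenMap hs U hU

/-- A Robertson–Walker line element of Segré type `{1,(111)}` with constant Ricci scalar satisfies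
Yang's equations. -/
lemma yang_of_rw {U : Set R4} {G : R4 → Matrix (Fin 4) (Fin 4) ℝ} {x : R4} {k c : ℝ} {A : ℝ → ℝ}
    (hG : IsMetricOn U G) (hS : ∀ y ∈ U, SegreAt G y)
    (hA : ContDiffOn ℝ ∞ A ((fun x : R4 => x 0) '' U))
    (h : ∀ x ∈ U, 0 < A (x 0) ∧ 0 < 1 + k / 4 * (x 1 ^ 2 + x 2 ^ 2 + x 3 ^ 2) ∧
      G x = rwMetric k A x)
    (hR : ∀ y ∈ U, ((G y)⁻¹ * ric G y).trace = c) (hx : x ∈ U) (a b d : Fin 4) :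
    covB (chr G) a (ric G) x b d = covB (chr G) b (ric G) x a d := by
  have hI := isOpen_image_time hG.isOpen
  have hco : ∀ i (y : R4), ContDiffAt ℝ ∞ (fun y : R4 => y i) y := fun i y =>
    (EuclideanSpace.proj i : R4 →L[ℝ] ℝ).contDiff.contDiffAt
  have hdA : ∀ y ∈ U, HasDerivAt A (deriv A (y 0)) (y 0) := fun y hy =>
    ((hA.contDiffAt (hI.mem_nhds ⟨y, hy, rfl⟩)).differentiableAt (by simp)).hasDerivAt
  have hA' : ContDiffOn ℝ ∞ (deriv A) ((fun x : R4 => x 0) '' U) :=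
    hA.deriv_of_isOpen hI (by simp)
  have hH' : ContDiffOn ℝ ∞ (fun t => - deriv A t / A t) ((fun x : R4 => x 0) '' U) :=
    hA'.neg.div hA fun t ht => by
      obtain ⟨y, hy, rfl⟩ := ht
      exact (h y hy).1.ne'
  have hcoD : ∀ i (y : R4), DifferentiableAt ℝ (fun y : R4 => y i) y := fun i y =>
    (hco i y).differentiableAt (by simp)
  set f : R4 → ℝ := fun y => 1 + k / 4 * (y 1 ^ 2 + y 2 ^ 2 + y 3 ^ 2) with hf
  have hfD : ∀ y, DifferentiableAt ℝ f y := fun y => by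
    have h1 := hcoD 1 y
    have h2 := hcoD 2 y
    have h3 := hcoD 3 y
    fun_prop
  have hfp : ∀ y, pd 0 f y = 0 := fun y => by
    have hp : ∀ i : Fin 4, i ≠ 0 → pd 0 (fun y : R4 => y i ^ 2) y = 0 := fun i hi => by
      rw [pd_comp (φ := fun t => t ^ 2) 0 (hasDerivAt_pow 2 _) (hcoD i y), pd_coord, if_neg hi,
        mul_zero]
    have h1 : DifferentiableAt ℝ (fun y : R4 => y 1 ^ 2) y := (hcoD 1 y).pow 2
    have h2 : DifferentiableAt ℝ (fun y : R4 => y 2 ^ 2) y := (hcoD 2 y).pow 2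
    have h3 : DifferentiableAt ℝ (fun y : R4 => y 3 ^ 2) y := (hcoD 3 y).pow 2
    have h12 : DifferentiableAt ℝ (fun y : R4 => y 1 ^ 2 + y 2 ^ 2) y := h1.add h2
    have h123 : DifferentiableAt ℝ (fun y : R4 => y 1 ^ 2 + y 2 ^ 2 + y 3 ^ 2) y := h12.add h3
    rw [hf, pd_add 0 (differentiableAt_const _) (h123.const_mul _), pd_const,
      pd_mul 0 (differentiableAt_const _) h123, pd_const, pd_add 0 h12 h3, pd_add 0 h1 h2, hp 1 (by decide), hp 2 (by decide),
      hp 3 (by decide)]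
    ring
  -- Here s = A²/f² with f independent of time, so ∂₀ s = −2Hs for H = −A'/A.
  refine yang_of_isotropic (s := fun y => A (y 0) ^ 2 / f y ^ 2)
    (H := fun y => - deriv A (y 0) / A (y 0)) hG hS (fun y hy => (h y hy).2.2)
    (fun y hy => ?_) (fun y hy => ?_) (fun y hy => ?_) (fun y hy a ha => ?_) hR hx a b d
  · exact div_pos (pow_pos (h y hy).1 2) (pow_pos (h y hy).2.1 2)
  · have hA0 := (h y hy).1.ne'
    have hf0 : f y ≠ 0 := (h y hy).2.1.ne'
    have hAD : DifferentiableAt ℝ (fun y : R4 => A (y 0)) y :=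
      (hdA y hy).differentiableAt.comp y (hcoD 0 y)
    have hA2 : DifferentiableAt ℝ (fun y : R4 => A (y 0) ^ 2) y := hAD.pow 2
    have hf2 : DifferentiableAt ℝ (fun y : R4 => f y ^ 2) y := (hfD y).pow 2
    rw [pd_div 0 hA2 hf2 (pow_ne_zero 2 hf0),
      pd_comp (f := fun y : R4 => A (y 0)) (φ := fun t => t ^ 2) 0 (hasDerivAt_pow 2 _) hAD,
      pd_comp (f := f) (φ := fun t => t ^ 2) 0 (hasDerivAt_pow 2 _) (hfD y), hfp,
      pd_comp 0 (hdA y hy) (hcoD 0 y), pd_coord, if_pos rfl]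
    field_simp
    ring
  · exact ContDiffAt.comp (g := fun t => - deriv A t / A t) y
      (hH'.contDiffAt (hI.mem_nhds ⟨y, hy, rfl⟩)) (hco 0 y)
  · have h1 := (hH'.contDiffAt (hI.mem_nhds ⟨y, hy, rfl⟩)).differentiableAt (by simp)
    rw [pd_comp a h1.hasDerivAt (hcoD 0 y), pd_coord, if_neg ha.symm, mul_zero]

/-- A Robertson–Walker space-time of Segré type `{1,(111)}` with constant Ricci scalar is a Yang
pure space. -/
theorem isYangPureSpace_of_rw {M : Type*} [TopologicalSpace M] [ChartedSpace R4 M]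
    [IsManifold (𝓡 4) ∞ M] {g : LorentzMetric M} (hS : g.HasSegreType_1_111)
    (hW : g.IsRobertsonWalker) (hR : g.HasConstantRicciScalar) : g.IsYangPureSpace := by
  obtain ⟨k, -, hk⟩ := hW
  obtain ⟨c, hc⟩ := hR
  intro φ hφ x hx a b d
  obtain ⟨χ, hχ, hp, A, hA, h⟩ := hk (φ.symm x)
  have hG := isMetricOn_components g hχ (hS χ hχ)
  have hxs : x ∈ (φ.symm.trans χ).source := ⟨hx, hp⟩
  rw [covRicci_eq, covRicci_eq]
  -- Yang's equations hold in the Robertson–Walker chart around the point and are carried to φ as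
  -- tensor equations.
  refine (isCoordChange_transition hφ hχ).yang_of_yang hG
    (fun y hy => components_eq g hφ hχ hy) hxs
    (yang_of_rw (c := c) hG (hS χ hχ) hA h (fun y hy => ?_) (χ.map_source hp)) a b d
  rw [← ricciScalar_eq _ ((show SegreAt _ _ from hS χ hχ y hy).ric_symm (hG.symm y hy))]
  exact hc χ hχ y hy

end Coord

theorem theoremt {M : Type*} [TopologicalSpace M] [ConnectedSpace M]
    [ChartedSpace R4 M] [IsManifold (𝓡 4) ∞ M]
    (g : LorentzMetric M) (hSegre : g.HasSegreType_1_111) :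
    g.IsYangPureSpace ↔ g.IsRobertsonWalker ∧ g.HasConstantRicciScalar :=
  ⟨fun hY => ⟨Coord.isRobertsonWalker_of_yang hSegre hY, Coord.ricciScalar_const hSegre hY⟩,
    fun h => Coord.isYangPureSpace_of_rw hSegre h.1 h.2⟩
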